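/- **Setting.** Fix $k\in\mathbb N$. A *platform-assisted auction* for $k$ identical items is a family of (possibly multi-round, randomized) protocols, indexed by a security parameter $\lambda$, between a platform, a seller, and any finite set of unit-demand buyers with distinct identities. The identity space has size super-polynomial in $\lambda$, and values lie in a finite set $\mathbb U_\lambda\subset[0,1]$ with $0\in\mathbb U_\lambda$. Each buyer and the seller exchange messages with the platform over a private pairwise channel; there is no other communication and in particular no broadcast channel (no public outcome can be posted). Buyers and the seller know about the other participants only what the platform tells them (including the number of bids). Before the protocol a key setup may give a public string to everyone and a secret key to the platform, the seller and each identity; there is *no PKI* if nobody holds a secret key. All honest players run in (possibly non-uniform) probabilistic time polynomial in $\lambda$ and the number of bids. At the end the platform sends each buyer $i$ either a rejection or a number of items $x_i$ and a payment $p_i\ge 0$, and the seller either a rejection or a number $t\le k$ of items sold and a revenue $\mu\ge0$; each player then accepts or rejects. Required are: if the platform is honest, all honest players take the same decision as the platform, and if everyone is honest everyone accepts; an honest buyer $i$ with input $v_i$ accepts only if $x_i\in\{0,1\}$ and $x_iv_i-p_i\ge0$; if the platform is honest and accepts, then $t=\sum_i x_i$ and $\mu\le\sum_i p_i$. **Utility.**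 If the platform is honest, a buyer with true value $v$ has utility $0$ if the platform rejects; otherwise it gets $v$ if any of its identities obtains an item, minus the payments of its identities that obtain items. An execution with a strategic platform and set $H$ of honest buyers is *safe* if all honest players accept and $\sum_{i\in H}x_i\le t$. A coalition of the platform and a set of buyers $A$ has utility $0$ in an unsafe execution, and otherwise $\sum_{i\in H}p_i-\mu$ plus the sum of the $\min(|A|,\,t-\sum_{i\in H}x_i)$ largest true values of buyers in $A$. **Incentive compatibility.** An auction is *strong computational* IC for a strategic coalition $\mathcal C$ if (i) for every polynomial $n(\cdot)$ and every non-uniform probabilistic polynomial-time strategy of $\mathcal C$ (which may use additional fake identities, and knows the secret keys of its members and of its fake identities) there is a negligible function $\mathrm{negl}$ such that for all $\lambda$, all choices of identities, at most $n(\lambda)$ honest buyers and all true values, the expected utility of $\mathcal C$ is at most its expected utility from honest play plus $\mathrm{negl}(\lambda)$; and (ii) extended input replacement (submitting, instead of the true values, arbitrarily many arbitrary bids under arbitrary identities different from those of the honest buyers, and otherwise following the protocol) never increases the expected utility of $\mathcal C$ at all. It is bIC if $\mathcal C$ is any single buyer and the platform is honest, pIC if $\mathcal C$ is the platform, and $1$-pbIC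 if $\mathcal C$ is the platform together with one buyer. In the Bayesian versions with respect to distributions $\mathcal D_\lambda$ on $\mathbb U_\lambda$, the honest buyers' values are drawn independently from $\mathcal D_\lambda$ (and expected utilities include this draw), while the true values in $\mathcal C$ are arbitrary. **Non-triviality.** The auction is *non-trivial* if there are a polynomial $q>0$ and a polynomial bound $n(\cdot)$ such that for infinitely many $\lambda$ there are at most $n(\lambda)$ buyers and true values in $\mathbb U_\lambda$ for which the expected total buyer utility under honest play is at least $1/q(\lambda)$. It is non-trivial with respect to $\mathcal D_\lambda$ if the same holds with all values drawn independently from $\mathcal D_\lambda$. **Theorem.** Consider such an auction, and assume that there is no PKI or that the seller never sends a message. Let $\mathsf{tick}(\mathbb U_\lambda)$ be the largest distance $|a-b|$ between adjacent elements $a\le b$ of $\mathbb U_\lambda$ (no element of $\mathbb U_\lambda$ lies strictly between them), and assume that $\mathsf{tick}(\mathbb U_\lambda)\le\mathrm{negl}(\lambda)$ for all $\lambda$ and some negligible function $\mathrm{negl}$. Then: 1. If the auction is non-trivial, it is not both strong computational bIC and strong computational $1$-pbIC. 2. For all distributions $\mathcal D_\lambda$ on $\mathbb U_\lambda$: if the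 auction is non-trivial with respect to $\mathcal D_\lambda$, it does not satisfy strong computational Bayesian bIC, strong computational Bayesian pIC and strong computational Bayesian $1$-pbIC with respect to $\mathcal D_\lambda$ all at once. -/

import Mathlib

open scoped BigOperators NNReal

namespace PlatformAuction

/-! ### Asymptotics -/

/-- `f` is bounded by a polynomial in the security parameter. -/
def PolyBounded (f : ℕ → ℕ) : Prop :=
  ∃ P : Polynomial ℕ, ∀ sec, f sec ≤ P.eval sec

/-- Negligible functions: nonnegative and eventually below `1 / p` for every positive polynomial
`p`. -/
def Negligible (ε : ℕ → ℝ) : Prop :=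
  (∀ sec, 0 ≤ ε sec) ∧
    ∀ p : Polynomial ℝ, (∀ m : ℕ, 0 < p.eval (m : ℝ)) →
      ∀ᶠ sec : ℕ in Filter.atTop, ε sec < 1 / p.eval (sec : ℝ)

/-- The largest gap between two adjacent points of a finite set of reals. -/
noncomputable def tick (U : Finset ℝ) : ℝ :=
  sSup {d : ℝ | ∃ a ∈ U, ∃ b ∈ U, a ≤ b ∧ (∀ c ∈ U, ¬ (a < c ∧ c < b)) ∧ d = |a - b|}

/-! ### Boolean circuits and interactive machines -/

/-- An assignment of bits to a set of wires. -/
abbrev Bits (ι : Type) : Type := ι → Bool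

/-- A Boolean circuit with input wires `ι` and output wires `o`: a list of NAND gates, each reading
two wires, where a wire is an input or the output of an earlier gate. A wire that points to no
earlier gate carries the constant `false`. -/
structure Circuit (ι o : Type) where
  gates : List ((ι ⊕ ℕ) × (ι ⊕ ℕ))
  out : o → ι ⊕ ℕ

namespace Circuit

variable {ι o : Type}

/-- The bit on a wire, given the inputs and the values of the gates computed so far. -/
def read (x : Bits ι) (vals : List Bool) : ι ⊕ ℕ → Bool
  | Sum.inl i => x i
  | Sum.inr j => vals.getD j false

/-- The values of all gates, in order. -/
def gateValues (c : Circuit ι o) (x : Bits ι) : List Bool :=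
  c.gates.foldl (fun vals g => vals ++ [!(read x vals g.1 && read x vals g.2)]) []

/-- The function computed by a circuit. -/
def eval (c : Circuit ι o) (x : Bits ι) : Bits o :=
  fun j => read x (c.gateValues x) (c.out j)

/-- The number of gates. -/
def size (c : Circuit ι o) : ℕ := c.gates.length

end Circuit

/-- An interactive machine with read-only input wires `I` (keys and random coins), incoming message
wires `In`, outgoing message wires `Out` and `mem` bits of memory, all initially `false`. In round
`r` the circuit `step r` maps (input, memory, incoming message) to (new memory, outgoing
message). -/
structure Machine (I In Out : Type) where
  mem : ℕ
  step : ℕ → Circuit (I ⊕ Fin mem ⊕ In) (Fin mem ⊕ Out)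

/-- The memory and the work in every round are at most `s`. -/
def Machine.Bounded {I In Out : Type} (M : Machine I In Out) (s : ℕ) : Prop :=
  M.mem ≤ s ∧ ∀ r, (M.step r).size ≤ s

/-! ### Synchronous interaction -/

/-- A deterministic reactive process: in round `r` it maps its state and an incoming message to a
new state and an outgoing message. -/
structure Proc (A B : Type) where
  σ : Type
  start : σ
  next : ℕ → σ → A → σ × B

/-- A machine whose input (keys and coins) has been fixed. -/
def Machine.toProc {I In Out : Type} (M : Machine I In Out) (x : Bits I) :
    Proc (Bits In) (Bits Out) where
  σ := Bits (Fin M.mem)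
  start := fun _ => false
  next := fun r s m =>
    let y := (M.step r).eval (Sum.elim x (Sum.elim s m))
    (fun j => y (Sum.inl j), fun j => y (Sum.inr j))

/-- Independent processes, one for each pairwise channel `i`, run side by side. -/
def Proc.parallel {ι : Type} {W : ι → Type} (P : ∀ i, Proc (Bits (W i)) (Bits (W i))) :
    Proc (Bits (Σ i, W i)) (Bits (Σ i, W i)) where
  σ := ∀ i, (P i).σ
  start := fun i => (P i).start
  next := fun r s m =>
    (fun i => ((P i).next r (s i) (fun j => m ⟨i, j⟩)).1,
     fun w => ((P w.1).next r (s w.1) (fun j => m ⟨w.1, j⟩)).2 w.2)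

/-- The process `P`, but with the outgoing wires in `Z` taken over by the process `Q`. -/
def Proc.takeOver {A W : Type} (P Q : Proc A (Bits W)) (Z : W → Prop) [DecidablePred Z] :
    Proc A (Bits W) where
  σ := P.σ × Q.σ
  start := (P.start, Q.start)
  next := fun r s m =>
    (((P.next r s.1 m).1, (Q.next r s.2 m).1),
     fun w => if Z w then (Q.next r s.2 m).2 w else (P.next r s.1 m).2 w)

/-- The process that ignores what it receives and sends a prescribed stream of messages. -/
def Proc.stream {A B : Type} (u : ℕ → B) : Proc A B where
  σ := Unit
  start := ()
  next := fun r _ _ => ((), u r)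

/-- The configuration (state of the center, state of the peers, last message of the peers) before
round `r`. In each round the center speaks first, knowing the replies of the previous round, and
then the peers reply. -/
def interact {D U : Type} (center : Proc U D) (peers : Proc D U) (u₀ : U) :
    ℕ → center.σ × peers.σ × U
  | 0 => (center.start, peers.start, u₀)
  | r + 1 =>
    let c := interact center peers u₀ r
    let a := center.next r c.1 c.2.2
    let b := peers.next r c.2.1 a.2
    (a.1, b.1, b.2)

/-- The message that the center sends to the peers in round `r`. -/
def centerMessage {D U : Type} (center : Proc U D) (peers : Proc D U) (u₀ : U) (r : ℕ) : D :=
  let c := interact center peers u₀ r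
  (center.next r c.1 c.2.2).2

/-! ### Auctions -/

/-- The output of the key setup: a public string known to everybody (for example certified public
keys or the verification key of a certificate authority) and a secret key for the platform, for
the seller and for every buyer identity. -/
structure Keys (pubLen keyLen numIds : ℕ) where
  pub : Bits (Fin pubLen)
  platform : Bits (Fin keyLen)
  seller : Bits (Fin keyLen)
  buyer : Fin numIds → Bits (Fin keyLen)

/-- A family of platform-assisted auction protocols for `k` identical items, indexed by the security
parameter `sec`, without any broadcast channel: the buyers and the seller talk to the platform
only, over pairwise private channels.

A session is opened by the platform, which announces the number `N` of bids; `N` fixes the number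
of rounds and the length of messages and coins. A buyer or seller knows nothing about the other
participants except what the platform tells it, so a strategic platform may announce different
numbers to different players. After `rounds sec N` rounds the platform sends one more message, the
private outcome. The platform knows the set `B` of participating identities.

All machines may depend in an arbitrary (non-uniform) way on the public data and on the own
bid. -/
structure Auction (k : ℕ) where
  domain : ℕ → Finset ℝ
  numIds : ℕ → ℕ
  pubLen : ℕ → ℕ
  keyLen : ℕ → ℕ
  setupLen : ℕ → ℕ
  setup : ∀ sec, Bits (Fin (setupLen sec)) → Keys (pubLen sec) (keyLen sec) (numIds sec)
  rounds : ℕ → ℕ → ℕ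
  msgLen : ℕ → ℕ → ℕ
  coinLen : ℕ → ℕ → ℕ
  buyer : ∀ sec N, Fin (numIds sec) → domain sec →
    Machine (Fin (pubLen sec) ⊕ Fin (keyLen sec) ⊕ Fin (coinLen sec N))
      (Fin (msgLen sec N)) (Fin (msgLen sec N))
  seller : ∀ sec N,
    Machine (Fin (pubLen sec) ⊕ Fin (keyLen sec) ⊕ Fin (coinLen sec N))
      (Fin (msgLen sec N)) (Fin (msgLen sec N))
  /-- The channels of the platform: `some i` is the buyer `i`, `none` is the seller. -/
  platform : ∀ sec (B : Finset (Fin (numIds sec))),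
    Machine (Fin (pubLen sec) ⊕ Fin (keyLen sec) ⊕ Fin (coinLen sec B.card))
      (Σ _ : Option B, Fin (msgLen sec B.card)) (Σ _ : Option B, Fin (msgLen sec B.card))
  /-- How the last message to a buyer encodes its private outcome: the number of items allocated to
  it and its payment, or `none`, by which the platform rejects. -/
  buyerOutcome : ∀ sec N, Bits (Fin (msgLen sec N)) → Option (ℕ × ℝ≥0)
  /-- How the last message to the seller encodes its private outcome: the number of items sold (at
  most `k`) and the revenue of the seller, or `none`, by which the platform rejects. -/
  sellerOutcome : ∀ sec N, Bits (Fin (msgLen sec N)) → Option (Fin (k + 1) × ℝ≥0)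
  /-- The decision of a buyer to accept, a function of its view: keys, coins and all messages
  received. -/
  buyerAccepts : ∀ sec N, Fin (numIds sec) → domain sec →
    Bits (Fin (pubLen sec) ⊕ Fin (keyLen sec) ⊕ Fin (coinLen sec N)) →
    (Fin (rounds sec N + 1) → Bits (Fin (msgLen sec N))) → Bool
  sellerAccepts : ∀ sec N,
    Bits (Fin (pubLen sec) ⊕ Fin (keyLen sec) ⊕ Fin (coinLen sec N)) →
    (Fin (rounds sec N + 1) → Bits (Fin (msgLen sec N))) → Bool

namespace Auction

variable {k : ℕ} (a : Auction k)

/-- Buyer identities. -/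
abbrev Id (sec : ℕ) : Type := Fin (a.numIds sec)

/-- A choice of a value (or bid) for every identity; only those of participants matter. -/
abbrev Values (sec : ℕ) : Type := a.Id sec → a.domain sec

/-- The read-only input of an honest player: public string, own secret key, own coins. -/
abbrev Input (sec N : ℕ) : Type :=
  Fin (a.pubLen sec) ⊕ Fin (a.keyLen sec) ⊕ Fin (a.coinLen sec N)

/-- The wires between the platform and the participants `B` (and the seller), if player `i` has been
told that there are `N i` bids. -/
abbrev Wires (sec : ℕ) (B : Finset (a.Id sec)) (N : Option B → ℕ) : Type :=
  Σ i : Option B, Fin (a.msgLen sec (N i))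

/-- Random coins of the honest players on the platform's channels. -/
abbrev PeerCoins (sec : ℕ) (B : Finset (a.Id sec)) (N : Option B → ℕ) : Type :=
  ∀ i : Option B, Bits (Fin (a.coinLen sec (N i)))

/-- A record of an execution, with the platform's channels going to the identities `B` and the
seller: `msgs r` is what the platform sends in round `r`. -/
structure Transcript (sec : ℕ) (B : Finset (a.Id sec)) (N : Option B → ℕ) where
  keys : Keys (a.pubLen sec) (a.keyLen sec) (a.numIds sec)
  coins : a.PeerCoins sec B N
  bids : a.Values sec
  msgs : ℕ → Bits (a.Wires sec B N)

variable {a} {sec : ℕ} {B : Finset (a.Id sec)} {N : Option B → ℕ}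

/-- The secret key of a participant. -/
def peerKey (K : Keys (a.pubLen sec) (a.keyLen sec) (a.numIds sec)) :
    Option B → Bits (Fin (a.keyLen sec))
  | none => K.seller
  | some i => K.buyer i

/-- The input of an honest participant. -/
def peerInput (K : Keys (a.pubLen sec) (a.keyLen sec) (a.numIds sec)) (ω : a.PeerCoins sec B N)
    (i : Option B) : Bits (a.Input sec (N i)) :=
  Sum.elim K.pub (Sum.elim (peerKey K i) (ω i))

/-- The machine of an honest participant. -/
def peerMachine (a : Auction k) (sec : ℕ) (B : Finset (a.Id sec)) (N : Option B → ℕ)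
    (b : a.Values sec) : ∀ i : Option B,
      Machine (a.Input sec (N i)) (Fin (a.msgLen sec (N i))) (Fin (a.msgLen sec (N i)))
  | none => a.seller sec (N none)
  | some i => a.buyer sec (N (some i)) i (b i)

/-- All participants `B` with bids `b`, and the seller, following the protocol. -/
def honestPeers (N : Option B → ℕ) (b : a.Values sec)
    (K : Keys (a.pubLen sec) (a.keyLen sec) (a.numIds sec)) (ω : a.PeerCoins sec B N) :
    Proc (Bits (a.Wires sec B N)) (Bits (a.Wires sec B N)) :=
  Proc.parallel fun i => (peerMachine a sec B N b i).toProc (peerInput K ω i)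

namespace Transcript

variable (T : a.Transcript sec B N)

/-- The messages that participant `i` receives in its session. -/
def received (i : Option B) :
    Fin (a.rounds sec (N i) + 1) → Bits (Fin (a.msgLen sec (N i))) :=
  fun r j => T.msgs r ⟨i, j⟩

/-- The last message to participant `i`. -/
def lastMessage (i : Option B) : Bits (Fin (a.msgLen sec (N i))) :=
  T.received i (Fin.last _)

/-- Participant `i`, following the protocol, accepts. -/
def Accepts : Option B → Prop
  | none => a.sellerAccepts sec (N none) (peerInput T.keys T.coins none) (T.received none) = true
  | some i => a.buyerAccepts sec (N (some i)) i (T.bids i) (peerInput T.keys T.coins (some i))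
      (T.received (some i)) = true

/-- The private outcome sent to buyer `i`. -/
def buyerOut (i : B) : Option (ℕ × ℝ≥0) :=
  a.buyerOutcome sec (N (some i)) (T.lastMessage (some i))

/-- The private outcome sent to the seller. -/
def sellerOut : Option (Fin (k + 1) × ℝ≥0) :=
  a.sellerOutcome sec (N none) (T.lastMessage none)

/-- The platform accepts: it sends no rejection. -/
def PlatformAccepts : Prop :=
  T.sellerOut.isSome ∧ ∀ i : B, (T.buyerOut i).isSome

/-- Number of items allocated to buyer `i`. -/
def items (i : B) : ℕ := ((T.buyerOut i).getD (0, 0)).1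

/-- Payment of buyer `i`. -/
def pay (i : B) : ℝ := ((T.buyerOut i).getD (0, 0)).2

/-- Number of items sold, as told to the seller. -/
def sold : ℕ := (T.sellerOut.getD (0, 0)).1

/-- Revenue of the seller. -/
def sellerRevenue : ℝ := (T.sellerOut.getD (0, 0)).2

open Classical in
/-- The utility of a buyer with true value `v` that controls the identities `C`, if the platform is
honest. The buyer has unit demand. -/
noncomputable def buyerUtility (C : Finset (a.Id sec)) (v : ℝ) : ℝ :=
  if T.PlatformAccepts then
    (if ∃ i : B, i.1 ∈ C ∧ 0 < T.items i then v else 0)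
      - ∑ i : B, (if i.1 ∈ C ∧ 0 < T.items i then T.pay i else 0)
  else 0

/-- Number of items allocated to the honest buyers `H`. -/
def itemsOf (H : Finset (a.Id sec)) : ℕ :=
  ∑ i : B, (if i.1 ∈ H then T.items i else 0)

/-- Payments of the honest buyers `H`. -/
noncomputable def payOf (H : Finset (a.Id sec)) : ℝ :=
  ∑ i : B, (if i.1 ∈ H then T.pay i else 0)

/-- The execution is safe: all honest buyers (those in `H`) and the seller accept, and the platform
has obtained enough items from the seller for all honest winners. -/
def Safe (H : Finset (a.Id sec)) : Prop :=
  T.Accepts none ∧ (∀ i : B, i.1 ∈ H → T.Accepts (some i)) ∧ T.itemsOf H ≤ T.sold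

open Classical in
/-- The utility of a strategic platform colluding with buyers whose true values are `vals`, against
honest buyers `H`: zero if the execution is unsafe; otherwise the payments of the honest buyers
minus the revenue of the seller plus the sum of the `x` highest values in `vals`, where `x` is the
number of items left for the coalition. -/
noncomputable def coalitionUtility (H : Finset (a.Id sec)) (vals : Multiset ℝ) : ℝ :=
  if T.Safe H then
    T.payOf H - T.sellerRevenue + ((vals.sort (· ≥ ·)).take (T.sold - T.itemsOf H)).sum
  else 0

end Transcript

/-! ### Executions with an honest platform -/

/-- The transcript if the platform is honest, the participants are the identities `B`, and their
messages (and those of the seller) are produced by an arbitrary process. -/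
def platformTranscript (b : a.Values sec)
    (K : Keys (a.pubLen sec) (a.keyLen sec) (a.numIds sec))
    (ω : a.PeerCoins sec B (fun _ => B.card)) (ρ : Bits (Fin (a.coinLen sec B.card)))
    (peers : Proc (Bits (a.Wires sec B (fun _ => B.card)))
      (Bits (a.Wires sec B (fun _ => B.card)))) :
    a.Transcript sec B (fun _ => B.card) where
  keys := K
  coins := ω
  bids := b
  msgs := centerMessage
    ((a.platform sec B).toProc (Sum.elim K.pub (Sum.elim K.platform ρ))) peers (fun _ => false)

/-- The transcript if everybody is honest, the identities `B` participate and bid `b`. -/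
def honestTranscript (B : Finset (a.Id sec)) (b : a.Values sec)
    (κ : Bits (Fin (a.setupLen sec)))
    (ω : a.PeerCoins sec B (fun _ => B.card)) (ρ : Bits (Fin (a.coinLen sec B.card))) :
    a.Transcript sec B (fun _ => B.card) :=
  platformTranscript b (a.setup sec κ) ω ρ (honestPeers _ b (a.setup sec κ) ω)

/-- The expectation of a quantity in the execution where everybody is honest, over all coins. -/
noncomputable def honestExp (B : Finset (a.Id sec)) (b : a.Values sec)
    (f : a.Transcript sec B (fun _ => B.card) → ℝ) : ℝ :=
  Finset.univ.expect fun κ : Bits (Fin (a.setupLen sec)) =>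
  Finset.univ.expect fun ω : a.PeerCoins sec B (fun _ => B.card) =>
  Finset.univ.expect fun ρ : Bits (Fin (a.coinLen sec B.card)) =>
    f (honestTranscript B b κ ω ρ)

variable (a)

/-- The guarantees that an auction has to provide: values lie in `[0, 1]` and include `0`; the
number of identities is super-polynomial; correctness, individual rationality, consistency of the
number of items sold, and budget feasibility. -/
structure IsAuction : Prop where
  zero_mem : ∀ sec, (0 : ℝ) ∈ a.domain sec
  mem_unit : ∀ sec, ∀ v ∈ a.domain sec, 0 ≤ v ∧ v ≤ 1
  many_ids : ∀ P : Polynomial ℕ, ∀ᶠ sec in Filter.atTop, P.eval sec < a.numIds sec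
  /-- An honest buyer that accepts has an outcome with at most one item and nonnegative utility. -/
  buyer_rational : ∀ sec N i v x msgs, a.buyerAccepts sec N i v x msgs = true →
    ∃ y : ℕ × ℝ≥0, a.buyerOutcome sec N (msgs (Fin.last _)) = some y ∧
      y.1 ≤ 1 ∧ (y.2 : ℝ) ≤ y.1 * (v : ℝ)
  /-- An honest seller that accepts has an outcome. -/
  seller_rational : ∀ sec N x msgs, a.sellerAccepts sec N x msgs = true →
    (a.sellerOutcome sec N (msgs (Fin.last _))).isSome
  /-- If everybody is honest then everybody accepts. -/
  complete : ∀ sec (B : Finset (a.Id sec)) (b : a.Values sec) κ ω ρ,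
    (honestTranscript B b κ ω ρ).PlatformAccepts ∧ ∀ i, (honestTranscript B b κ ω ρ).Accepts i
  /-- If the platform is honest, then, whatever messages the players in `Z` send, all honest players
  take the same decision as the platform. -/
  agreement : ∀ sec (B : Finset (a.Id sec)) (b : a.Values sec) κ ω ρ
    (Z : Finset (Option B)) (u : ℕ → Bits (a.Wires sec B (fun _ => B.card))),
    let T := platformTranscript b (a.setup sec κ) ω ρ
      ((honestPeers _ b (a.setup sec κ) ω).takeOver (Proc.stream u) (fun w => w.1 ∈ Z))
    ∀ i ∉ Z, (T.Accepts i ↔ T.PlatformAccepts)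
  /-- If the platform is honest and accepts, then, whatever messages the players in `Z` send, the
  number of items sold is the number of items allocated, and the revenue of the seller is at most
  the total payment. -/
  consistent : ∀ sec (B : Finset (a.Id sec)) (b : a.Values sec) κ ω ρ
    (Z : Finset (Option B)) (u : ℕ → Bits (a.Wires sec B (fun _ => B.card))),
    let T := platformTranscript b (a.setup sec κ) ω ρ
      ((honestPeers _ b (a.setup sec κ) ω).takeOver (Proc.stream u) (fun w => w.1 ∈ Z))
    T.PlatformAccepts → T.sold = ∑ i, T.items i ∧ T.sellerRevenue ≤ ∑ i, T.pay i

/-- Honest players run in probabilistic polynomial time (in the security parameter and the announced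
number of bids). -/
def IsPPT : Prop :=
  ∃ P : Polynomial ℕ,
    (∀ sec, a.pubLen sec ≤ P.eval sec ∧ a.keyLen sec ≤ P.eval sec) ∧
    (∀ sec N, a.rounds sec N ≤ P.eval (sec + N) ∧ a.msgLen sec N ≤ P.eval (sec + N) ∧
      a.coinLen sec N ≤ P.eval (sec + N) ∧
      (∀ i v, (a.buyer sec N i v).Bounded (P.eval (sec + N))) ∧
      (a.seller sec N).Bounded (P.eval (sec + N))) ∧
    ∀ sec (B : Finset (a.Id sec)), (a.platform sec B).Bounded (P.eval (sec + B.card))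

/-- There is no public-key infrastructure: nobody holds a secret key, so that anybody can act under
any identity, including that of the seller. -/
def NoPKI : Prop := ∀ sec, a.keyLen sec = 0

/-- The seller never sends a message (a message of zeros is no message). -/
def SellerSilent : Prop :=
  ∀ sec N r x j, ((a.seller sec N).step r).eval x (Sum.inr j) = false

/-! ### Strategies -/

/-- A strategy of a single buyer with true identity `u` against honest buyers `H`, an honest seller
and an honest platform: it participates under a set `C` of identities of its choice and controls
all their messages. It knows the secret keys of these identities. -/
structure BuyerStrategy (sec : ℕ) (H : Finset (a.Id sec)) (u : a.Id sec) where
  C : Finset (a.Id sec)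
  disjoint : Disjoint H C
  coins : ℕ
  machine : Machine
    (Fin (a.pubLen sec) ⊕ (↥(insert u C) × Fin (a.keyLen sec)) ⊕ Fin coins)
    (C × Fin (a.msgLen sec (H ∪ C).card)) (C × Fin (a.msgLen sec (H ∪ C).card))

/-- A strategy of the platform colluding with the buyers `A` against honest buyers `H` and an honest
seller. It chooses the number of bids announced to each honest player and controls everything that
the platform sends. It knows the secret keys of the platform, of the colluding buyers, and of a
set of additional (fake) identities of its choice. -/
structure PlatformStrategy (sec : ℕ) (H A : Finset (a.Id sec)) where
  fakes : Finset (a.Id sec)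
  disjoint : Disjoint H fakes
  announce : Option H → ℕ
  coins : ℕ
  machine : Machine
    (Fin (a.pubLen sec) ⊕ Fin (a.keyLen sec) ⊕ (↥(A ∪ fakes) × Fin (a.keyLen sec)) ⊕ Fin coins)
    (a.Wires sec H announce) (a.Wires sec H announce)

variable {a}

/-- All resources used by the strategy are at most `s`. -/
def BuyerStrategy.Bounded {H : Finset (a.Id sec)} {u : a.Id sec} (S : a.BuyerStrategy sec H u)
    (s : ℕ) : Prop :=
  S.C.card ≤ s ∧ S.coins ≤ s ∧ S.machine.Bounded s

/-- All resources used by the strategy are at most `s`. -/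
def PlatformStrategy.Bounded {H A : Finset (a.Id sec)} (S : a.PlatformStrategy sec H A)
    (s : ℕ) : Prop :=
  S.fakes.card ≤ s ∧ (∀ i, S.announce i ≤ s) ∧ S.coins ≤ s ∧ S.machine.Bounded s

/-- The strategic buyer as a process on the channels of the platform. It sees and uses only the
channels of its own identities. -/
def BuyerStrategy.toProc {H : Finset (a.Id sec)} {u : a.Id sec} (S : a.BuyerStrategy sec H u)
    (K : Keys (a.pubLen sec) (a.keyLen sec) (a.numIds sec)) (τ : Bits (Fin S.coins)) :
    Proc (Bits (a.Wires sec (H ∪ S.C) (fun _ => (H ∪ S.C).card)))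
      (Bits (a.Wires sec (H ∪ S.C) (fun _ => (H ∪ S.C).card))) :=
  let P := S.machine.toProc (Sum.elim K.pub (Sum.elim (fun w => K.buyer w.1 w.2) τ))
  { σ := P.σ
    start := P.start
    next := fun r s m =>
      let y := P.next r s (fun w => m ⟨some ⟨w.1, Finset.mem_union_right H w.1.2⟩, w.2⟩)
      (y.1, fun w =>
        match w with
        | ⟨none, _⟩ => false
        | ⟨some i, j⟩ => if h : i.1 ∈ S.C then y.2 (⟨i.1, h⟩, j) else false) }

/-- The transcript if a single buyer follows the strategy `S` and everybody else is honest: the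
messages on the channels of the identities `S.C` are those of the strategy. -/
def BuyerStrategy.transcript {H : Finset (a.Id sec)} {u : a.Id sec} (S : a.BuyerStrategy sec H u)
    (v : a.Values sec) (κ : Bits (Fin (a.setupLen sec)))
    (ω : a.PeerCoins sec (H ∪ S.C) (fun _ => (H ∪ S.C).card))
    (ρ : Bits (Fin (a.coinLen sec (H ∪ S.C).card))) (τ : Bits (Fin S.coins)) :
    a.Transcript sec (H ∪ S.C) (fun _ => (H ∪ S.C).card) :=
  platformTranscript v (a.setup sec κ) ω ρ
    ((honestPeers _ v (a.setup sec κ) ω).takeOver (S.toProc (a.setup sec κ) τ)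
      (fun w => ∃ i ∈ w.1, i.1 ∈ S.C))

/-- Expected utility of the strategic buyer `u`; the values of all buyers are `v`. -/
noncomputable def BuyerStrategy.utility {H : Finset (a.Id sec)} {u : a.Id sec}
    (S : a.BuyerStrategy sec H u) (v : a.Values sec) : ℝ :=
  Finset.univ.expect fun κ : Bits (Fin (a.setupLen sec)) =>
  Finset.univ.expect fun ω : a.PeerCoins sec (H ∪ S.C) (fun _ => (H ∪ S.C).card) =>
  Finset.univ.expect fun ρ : Bits (Fin (a.coinLen sec (H ∪ S.C).card)) =>
  Finset.univ.expect fun τ : Bits (Fin S.coins) =>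
    (S.transcript v κ ω ρ τ).buyerUtility S.C (v u)

/-- The transcript if the platform's coalition follows the strategy `S`; the honest buyers are those
in `H`, with values `v`. -/
def PlatformStrategy.transcript {H A : Finset (a.Id sec)} (S : a.PlatformStrategy sec H A)
    (v : a.Values sec) (κ : Bits (Fin (a.setupLen sec))) (ω : a.PeerCoins sec H S.announce)
    (τ : Bits (Fin S.coins)) : a.Transcript sec H S.announce where
  keys := a.setup sec κ
  coins := ω
  bids := v
  msgs := centerMessage
    (S.machine.toProc
      (Sum.elim (a.setup sec κ).pub
        (Sum.elim (a.setup sec κ).platform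
          (Sum.elim (fun w => (a.setup sec κ).buyer w.1 w.2) τ))))
    (honestPeers S.announce v (a.setup sec κ) ω) (fun _ => false)

/-- The true values of a set of buyers. -/
def valuesOf (A : Finset (a.Id sec)) (v : a.Values sec) : Multiset ℝ :=
  A.val.map fun i => (v i : ℝ)

/-- Expected utility of the platform's coalition; the values of all buyers are `v`. -/
noncomputable def PlatformStrategy.utility {H A : Finset (a.Id sec)}
    (S : a.PlatformStrategy sec H A) (v : a.Values sec) : ℝ :=
  Finset.univ.expect fun κ : Bits (Fin (a.setupLen sec)) =>
  Finset.univ.expect fun ω : a.PeerCoins sec H S.announce =>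
  Finset.univ.expect fun τ : Bits (Fin S.coins) =>
    (S.transcript v κ ω τ).coalitionUtility H (valuesOf A v)

/-- Expected utility of buyer `u` under extended input replacement: instead of its true value it
submits the bids `b` under the identities `C`, and otherwise everybody is honest. The values of all
buyers are `v`. -/
noncomputable def buyerReplacement (H : Finset (a.Id sec)) (u : a.Id sec) (C : Finset (a.Id sec))
    (b v : a.Values sec) : ℝ :=
  honestExp (H ∪ C) (C.piecewise b v) fun T => T.buyerUtility C (v u)

/-- Expected utility of the coalition of the platform and the buyers `A` under extended input
replacement: instead of its true values it submits the bids `b` under the identities `C`, and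
otherwise everybody is honest. The values of all buyers are `v`. -/
noncomputable def coalitionReplacement (H A C : Finset (a.Id sec)) (b v : a.Values sec) : ℝ :=
  honestExp (H ∪ C) (C.piecewise b v) fun T => T.coalitionUtility H (valuesOf A v)

/-- Expected utility of buyer `u` if everybody is honest. -/
noncomputable def buyerHonest (H : Finset (a.Id sec)) (u : a.Id sec) (v : a.Values sec) : ℝ :=
  buyerReplacement H u {u} v v

/-- Expected utility of the platform and the buyers `A` if everybody is honest. -/
noncomputable def coalitionHonest (H A : Finset (a.Id sec)) (v : a.Values sec) : ℝ :=
  coalitionReplacement H A A v v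

/-! ### Incentive compatibility, ex post -/

variable (a)

/-- Strong computational buyer incentive compatibility. -/
def StrongBIC : Prop :=
  (∀ n : ℕ → ℕ, PolyBounded n →
    ∀ S : ∀ sec (H : Finset (a.Id sec)) (u : a.Id sec), a.BuyerStrategy sec H u,
    (∃ P : Polynomial ℕ, ∀ sec H u, H.card ≤ n sec → (S sec H u).Bounded (P.eval sec)) →
    ∃ ε, Negligible ε ∧ ∀ sec (H : Finset (a.Id sec)) (u : a.Id sec) (v : a.Values sec),
      H.card ≤ n sec → u ∉ H →
      (S sec H u).utility v ≤ buyerHonest H u v + ε sec) ∧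
  ∀ sec (H : Finset (a.Id sec)) (u : a.Id sec) (C : Finset (a.Id sec)) (b v : a.Values sec),
    u ∉ H → Disjoint H C → buyerReplacement H u C b v ≤ buyerHonest H u v

/-- Strong computational incentive compatibility for the platform colluding with any set of buyers
whose size satisfies `sizeOk`. -/
def StrongPlatformIC (sizeOk : ℕ → Prop) : Prop :=
  (∀ n : ℕ → ℕ, PolyBounded n →
    ∀ S : ∀ sec (H A : Finset (a.Id sec)), a.PlatformStrategy sec H A,
    (∃ P : Polynomial ℕ, ∀ sec H A, H.card ≤ n sec → sizeOk A.card →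
      (S sec H A).Bounded (P.eval sec)) →
    ∃ ε, Negligible ε ∧ ∀ sec (H A : Finset (a.Id sec)) (v : a.Values sec),
      H.card ≤ n sec → sizeOk A.card → Disjoint H A →
      (S sec H A).utility v ≤ coalitionHonest H A v + ε sec) ∧
  ∀ sec (H A C : Finset (a.Id sec)) (b v : a.Values sec),
    sizeOk A.card → Disjoint H A → Disjoint H C →
    coalitionReplacement H A C b v ≤ coalitionHonest H A v

/-- Strong computational `c`-platform-buyer incentive compatibility. -/
def StrongPBIC (c : ℕ) : Prop := a.StrongPlatformIC fun m => 1 ≤ m ∧ m ≤ c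

/-- The expected total utility of the buyers is at least `1 / q` for infinitely many security
parameters and suitable value vectors of polynomial length. -/
def NonTrivial : Prop :=
  ∃ q : Polynomial ℝ, (∀ m : ℕ, 0 < q.eval (m : ℝ)) ∧ ∃ n : ℕ → ℕ, PolyBounded n ∧
    ∃ᶠ sec : ℕ in Filter.atTop, ∃ (B : Finset (a.Id sec)) (v : a.Values sec), B.card ≤ n sec ∧
      1 / q.eval (sec : ℝ) ≤ honestExp B v fun T => ∑ i ∈ B, T.buyerUtility {i} (v i)

/-! ### Incentive compatibility, Bayesian -/

variable {a}

/-- The expectation of `f` if the value of every identity is drawn independently from `D`. -/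
noncomputable def valueExp (D : PMF (a.domain sec)) (f : a.Values sec → ℝ) : ℝ :=
  ∑ v : a.Values sec, (∏ i, (D (v i)).toReal) * f v

variable (a) (D : ∀ sec, PMF (a.domain sec))

/-- Strong computational Bayesian buyer incentive compatibility: the honest buyers draw their values
from `D`, the strategic buyer has an arbitrary value `w`. -/
def StrongBayesBIC : Prop :=
  (∀ n : ℕ → ℕ, PolyBounded n →
    ∀ S : ∀ sec (H : Finset (a.Id sec)) (u : a.Id sec), a.BuyerStrategy sec H u,
    (∃ P : Polynomial ℕ, ∀ sec H u, H.card ≤ n sec → (S sec H u).Bounded (P.eval sec)) →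
    ∃ ε, Negligible ε ∧
      ∀ sec (H : Finset (a.Id sec)) (u : a.Id sec) (w : a.domain sec),
      H.card ≤ n sec → u ∉ H →
      valueExp (D sec) (fun v => (S sec H u).utility (Function.update v u w)) ≤
        valueExp (D sec) (fun v => buyerHonest H u (Function.update v u w)) + ε sec) ∧
  ∀ sec (H : Finset (a.Id sec)) (u : a.Id sec) (C : Finset (a.Id sec)) (b : a.Values sec)
    (w : a.domain sec), u ∉ H → Disjoint H C →
    valueExp (D sec) (fun v => buyerReplacement H u C b (Function.update v u w)) ≤
      valueExp (D sec) (fun v => buyerHonest H u (Function.update v u w))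

/-- Strong computational Bayesian incentive compatibility for the platform colluding with any set of
buyers whose size satisfies `sizeOk`: the honest buyers draw their values from `D`, the colluding
buyers have arbitrary values `w`. -/
def StrongBayesPlatformIC (sizeOk : ℕ → Prop) : Prop :=
  (∀ n : ℕ → ℕ, PolyBounded n →
    ∀ S : ∀ sec (H A : Finset (a.Id sec)), a.PlatformStrategy sec H A,
    (∃ P : Polynomial ℕ, ∀ sec H A, H.card ≤ n sec → sizeOk A.card →
      (S sec H A).Bounded (P.eval sec)) →
    ∃ ε, Negligible ε ∧ ∀ sec (H A : Finset (a.Id sec)) (w : a.Values sec),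
      H.card ≤ n sec → sizeOk A.card → Disjoint H A →
      valueExp (D sec) (fun v => (S sec H A).utility (A.piecewise w v)) ≤
        valueExp (D sec) (fun v => coalitionHonest H A (A.piecewise w v)) + ε sec) ∧
  ∀ sec (H A C : Finset (a.Id sec)) (b w : a.Values sec),
    sizeOk A.card → Disjoint H A → Disjoint H C →
    valueExp (D sec) (fun v => coalitionReplacement H A C b (A.piecewise w v)) ≤
      valueExp (D sec) (fun v => coalitionHonest H A (A.piecewise w v))

/-- Strong computational Bayesian platform incentive compatibility. -/
def StrongBayesPIC : Prop := a.StrongBayesPlatformIC D fun m => m = 0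

/-- Strong computational Bayesian `c`-platform-buyer incentive compatibility. -/
def StrongBayesPBIC (c : ℕ) : Prop := a.StrongBayesPlatformIC D fun m => 1 ≤ m ∧ m ≤ c

/-- With values drawn independently from `D`, the expected total utility of the buyers is at least
`1 / q` for infinitely many security parameters and suitable sets of identities of polynomial
size. -/
def BayesNonTrivial : Prop :=
  ∃ q : Polynomial ℝ, (∀ m : ℕ, 0 < q.eval (m : ℝ)) ∧ ∃ n : ℕ → ℕ, PolyBounded n ∧
    ∃ᶠ sec : ℕ in Filter.atTop, ∃ B : Finset (a.Id sec), B.card ≤ n sec ∧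
      1 / q.eval (sec : ℝ) ≤ valueExp (D sec) fun v =>
        honestExp B v fun T => ∑ i ∈ B, T.buyerUtility {i} (v i)

end Auction

end PlatformAuction

/-!
A strategic platform can show different auctions to different players, because nothing about the
outcome is public. The proof turns this into a profitable deviation for the platform together with
one buyer.

*Revenue of the platform.* Let `x(z)` and `p(z)` be the expected number of items and the expected
payment of a buyer that bids `z`, and `R(z)` the expected revenue of the platform. Truthful bidding
is optimal for the buyer alone, whose payoff is `w x(z) - p(z)`, and for the buyer together with the
platform, whose payoff is `w x(z) - p(z) + R(z)`. Adding the two inequalities for exchanged roles of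
two values gives `R(w) - R(z) ≤ (z - w) (x(z) - x(w))`, and summing over adjacent values shows that
a single bid changes `R` by at most the tick size (`interimSurplus_le`). If all bids are `0`, or if
there are no bids, then `R` vanishes. Hence the revenue of the platform is negligible
(`surplus_le_of_exPost`, `interimSurplus_le_of_bayes`), and under honest play the platform and a
buyer `u` together get little more than the utility of `u`.

*The attack.* In a non-trivial auction some buyer `u` has a substantial expected utility among the
buyers `B`. Add a crowd of further buyers whose values are distributed like the one of `u`. There
are only `k` items, so that some member of a large crowd has hardly any utility; and since a buyer
may take part under any identity, `u` in its place does no better (`ExactBIC.interimUtility_le`).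
Thus honest play against `B` without `u` and the crowd yields almost nothing. Instead, the platform
runs the auction among `B` honestly with the seller, pretending that the crowd does not exist. To
every member of the crowd it shows a separate auction with many simulated competitors, chosen such
that this member obtains an item with small probability only (`exists_small_alloc`). No member of
the crowd notices, and unless one of them obtains an item, the coalition gets the utility that `u`
has among `B` (`Attack.le_coalitionUtility`). All identities outside the coalition can be simulated
because they are fake; the seller can be simulated towards the crowd because its messages carry no
secret (`out_seller_congr`).

*Running the attack.* The sessions are played in lockstep by one machine whose rounds are
compositions of the circuits of the honest players (`Circuit.ComputableWith`,
`Sessions.exists_bounded_strategy`). An interaction is determined by the input-output behavior of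
its two sides (`eq_centerMessage`), so that every honest player sees exactly what it would see in an
honest execution of its session (`Sessions.msgs_strategy`), with the right distribution
(`Sessions.expect_sessionTranscript`).

The ex post and the Bayesian case are treated together by letting every identity have its own
distribution of values: point masses in the former case, a common distribution in the latter.
-/

namespace PlatformAuction

/-! ### Circuit complexity of families of Boolean functions -/

namespace Circuit

variable {ι ι' o : Type}

/-- The values of all wires when the gates `gs` are evaluated after wires with values `vals`. -/
def runGates (x : Bits ι) (vals : List Bool) (gs : List ((ι ⊕ ℕ) × (ι ⊕ ℕ))) : List Bool :=
  gs.foldl (fun vals g => vals ++ [!(read x vals g.1 && read x vals g.2)]) vals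

lemma runGates_cons (x : Bits ι) (vals : List Bool) (g : (ι ⊕ ℕ) × (ι ⊕ ℕ))
    (gs : List ((ι ⊕ ℕ) × (ι ⊕ ℕ))) :
    runGates x vals (g :: gs) =
      runGates x (vals ++ [!(read x vals g.1 && read x vals g.2)]) gs := rfl

lemma runGates_append (x : Bits ι) (vals : List Bool) (gs hs : List ((ι ⊕ ℕ) × (ι ⊕ ℕ))) :
    runGates x vals (gs ++ hs) = runGates x (runGates x vals gs) hs := by
  simp [runGates]

lemma length_runGates (x : Bits ι) (gs : List ((ι ⊕ ℕ) × (ι ⊕ ℕ))) :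
    ∀ vals, (runGates x vals gs).length = vals.length + gs.length := by
  induction gs with
  | nil => intro vals; simp [runGates]
  | cons g gs ih => intro vals; rw [runGates_cons, ih]; simp; omega

lemma getD_append_length_add (l t : List Bool) (j : ℕ) :
    (l ++ t).getD (l.length + j) false = t.getD j false := by
  rw [List.getD_append_right _ _ _ _ (by omega), Nat.add_sub_cancel_left]

/-- The wires of a circuit, relocated behind `n` wires that are already there; the inputs of the
circuit are read off the wires `f`. -/
def relocate (f : ι' → ι ⊕ ℕ) (n : ℕ) : ι' ⊕ ℕ → ι ⊕ ℕ :=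
  Sum.elim f fun j => Sum.inr (n + j)

lemma read_relocate {x : Bits ι} {y : Bits ι'} {f : ι' → ι ⊕ ℕ} {vals t : List Bool}
    (hf : ∀ i, read x (vals ++ t) (f i) = y i) (w : ι' ⊕ ℕ) :
    read x (vals ++ t) (relocate f vals.length w) = read y t w := by
  rcases w with i | j
  · exact hf i
  · exact getD_append_length_add vals t j

lemma runGates_relocate {x : Bits ι} {y : Bits ι'} {f : ι' → ι ⊕ ℕ} {vals : List Bool} {s : ℕ}
    (hf : ∀ t : List Bool, t.length ≤ s → ∀ i, read x (vals ++ t) (f i) = y i)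
    (gs : List ((ι' ⊕ ℕ) × (ι' ⊕ ℕ))) :
    ∀ t : List Bool, t.length + gs.length ≤ s →
      runGates x (vals ++ t)
        (gs.map fun g => (relocate f vals.length g.1, relocate f vals.length g.2)) =
      vals ++ runGates y t gs := by
  induction gs with
  | nil => intro t _; rfl
  | cons g gs ih =>
    intro t ht
    simp only [List.length_cons] at ht
    rw [List.map_cons, runGates_cons, runGates_cons,
      read_relocate (hf t (by omega)), read_relocate (hf t (by omega)), List.append_assoc]
    exact ih _ (by simp; omega)

/-- The Boolean function `g` is constantly `false` or can be read off a wire that exists after the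
gates `gs`. Wires that point to no gate are excluded, because later gates would change their
value. -/
def OnWire (gs : List ((ι ⊕ ℕ) × (ι ⊕ ℕ))) (g : Bits ι → Bool) : Prop :=
  (g = fun _ => false) ∨ ∃ w : ι ⊕ ℕ, Sum.elim (fun _ => True) (· < gs.length) w ∧
    ∀ x, read x (runGates x [] gs) w = g x

/-- All Boolean functions in the family `S` can be computed together with at most `s` gates. -/
def ComputableWith (s : ℕ) (S : Set (Bits ι → Bool)) : Prop :=
  ∃ gs : List ((ι ⊕ ℕ) × (ι ⊕ ℕ)), gs.length ≤ s ∧ ∀ g ∈ S, OnWire gs g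

lemma ComputableWith.mono {s t : ℕ} {S T : Set (Bits ι → Bool)} (h : ComputableWith s S)
    (hst : s ≤ t) (hTS : T ⊆ S) : ComputableWith t T := by
  obtain ⟨gs, hl, hgs⟩ := h
  exact ⟨gs, hl.trans hst, fun g hg => hgs g (hTS hg)⟩

/-- The value of a wire, or `false` if there is no wire. -/
def input (i : Option ι) (x : Bits ι) : Bool := i.elim false x

lemma computableWith_input : ComputableWith 0 (Set.range (input : Option ι → Bits ι → Bool)) := by
  refine ⟨[], le_rfl, ?_⟩
  rintro _ ⟨_ | i, rfl⟩
  · exact Or.inl rfl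
  · exact Or.inr ⟨Sum.inl i, trivial, fun x => rfl⟩

lemma read_append_of_live {x : Bits ι} {vals : List Bool} (t : List Bool) {w : ι ⊕ ℕ}
    (hw : Sum.elim (fun _ => True) (· < vals.length) w) :
    read x (vals ++ t) w = read x vals w := by
  rcases w with i | j
  · rfl
  · exact List.getD_append _ _ _ _ hw

/-- Running a circuit on functions that have been computed costs as many gates as the circuit
has. -/
lemma ComputableWith.extend {s : ℕ} {S : Set (Bits ι → Bool)} (hS : ComputableWith s S)
    (c : Circuit ι' o) (h : ι' → Bits ι → Bool) (hh : ∀ i, h i ∈ S) :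
    ComputableWith (s + c.size)
      (S ∪ Set.range fun (j : o) (x : Bits ι) => c.eval (fun i => h i x) j) := by
  obtain ⟨gs, hl, hgs⟩ := hS
  -- functions that are constantly `false` are read off a wire beyond the end of the new circuit
  have hw : ∀ i, ∃ w : ι ⊕ ℕ, ∀ x, ∀ t : List Bool, t.length ≤ c.size →
      read x (runGates x [] gs ++ t) w = h i x := by
    intro i
    rcases hgs _ (hh i) with h0 | ⟨w, hw, hx⟩
    · refine ⟨Sum.inr (gs.length + c.size), fun x t ht => ?_⟩
      rw [h0]
      refine List.getD_eq_default _ _ ?_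
      simp [length_runGates, ht]
    · refine ⟨w, fun x t _ => ?_⟩
      rw [read_append_of_live, hx]
      simpa [length_runGates] using hw
  choose f hf using hw
  have hlen : ∀ x, (runGates x [] gs).length = gs.length := fun x => by
    simp [length_runGates]
  have hrun : ∀ x, runGates x [] (gs ++ c.gates.map fun g =>
      (relocate f gs.length g.1, relocate f gs.length g.2)) =
      runGates x [] gs ++ c.gateValues (fun i => h i x) := by
    intro x
    have := runGates_relocate (y := fun i => h i x) (s := c.size)
      (fun t ht i => hf i x t ht) c.gates [] (by simp [size])
    rw [runGates_append]
    rw [List.append_nil, hlen] at this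
    exact this
  refine ⟨gs ++ c.gates.map fun g => (relocate f gs.length g.1, relocate f gs.length g.2),
    by simpa [size] using hl, ?_⟩
  have hcl : ∀ y : Bits ι', (c.gateValues y).length = c.size := fun y => by
    exact (length_runGates y c.gates []).trans (Nat.zero_add _)
  have live : ∀ g, OnWire gs g → OnWire (gs ++ c.gates.map fun g =>
      (relocate f gs.length g.1, relocate f gs.length g.2)) g := by
    rintro g (h0 | ⟨w, hw, hx⟩)
    · exact Or.inl h0
    · refine Or.inr ⟨w, ?_, fun x => ?_⟩
      · rcases w with i | j
        · trivial
        · simp only [Sum.elim_inr, List.length_append, List.length_map] at hw ⊢; omega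
      · rw [hrun, read_append_of_live, hx]
        simpa [hlen] using hw
  rintro g (hg | ⟨j, rfl⟩)
  · exact live g (hgs g hg)
  · show OnWire _ (fun x => read (fun i => h i x) (c.gateValues fun i => h i x) (c.out j))
    rcases hj : c.out j with i | m
    · exact live _ (hgs _ (hh i))
    · by_cases hm : m < c.size
      · refine Or.inr ⟨Sum.inr (gs.length + m), ?_, fun x => ?_⟩
        · simp only [Sum.elim_inr, List.length_append, List.length_map]
          exact Nat.add_lt_add_left hm _
        · rw [hrun]
          rw [← hlen x]
          exact getD_append_length_add _ _ m
      · refine Or.inl (funext fun x => ?_)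
        refine List.getD_eq_default _ _ ?_
        rw [hcl]; omega

/-- Circuits that run side by side on functions that have been computed. -/
lemma ComputableWith.extend_finset {s : ℕ} {S : Set (Bits ι → Bool)} (hS : ComputableWith s S)
    {J : Type} {I O : J → Type} (c : ∀ j, Circuit (I j) (O j)) (h : ∀ j, I j → Bits ι → Bool)
    (hh : ∀ j i, h j i ∈ S) (F : Finset J) :
    ComputableWith (s + ∑ j ∈ F, (c j).size)
      (S ∪ {g | ∃ j ∈ F, ∃ i, g = fun x => (c j).eval (fun i => h j i x) i}) := by
  classical
  induction F using Finset.induction_on with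
  | empty => simpa using hS
  | insert j F hj ih =>
    refine (ih.extend (c j) (h j) fun i => Or.inl (hh j i)).mono ?_ ?_
    · rw [Finset.sum_insert hj]; omega
    · rintro g (hg | ⟨j', hj', i, rfl⟩)
      · exact Or.inl (Or.inl hg)
      · rcases Finset.mem_insert.1 hj' with rfl | hF
        · exact Or.inr ⟨i, rfl⟩
        · exact Or.inl (Or.inr ⟨j', hF, i, rfl⟩)

/-- A circuit for the function `f` if its output bits can be computed together. -/
lemma ComputableWith.exists_circuit {s : ℕ} {S : Set (Bits ι → Bool)} (hS : ComputableWith s S)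
    (f : Bits ι → Bits o) (hf : ∀ j, (fun x => f x j) ∈ S) :
    ∃ c : Circuit ι o, c.size ≤ s ∧ c.eval = f := by
  obtain ⟨gs, hl, hgs⟩ := hS
  have hw : ∀ j, ∃ w : ι ⊕ ℕ, ∀ x, read x (runGates x [] gs) w = f x j := by
    intro j
    rcases hgs _ (hf j) with h0 | ⟨w, -, hx⟩
    · refine ⟨Sum.inr gs.length, fun x => ?_⟩
      rw [congrFun h0 x]
      exact List.getD_eq_default _ _ (by simp [length_runGates])
    · exact ⟨w, hx⟩
  choose w hw using hw
  exact ⟨⟨gs, w⟩, hl, funext fun x => funext fun j => hw j x⟩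

end Circuit

/-! ### Processes as maps on message streams -/

namespace Proc

variable {A B : Type}

/-- The state of a process before round `r`, when it receives the messages `s`. -/
def stateAt (P : Proc A B) (s : ℕ → A) : ℕ → P.σ
  | 0 => P.start
  | r + 1 => (P.next r (stateAt P s r) (s r)).1

/-- The messages sent by a process that receives the messages `s`. -/
def out (P : Proc A B) (s : ℕ → A) (r : ℕ) : B := (P.next r (P.stateAt s r) (s r)).2

lemma stateAt_congr (P : Proc A B) {s s' : ℕ → A} {r : ℕ} (h : ∀ q < r, s q = s' q) :
    P.stateAt s r = P.stateAt s' r := by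
  induction r with
  | zero => rfl
  | succ r ih =>
    simp only [stateAt]
    rw [ih fun q hq => h q (by omega), h r (by omega)]

/-- A process is causal: what it sends depends on the messages received so far only. -/
lemma out_congr (P : Proc A B) {s s' : ℕ → A} {r : ℕ} (h : ∀ q ≤ r, s q = s' q) :
    P.out s r = P.out s' r := by
  simp only [out]
  rw [P.stateAt_congr fun q hq => h q hq.le, h r le_rfl]

lemma out_parallel {ι : Type} {W : ι → Type} (P : ∀ i, Proc (Bits (W i)) (Bits (W i)))
    (s : ℕ → Bits (Σ i, W i)) (r : ℕ) (i : ι) (j : W i) :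
    (parallel P).out s r ⟨i, j⟩ = (P i).out (fun q j => s q ⟨i, j⟩) r j := by
  have h : ∀ r i, (parallel P).stateAt s r i = (P i).stateAt (fun q j => s q ⟨i, j⟩) r := by
    intro r
    induction r with
    | zero => intro i; rfl
    | succ r ih =>
      intro i
      simp only [stateAt, ← ih]
      rfl
  simp only [out, ← h]
  rfl

lemma out_takeOver {W : Type} (P Q : Proc A (Bits W)) (Z : W → Prop) [DecidablePred Z]
    (s : ℕ → A) (r : ℕ) :
    (takeOver P Q Z).out s r = fun w => if Z w then Q.out s r w else P.out s r w := by
  have h : ∀ r, (takeOver P Q Z).stateAt s r = (P.stateAt s r, Q.stateAt s r) := by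
    intro r
    induction r with
    | zero => rfl
    | succ r ih => simp only [stateAt, ih]; rfl
  simp only [out, h]
  rfl

end Proc

/-- The message of the peers that the center sees in round `r`. -/
def peersMessage {D U : Type} (center : Proc U D) (peers : Proc D U) (u₀ : U) (r : ℕ) : U :=
  (interact center peers u₀ r).2.2

section Interact

variable {D U : Type} (center : Proc U D) (peers : Proc D U) (u₀ : U)

lemma interact_states (r : ℕ) :
    (interact center peers u₀ r).1 = center.stateAt (peersMessage center peers u₀) r ∧
    (interact center peers u₀ r).2.1 = peers.stateAt (centerMessage center peers u₀) r := by
  induction r with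
  | zero => exact ⟨rfl, rfl⟩
  | succ r ih =>
    constructor
    · simp only [Proc.stateAt, ← ih.1]; rfl
    · simp only [Proc.stateAt, ← ih.2]; rfl

lemma centerMessage_eq_out (r : ℕ) :
    centerMessage center peers u₀ r = center.out (peersMessage center peers u₀) r := by
  simp only [Proc.out, ← (interact_states center peers u₀ r).1]
  rfl

lemma peersMessage_succ (r : ℕ) :
    peersMessage center peers u₀ (r + 1) = peers.out (centerMessage center peers u₀) r := by
  simp only [Proc.out, ← (interact_states center peers u₀ r).2]
  rfl

variable {center peers u₀}

/-- An interaction is determined by the input-output behavior of the two sides: it is the only pair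
of message streams that is consistent with both. -/
lemma eq_centerMessage {d : ℕ → D} {m : ℕ → U} (h0 : m 0 = u₀) (hd : ∀ r, d r = center.out m r)
    (hm : ∀ r, m (r + 1) = peers.out d r) : d = centerMessage center peers u₀ := by
  have key : ∀ r, (∀ q < r, d q = centerMessage center peers u₀ q) ∧
      ∀ q ≤ r, m q = peersMessage center peers u₀ q := by
    intro r
    induction r with
    | zero =>
      refine ⟨fun q hq => absurd hq (by omega), fun q hq => ?_⟩
      obtain rfl : q = 0 := by omega
      exact h0
    | succ r ih =>
      have hd' : ∀ q < r + 1, d q = centerMessage center peers u₀ q := by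
        intro q hq
        rw [hd, centerMessage_eq_out]
        exact center.out_congr fun p hp => ih.2 p (by omega)
      refine ⟨hd', fun q hq => ?_⟩
      rcases q with _ | q
      · exact h0
      · rw [hm, peersMessage_succ]
        exact peers.out_congr fun p hp => hd' p (by omega)
  exact funext fun r => (key (r + 1)).1 r (by omega)

lemma centerMessage_congr {center' : Proc U D} {peers' : Proc D U}
    (hc : center.out = center'.out) (hp : peers.out = peers'.out) :
    centerMessage center peers u₀ = centerMessage center' peers' u₀ :=
  eq_centerMessage rfl (fun r => by rw [centerMessage_eq_out, hc])
    fun r => by rw [← hp, peersMessage_succ]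

end Interact

/-! ### Machines with memory indexed by an arbitrary finite type -/

namespace Circuit

variable {ι ι' o o' : Type}

/-- Renaming of the input and output wires of a circuit. -/
def rename (c : Circuit ι o) (f : ι → ι') (g : o' → o) : Circuit ι' o' where
  gates := c.gates.map fun w => (Sum.map f id w.1, Sum.map f id w.2)
  out := fun j => Sum.map f id (c.out (g j))

lemma eval_rename (c : Circuit ι o) (f : ι → ι') (g : o' → o) (x : Bits ι') :
    (c.rename f g).eval x = fun j => c.eval (fun i => x (f i)) (g j) := by
  have hread : ∀ vals (w : ι ⊕ ℕ),
      read x vals (Sum.map f id w) = read (fun i => x (f i)) vals w := by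
    rintro vals (i | j) <;> rfl
  have hvals : (c.rename f g).gateValues x = c.gateValues fun i => x (f i) := by
    simp only [gateValues, rename, List.foldl_map, hread]
  funext j
  simp only [eval, hvals]
  exact hread _ _

end Circuit

section Reactive

variable {I In Out M : Type}

/-- The process with fixed input `x` and memory `M` whose rounds are given by functions on bits. -/
def reactive (f : ℕ → Bits (I ⊕ M ⊕ In) → Bits (M ⊕ Out)) (x : Bits I) :
    Proc (Bits In) (Bits Out) where
  σ := Bits M
  start := fun _ => false
  next := fun r s m =>
    (fun j => f r (Sum.elim x (Sum.elim s m)) (Sum.inl j),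
      fun j => f r (Sum.elim x (Sum.elim s m)) (Sum.inr j))

/-- A reactive process whose rounds are computed by small circuits is realized by a machine. -/
lemma exists_machine_of_circuits [Fintype M] (f : ℕ → Bits (I ⊕ M ⊕ In) → Bits (M ⊕ Out)) (s : ℕ)
    (hM : Fintype.card M ≤ s) (hf : ∀ r, ∃ c : Circuit (I ⊕ M ⊕ In) (M ⊕ Out),
      c.size ≤ s ∧ c.eval = f r) :
    ∃ T : Machine I In Out, T.Bounded s ∧ ∀ x, (T.toProc x).out = (reactive f x).out := by
  choose c hc hcf using hf
  let e := Fintype.equivFin M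
  refine ⟨⟨Fintype.card M, fun r => (c r).rename (Sum.map id (Sum.map e id)) (Sum.map e.symm id)⟩,
    ⟨hM, fun r => by simpa [Circuit.size, Circuit.rename] using hc r⟩, fun x => ?_⟩
  set T : Machine I In Out := ⟨Fintype.card M,
    fun r => (c r).rename (Sum.map id (Sum.map e id)) (Sum.map e.symm id)⟩ with hT
  have harg : ∀ (y : Bits (Fin (Fintype.card M))) (m : Bits In),
      (fun i => (Sum.elim x (Sum.elim y m) : Bits (I ⊕ Fin (Fintype.card M) ⊕ In))
        (Sum.map id (Sum.map e id) i)) = Sum.elim x (Sum.elim (fun j => y (e j)) m) := by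
    intro y m
    funext i
    rcases i with i | i | i <;> rfl
  have hstep : ∀ r (y : Bits (Fin (Fintype.card M))) (m : Bits In),
      (T.step r).eval (Sum.elim x (Sum.elim y m)) = fun j =>
        f r (Sum.elim x (Sum.elim (fun j => y (e j)) m)) (Sum.map e.symm id j) := by
    intro r y m
    show ((c r).rename _ _).eval _ = _
    rw [Circuit.eval_rename, harg, hcf]
  funext s r
  have hstate : ∀ r, (reactive f x).stateAt s r = fun j => (T.toProc x).stateAt s r (e j) := by
    intro r
    induction r with
    | zero => rfl
    | succ r ih =>
      funext j
      refine Eq.trans ?_ (congrFun (hstep r ((T.toProc x).stateAt s r) (s r)) (Sum.inl (e j))).symm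
      show f r (Sum.elim x (Sum.elim ((reactive f x).stateAt s r) (s r))) (Sum.inl j) =
        f r _ (Sum.inl (e.symm (e j)))
      rw [Equiv.symm_apply_apply]
      exact congrArg (fun y : Bits M => f r (Sum.elim x (Sum.elim y (s r))) (Sum.inl j)) ih
  funext j
  refine (congrFun (hstep r ((T.toProc x).stateAt s r) (s r)) (Sum.inr j)).trans ?_
  exact congrArg (fun y : Bits M => f r (Sum.elim x (Sum.elim y (s r))) (Sum.inr j)) (hstate r).symm

end Reactive

namespace Auction

variable {k : ℕ} {a : Auction k} {sec : ℕ}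

/-! ### A platform that runs several sessions at once -/

/-- A way to split the honest buyers `H` and the seller over several sessions `j`. In the session
`j` the platform pretends that the identities `Bs j` take part; those outside `H` are simulated
and bid `bids j`. Every honest buyer occurs in its own session only. -/
structure Sessions (a : Auction k) (sec : ℕ) (H : Finset (a.Id sec)) where
  J : Type
  fintype : Fintype J
  Bs : J → Finset (a.Id sec)
  bids : J → a.Values sec
  σ : Option H → J
  mem : ∀ i : H, i.1 ∈ Bs (σ (some i))
  eq_of_mem : ∀ j, ∀ i : H, i.1 ∈ Bs j → σ (some i) = j

namespace Sessions

variable {H : Finset (a.Id sec)} (s : Sessions a sec H)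

instance : Fintype s.J := s.fintype

/-- The number of bids announced to an honest player: the one of its session. -/
def announce (i : Option H) : ℕ := (s.Bs (s.σ i)).card

/-- The participant of its session that an honest player is. -/
def place : ∀ i : Option H, Option (s.Bs (s.σ i))
  | none => none
  | some i => some ⟨i.1, s.mem i⟩

/-- Wires (or coins) of all sessions, where `l N` is the number of wires of one player in a session
with `N` bids. -/
abbrev Total (l : ℕ → ℕ) : Type := Σ j, Σ _ : Option (s.Bs j), Fin (l (s.Bs j).card)

/-- The wires (or coins) of the honest players among those of all sessions. -/
def wire (l : ℕ → ℕ) (w : Σ i : Option H, Fin (l (s.announce i))) : s.Total l :=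
  ⟨s.σ w.1, s.place w.1, w.2⟩

lemma wire_injective (l : ℕ → ℕ) : Function.Injective (s.wire l) := by
  rintro ⟨i, b⟩ ⟨i', b'⟩ h
  have hid : ∀ w, ((s.wire l w).2.1).map Subtype.val = w.1.map Subtype.val := by
    rintro ⟨_ | i, b⟩ <;> rfl
  have h1 := hid ⟨i, b⟩
  rw [h, hid] at h1
  obtain rfl : i' = i := Option.map_injective Subtype.val_injective h1
  obtain rfl : b = b' := eq_of_heq (Sigma.mk.inj (eq_of_heq (Sigma.mk.inj h).2)).2
  rfl

/-- The random coins for all sessions: those of the platform and of every participant. -/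
abbrev CoinIndex : Type :=
  Σ j, (Fin (a.coinLen sec (s.Bs j).card) ⊕
    Σ _ : Option (s.Bs j), Fin (a.coinLen sec (s.Bs j).card))

/-- The fake identities: all simulated participants. -/
def fakes : Finset (a.Id sec) := Finset.univ.biUnion s.Bs \ H

variable (A : Finset (a.Id sec))

/-- The input wires of the machine that runs all sessions. -/
abbrev In : Type :=
  Fin (a.pubLen sec) ⊕ Fin (a.keyLen sec) ⊕ (↥(A ∪ s.fakes) × Fin (a.keyLen sec)) ⊕
    Fin (Fintype.card s.CoinIndex)

/-- The honest protocol of a participant of a session. -/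
abbrev peerMach (j : s.J) (p : Option (s.Bs j)) :=
  peerMachine a sec (s.Bs j) (fun _ => (s.Bs j).card) (s.bids j) p

/-- The memory of the machine that runs all sessions: the memories of the simulated platforms and
participants, and the last messages of the latter. -/
abbrev Mem : Type :=
  (Σ j, Fin (a.platform sec (s.Bs j)).mem) ⊕
    (Σ q : (Σ j, Option (s.Bs j)), Fin (s.peerMach q.1 q.2).mem) ⊕ s.Total (a.msgLen sec)

/-- All wires that a round of the machine can read. -/
abbrev StepIn : Type := s.In A ⊕ s.Mem ⊕ a.Wires sec H s.announce

/-- Where the machine finds the input of the simulated platform. -/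
noncomputable def platInput (j : s.J) :
    Fin (a.pubLen sec) ⊕ Fin (a.keyLen sec) ⊕ Fin (a.coinLen sec (s.Bs j).card) → s.In A :=
  Sum.elim Sum.inl (Sum.elim (fun l => Sum.inr (Sum.inl l))
    fun c => Sum.inr (Sum.inr (Sum.inr (Fintype.equivFin s.CoinIndex ⟨j, Sum.inl c⟩))))

/-- Where the machine finds the secret key of a participant of a session. Keys that it does not have
are replaced by zeros. -/
def keyWire (j : s.J) : Option (s.Bs j) → Fin (a.keyLen sec) → Option (s.In A)
  | none => fun _ => none
  | some i => fun l =>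
    if h : i.1 ∈ A ∪ s.fakes then some (Sum.inr (Sum.inr (Sum.inl (⟨i.1, h⟩, l)))) else none

/-- Where the machine finds the input of a simulated participant. -/
noncomputable def simInput (j : s.J) (p : Option (s.Bs j)) :
    a.Input sec (s.Bs j).card → Option (s.In A) :=
  Sum.elim (fun l => some (Sum.inl l)) (Sum.elim (s.keyWire A j p)
    fun c => some (Sum.inr (Sum.inr (Sum.inr (Fintype.equivFin s.CoinIndex
      ⟨j, Sum.inr ⟨p, c⟩⟩)))))

/-- Where the machine finds the messages to the platform of session `j`: on the wires of the honest
players, and in the memory for the simulated participants. -/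
noncomputable def msgWire : s.Total (a.msgLen sec) → s.StepIn A :=
  Function.extend (s.wire (a.msgLen sec)) (fun w => Sum.inr (Sum.inr w))
    fun w => Sum.inr (Sum.inl (Sum.inr (Sum.inr w)))

/-- Where the machine finds everything that the platform of session `j` reads in one round. -/
noncomputable def platWire (j : s.J) :
    (Fin (a.pubLen sec) ⊕ Fin (a.keyLen sec) ⊕ Fin (a.coinLen sec (s.Bs j).card)) ⊕
      Fin (a.platform sec (s.Bs j)).mem ⊕
      (Σ _ : Option (s.Bs j), Fin (a.msgLen sec (s.Bs j).card)) → s.StepIn A :=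
  Sum.elim (fun i => Sum.inl (s.platInput A j i))
    (Sum.elim (fun m => Sum.inr (Sum.inl (Sum.inl ⟨j, m⟩))) fun w => s.msgWire A ⟨j, w⟩)

/-- The platform of session `j` in round `r`. -/
noncomputable def platOut (r : ℕ) (j : s.J) (x : Bits (s.StepIn A)) :
    Bits (Fin (a.platform sec (s.Bs j)).mem ⊕
      (Σ _ : Option (s.Bs j), Fin (a.msgLen sec (s.Bs j).card))) :=
  ((a.platform sec (s.Bs j)).step r).eval fun i => x (s.platWire A j i)

/-- What the simulated participant `p` of session `j` reads in round `r`. -/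
noncomputable def simArg (r : ℕ) (j : s.J) (p : Option (s.Bs j)) :
    a.Input sec (s.Bs j).card ⊕ Fin (s.peerMach j p).mem ⊕ Fin (a.msgLen sec (s.Bs j).card) →
      Bits (s.StepIn A) → Bool :=
  Sum.elim (fun i => Circuit.input ((s.simInput A j p i).map Sum.inl))
    (Sum.elim (fun m => Circuit.input (some (Sum.inr (Sum.inl (Sum.inr (Sum.inl ⟨⟨j, p⟩, m⟩))))))
      fun b x => s.platOut A r j x (Sum.inr ⟨p, b⟩))

/-- The simulated participant `p` of session `j` in round `r`. -/
noncomputable def simOut (r : ℕ) (j : s.J) (p : Option (s.Bs j)) (x : Bits (s.StepIn A)) :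
    Bits (Fin (s.peerMach j p).mem ⊕ Fin (a.msgLen sec (s.Bs j).card)) :=
  ((s.peerMach j p).step r).eval fun i => s.simArg A r j p i x

/-- A round of the machine that runs all sessions: it first simulates the platforms and then the
other participants. Honest players are simulated as well, but what their simulation sends is
ignored. -/
noncomputable def step (r : ℕ) (x : Bits (s.StepIn A)) :
    Bits (s.Mem ⊕ a.Wires sec H s.announce) :=
  Sum.elim
    (Sum.elim (fun w => s.platOut A r w.1 x (Sum.inl w.2))
      (Sum.elim (fun w => s.simOut A r w.1.1 w.1.2 x (Sum.inl w.2))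
        fun w => s.simOut A r w.1 w.2.1 x (Sum.inr w.2.2)))
    fun w => s.platOut A r (s.σ w.1) x (Sum.inr ⟨s.place w.1, w.2⟩)

lemma exists_circuit_step (r : ℕ) : ∃ c : Circuit (s.StepIn A) (s.Mem ⊕ a.Wires sec H s.announce),
    c.size ≤ ∑ j, ((a.platform sec (s.Bs j)).step r).size +
      ∑ q : (Σ j, Option (s.Bs j)), ((s.peerMach q.1 q.2).step r).size ∧
    c.eval = s.step A r := by
  have h1 := (Circuit.computableWith_input (ι := s.StepIn A)).extend_finset
    (fun j => (a.platform sec (s.Bs j)).step r)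
    (fun j i => Circuit.input (some (s.platWire A j i))) (fun j i => ⟨_, rfl⟩) Finset.univ
  have h2 := h1.extend_finset (fun q : (Σ j, Option (s.Bs j)) => (s.peerMach q.1 q.2).step r)
    (fun q => s.simArg A r q.1 q.2) (by
      rintro ⟨j, p⟩ (i | m | b)
      · exact Or.inl ⟨_, rfl⟩
      · exact Or.inl ⟨some (Sum.inr (Sum.inl (Sum.inr (Sum.inl ⟨⟨j, p⟩, m⟩)))), rfl⟩
      · exact Or.inr ⟨j, Finset.mem_univ _, _, rfl⟩) Finset.univ
  rw [Nat.zero_add] at h2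
  refine h2.exists_circuit _ ?_
  rintro ((⟨j, m⟩ | ⟨⟨j, p⟩, m⟩ | ⟨j, p, b⟩) | ⟨i, b⟩)
  · exact Or.inl (Or.inr ⟨j, Finset.mem_univ _, _, rfl⟩)
  · exact Or.inr ⟨⟨j, p⟩, Finset.mem_univ _, _, rfl⟩
  · exact Or.inr ⟨⟨j, p⟩, Finset.mem_univ _, _, rfl⟩
  · exact Or.inl (Or.inr ⟨s.σ i, Finset.mem_univ _, _, rfl⟩)

end Sessions

end Auction

/-! ### Executions in which the platform runs several sessions -/

/-- The memory of a machine before round `r`, when it receives the messages `s`. -/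
def Machine.memAt {I In Out : Type} (M : Machine I In Out) (x : Bits I) (s : ℕ → Bits In) (r : ℕ) :
    Bits (Fin M.mem) :=
  (M.toProc x).stateAt s r

lemma Machine.memAt_succ {I In Out : Type} (M : Machine I In Out) (x : Bits I) (s : ℕ → Bits In)
    (r : ℕ) : M.memAt x s (r + 1) = fun j =>
      (M.step r).eval (Sum.elim x (Sum.elim (M.memAt x s r) (s r))) (Sum.inl j) := rfl

lemma Machine.out_toProc {I In Out : Type} (M : Machine I In Out) (x : Bits I) (s : ℕ → Bits In)
    (r : ℕ) : (M.toProc x).out s r = fun j =>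
      (M.step r).eval (Sum.elim x (Sum.elim (M.memAt x s r) (s r))) (Sum.inr j) := rfl

namespace Auction

variable {k : ℕ} {a : Auction k} {sec : ℕ}

/-- If there is no PKI or the seller is silent, then the seller can be simulated without its key. -/
lemma out_seller_congr (hseller : a.NoPKI ∨ a.SellerSilent) (N : ℕ) (p : Bits (Fin (a.pubLen sec)))
    (κ κ' : Bits (Fin (a.keyLen sec))) (c : Bits (Fin (a.coinLen sec N))) :
    ((a.seller sec N).toProc (Sum.elim p (Sum.elim κ c))).out =
      ((a.seller sec N).toProc (Sum.elim p (Sum.elim κ' c))).out := by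
  rcases hseller with h | h
  · have : κ = κ' := by
      funext i
      exact absurd i.2 (by simp [h sec])
    rw [this]
  · funext s r j
    simp only [Machine.out_toProc, h sec N r _ j]

namespace Sessions

variable {H : Finset (a.Id sec)} (s : Sessions a sec H) (A : Finset (a.Id sec))

section Run

variable (x : Bits (s.In A)) (m : ℕ → Bits (a.Wires sec H s.announce))

/-- The memory of the machine that runs all sessions before round `r`. -/
noncomputable def memAt (r : ℕ) : Bits s.Mem := (reactive (s.step A) x).stateAt m r

/-- Everything that the machine that runs all sessions reads in round `r`. -/
noncomputable def argAt (r : ℕ) : Bits (s.StepIn A) := Sum.elim x (Sum.elim (s.memAt A x m r) (m r))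

/-- The messages that reach the platforms of all sessions in round `r`. -/
noncomputable def incoming (r : ℕ) : Bits (s.Total (a.msgLen sec)) :=
  Function.extend (s.wire (a.msgLen sec)) (m r) fun w => s.memAt A x m r (Sum.inr (Sum.inr w))

/-- The platform of session `j` as a process. -/
noncomputable def platProc (j : s.J) : Proc (Bits (a.Wires sec (s.Bs j) fun _ => (s.Bs j).card))
    (Bits (a.Wires sec (s.Bs j) fun _ => (s.Bs j).card)) :=
  (a.platform sec (s.Bs j)).toProc fun i => x (s.platInput A j i)

/-- What the platform of session `j` sends in round `r`. -/
noncomputable def outgoing (j : s.J) (r : ℕ) : Bits (a.Wires sec (s.Bs j) fun _ => (s.Bs j).card) :=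
  (s.platProc A x j).out (fun q w => s.incoming A x m q ⟨j, w⟩) r

lemma memAt_succ (r : ℕ) : s.memAt A x m (r + 1) = fun j =>
    s.step A r (s.argAt A x m r) (Sum.inl j) := rfl

lemma argAt_msgWire (r : ℕ) (w : s.Total (a.msgLen sec)) :
    s.argAt A x m r (s.msgWire A w) = s.incoming A x m r w := by
  exact Function.apply_extend (s.argAt A x m r) _ _ _

lemma argAt_platWire (r : ℕ) (j : s.J) :
    (fun i => s.argAt A x m r (s.platWire A j i)) =
      Sum.elim (fun i => x (s.platInput A j i))
        (Sum.elim (fun i => s.memAt A x m r (Sum.inl ⟨j, i⟩))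
          fun w => s.incoming A x m r ⟨j, w⟩) := by
  funext i
  rcases i with i | i | w
  · rfl
  · rfl
  · exact s.argAt_msgWire A x m r ⟨j, w⟩

lemma memAt_plat (r : ℕ) (j : s.J) : (fun i => s.memAt A x m r (Sum.inl ⟨j, i⟩)) =
    (a.platform sec (s.Bs j)).memAt (fun i => x (s.platInput A j i))
      (fun q w => s.incoming A x m q ⟨j, w⟩) r := by
  induction r with
  | zero => rfl
  | succ r ih =>
    rw [memAt_succ, Machine.memAt_succ, ← ih, ← argAt_platWire]
    rfl

lemma platOut_argAt (r : ℕ) (j : s.J) (w : a.Wires sec (s.Bs j) fun _ => (s.Bs j).card) :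
    s.platOut A r j (s.argAt A x m r) (Sum.inr w) = s.outgoing A x m j r w := by
  rw [platOut, outgoing, platProc, Machine.out_toProc, argAt_platWire, memAt_plat]

lemma out_reactive_step (r : ℕ) (w : a.Wires sec H s.announce) :
    (reactive (s.step A) x).out m r w = s.outgoing A x m (s.σ w.1) r ⟨s.place w.1, w.2⟩ := by
  rw [← platOut_argAt]
  rfl

/-- A simulated participant as a process. -/
noncomputable def simProc (j : s.J) (p : Option (s.Bs j)) :
    Proc (Bits (Fin (a.msgLen sec (s.Bs j).card))) (Bits (Fin (a.msgLen sec (s.Bs j).card))) :=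
  (s.peerMach j p).toProc fun i => (s.simInput A j p i).elim false x

lemma argAt_simArg (r : ℕ) (j : s.J) (p : Option (s.Bs j)) :
    (fun i => s.simArg A r j p i (s.argAt A x m r)) =
      Sum.elim (fun i => (s.simInput A j p i).elim false x)
        (Sum.elim (fun i => s.memAt A x m r (Sum.inr (Sum.inl ⟨⟨j, p⟩, i⟩)))
          fun b => s.outgoing A x m j r ⟨p, b⟩) := by
  funext i
  rcases i with i | i | b
  · simp only [simArg, Sum.elim_inl, Circuit.input]
    cases s.simInput A j p i <;> rfl
  · rfl
  · exact s.platOut_argAt A x m r j ⟨p, b⟩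

lemma memAt_sim (r : ℕ) (j : s.J) (p : Option (s.Bs j)) :
    (fun i => s.memAt A x m r (Sum.inr (Sum.inl ⟨⟨j, p⟩, i⟩))) =
    (s.peerMach j p).memAt (fun i => (s.simInput A j p i).elim false x)
      (fun q b => s.outgoing A x m j q ⟨p, b⟩) r := by
  induction r with
  | zero => rfl
  | succ r ih =>
    rw [memAt_succ, Machine.memAt_succ, ← ih, ← argAt_simArg]
    rfl

lemma memAt_msg_succ (r : ℕ) (j : s.J) (p : Option (s.Bs j))
    (b : Fin (a.msgLen sec (s.Bs j).card)) :
    s.memAt A x m (r + 1) (Sum.inr (Sum.inr ⟨j, p, b⟩)) =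
      (s.simProc A x j p).out (fun q b => s.outgoing A x m j q ⟨p, b⟩) r b := by
  rw [memAt_succ, simProc, Machine.out_toProc, ← memAt_sim, ← argAt_simArg]
  rfl

end Run

lemma exists_machine (b : ℕ) (hM : Fintype.card s.Mem ≤ b)
    (hc : ∀ r, ∑ j, ((a.platform sec (s.Bs j)).step r).size +
      ∑ q : (Σ j, Option (s.Bs j)), ((s.peerMach q.1 q.2).step r).size ≤ b) :
    ∃ T : Machine (s.In A) (a.Wires sec H s.announce) (a.Wires sec H s.announce),
      T.Bounded b ∧ ∀ x, (T.toProc x).out = (reactive (s.step A) x).out :=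
  exists_machine_of_circuits (s.step A) b hM fun r =>
    (s.exists_circuit_step A r).imp fun _ h => ⟨h.1.trans (hc r), h.2⟩

/-- The strategy of the platform that runs all sessions in `s`, on a machine whose input-output
behavior is the one of the process with rounds `Sessions.step`. -/
noncomputable def strategy (T : Machine (s.In A) (a.Wires sec H s.announce)
    (a.Wires sec H s.announce)) : a.PlatformStrategy sec H A where
  fakes := s.fakes
  disjoint := Finset.disjoint_sdiff
  announce := s.announce
  coins := Fintype.card s.CoinIndex
  machine := T

section Transcript

variable (v : a.Values sec) (κ : Bits (Fin (a.setupLen sec))) (ω : a.PeerCoins sec H s.announce)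
  (τ : Bits (Fin (Fintype.card s.CoinIndex)))

/-- The bids in session `j`: the honest buyers bid their values `v`. -/
def sessionBids (j : s.J) : a.Values sec := H.piecewise v (s.bids j)

/-- The coins of all participants of all sessions. -/
noncomputable def allCoins : Bits (s.Total (a.coinLen sec)) :=
  Function.extend (s.wire (a.coinLen sec)) (fun w => ω w.1 w.2)
    fun w => τ (Fintype.equivFin s.CoinIndex ⟨w.1, Sum.inr w.2⟩)

/-- The coins of the participants of session `j`. -/
noncomputable def peerCoins (j : s.J) : a.PeerCoins sec (s.Bs j) fun _ => (s.Bs j).card :=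
  fun p c => s.allCoins ω τ ⟨j, p, c⟩

/-- The coins of the simulated platform of session `j`. -/
noncomputable def platCoins (j : s.J) : Bits (Fin (a.coinLen sec (s.Bs j).card)) :=
  fun c => τ (Fintype.equivFin s.CoinIndex ⟨j, Sum.inl c⟩)

/-- The honest execution that the players of session `j` see. -/
noncomputable def sessionTranscript (j : s.J) :
    a.Transcript sec (s.Bs j) fun _ => (s.Bs j).card :=
  honestTranscript (s.Bs j) (s.sessionBids v j) κ (s.peerCoins ω τ j) (s.platCoins τ j)

lemma peerCoins_place (i : Option H) : s.peerCoins ω τ (s.σ i) (s.place i) = ω i := by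
  funext c
  show s.allCoins ω τ (s.wire _ ⟨i, c⟩) = _
  unfold allCoins
  exact (s.wire_injective _).extend_apply _ _ _

lemma peerInput_place (K : Keys (a.pubLen sec) (a.keyLen sec) (a.numIds sec)) (i : Option H) :
    peerInput (N := fun _ => (s.Bs (s.σ i)).card) K (s.peerCoins ω τ (s.σ i)) (s.place i) =
      peerInput (N := s.announce) K ω i := by
  unfold peerInput
  rw [peerCoins_place]
  rcases i with _ | i <;> rfl

lemma peerMachine_place (i : Option H) :
    peerMachine a sec (s.Bs (s.σ i)) (fun _ => (s.Bs (s.σ i)).card) (s.sessionBids v (s.σ i))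
      (s.place i) = peerMachine a sec H s.announce v i := by
  rcases i with _ | i
  · rfl
  · have : s.sessionBids v (s.σ (some i)) i = v i := Finset.piecewise_eq_of_mem _ _ _ i.2
    show a.buyer sec _ i.1 (s.sessionBids v (s.σ (some i)) i) = a.buyer sec _ i.1 (v i)
    rw [this]

variable (K : Keys (a.pubLen sec) (a.keyLen sec) (a.numIds sec))

/-- The input of the machine that runs all sessions. -/
def input : Bits (s.In A) :=
  Sum.elim K.pub (Sum.elim K.platform (Sum.elim (fun w => K.buyer w.1 w.2) τ))

variable {K} in
/-- A participant that is not among the honest players is simulated perfectly. -/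
lemma out_simProc (hseller : a.NoPKI ∨ a.SellerSilent) (j : s.J) (p : Option (s.Bs j))
    (hp : ∀ i, (⟨s.σ i, s.place i⟩ : Σ j, Option (s.Bs j)) ≠ ⟨j, p⟩) :
    (s.simProc A (s.input A τ K) j p).out =
      ((peerMachine a sec (s.Bs j) (fun _ => (s.Bs j).card) (s.sessionBids v j) p).toProc
        (peerInput K (s.peerCoins ω τ j) p)).out := by
  have hcoins : ∀ c, s.peerCoins ω τ j p c =
      τ (Fintype.equivFin s.CoinIndex ⟨j, Sum.inr ⟨p, c⟩⟩) := by
    intro c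
    show s.allCoins ω τ ⟨j, p, c⟩ = _
    unfold allCoins
    refine Function.extend_apply' _ _ _ ?_
    rintro ⟨⟨i, c'⟩, hw⟩
    refine hp i ?_
    have h := congrArg (fun w : s.Total (a.coinLen sec) =>
      (⟨w.1, w.2.1⟩ : Σ j, Option (s.Bs j))) hw
    exact h
  rcases p with _ | i
  · have hin : (fun l => (s.simInput A j none l).elim false (s.input A τ K)) =
        Sum.elim K.pub (Sum.elim (fun _ => false) (s.peerCoins ω τ j none)) := by
      funext l
      rcases l with l | l | c
      · rfl
      · rfl
      · exact (hcoins c).symm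
    unfold simProc
    rw [hin]
    exact out_seller_congr hseller _ _ _ _ _
  · have hiH : i.1 ∉ H := by
      intro hi
      refine hp (some ⟨i.1, hi⟩) ?_
      have key : ∀ j' (hj : s.σ (some ⟨i.1, hi⟩) = j') (hij : i.1 ∈ s.Bs j'),
          (⟨s.σ (some ⟨i.1, hi⟩), s.place (some ⟨i.1, hi⟩)⟩ : Σ j, Option (s.Bs j)) =
            ⟨j', some ⟨i.1, hij⟩⟩ := by
        rintro _ rfl _
        rfl
      exact key j (s.eq_of_mem j ⟨i.1, hi⟩ i.2) i.2
    have hiA : i.1 ∈ A ∪ s.fakes :=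
      Finset.mem_union_right _ (Finset.mem_sdiff.2
        ⟨Finset.mem_biUnion.2 ⟨j, Finset.mem_univ _, i.2⟩, hiH⟩)
    have hin : (fun l => (s.simInput A j (some i) l).elim false (s.input A τ K)) =
        peerInput K (s.peerCoins ω τ j) (some i) := by
      funext l
      rcases l with l | l | c
      · rfl
      · simp only [simInput, Sum.elim_inr, Sum.elim_inl, keyWire, dif_pos hiA]
        rfl
      · exact (hcoins c).symm
    unfold simProc
    rw [hin]
    have hb : s.sessionBids v j i = s.bids j i := Finset.piecewise_eq_of_notMem _ _ _ hiH
    show ((a.buyer sec _ i.1 (s.bids j i)).toProc _).out =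
      ((a.buyer sec _ i.1 (s.sessionBids v j i)).toProc _).out
    rw [hb]

/-- Against the machine that runs all sessions, every honest player sees exactly what it sees in an
honest execution of its own session. -/
lemma msgs_strategy (hseller : a.NoPKI ∨ a.SellerSilent)
    {T : Machine (s.In A) (a.Wires sec H s.announce) (a.Wires sec H s.announce)}
    (hT : ∀ x, (T.toProc x).out = (reactive (s.step A) x).out) (r : ℕ)
    (w : a.Wires sec H s.announce) :
    ((s.strategy A T).transcript v κ ω τ).msgs r w =
      (s.sessionTranscript v κ ω τ (s.σ w.1)).msgs r ⟨s.place w.1, w.2⟩ := by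
  set K := a.setup sec κ with hK
  set x := s.input A τ K with hx
  set peers := honestPeers s.announce v K ω with hpeers
  have hmsgs : ((s.strategy A T).transcript v κ ω τ).msgs =
      centerMessage (reactive (s.step A) x) peers fun _ => false :=
    centerMessage_congr (hT x) rfl
  rw [hmsgs]
  set m := peersMessage (reactive (s.step A) x) peers fun _ => false with hm
  have hd : ∀ r w, centerMessage (reactive (s.step A) x) peers (fun _ => false) r w =
      s.outgoing A x m (s.σ w.1) r ⟨s.place w.1, w.2⟩ := by
    intro r w
    rw [centerMessage_eq_out, out_reactive_step]
  rw [hd]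
  suffices h : ∀ j, s.outgoing A x m j = (s.sessionTranscript v κ ω τ j).msgs by rw [h]
  intro j
  refine eq_centerMessage (m := fun q w => s.incoming A x m q ⟨j, w⟩) ?_ ?_ ?_
  · funext w
    have h0 : ∀ w, s.incoming A x m 0 w = false := by
      intro w
      unfold incoming
      by_cases h : ∃ w', s.wire (a.msgLen sec) w' = w
      · obtain ⟨w', rfl⟩ := h
        rw [(s.wire_injective _).extend_apply]
        rfl
      · rw [Function.extend_apply' _ _ _ h]
        rfl
    exact h0 _
  · intro r
    have hp : s.platProc A x j = (a.platform sec (s.Bs j)).toProc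
        (Sum.elim K.pub (Sum.elim K.platform (s.platCoins τ j))) := by
      unfold platProc
      congr 1
      funext i
      rcases i with i | i | i <;> rfl
    rw [← hp]
    rfl
  · intro r
    funext w
    have hnext : ∀ w : s.Total (a.msgLen sec), s.incoming A x m (r + 1) w =
        ((peerMachine a sec (s.Bs w.1) (fun _ => (s.Bs w.1).card) (s.sessionBids v w.1)
          w.2.1).toProc (peerInput K (s.peerCoins ω τ w.1) w.2.1)).out
            (fun q b => s.outgoing A x m w.1 q ⟨w.2.1, b⟩) r w.2.2 := by
      intro w
      unfold incoming
      by_cases h : ∃ w', s.wire (a.msgLen sec) w' = w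
      · obtain ⟨⟨i, b⟩, rfl⟩ := h
        rw [(s.wire_injective _).extend_apply, hm, peersMessage_succ, hpeers, honestPeers,
          Proc.out_parallel, ← honestPeers, ← hpeers]
        simp only [hd]
        show _ = ((peerMachine a sec (s.Bs (s.σ i)) (fun _ => (s.Bs (s.σ i)).card)
          (s.sessionBids v (s.σ i)) (s.place i)).toProc
            (peerInput K (s.peerCoins ω τ (s.σ i)) (s.place i))).out
              (fun q b => s.outgoing A x m (s.σ i) q ⟨s.place i, b⟩) r b
        rw [peerMachine_place, peerInput_place]
        rfl
      · rw [Function.extend_apply' _ _ _ h]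
        obtain ⟨j, p, b⟩ := w
        rw [memAt_msg_succ]
        refine congrFun (congrFun (congrFun (s.out_simProc A v ω τ hseller j p ?_) _) r) b
        rintro i hi
        refine h ?_
        cases hi
        exact ⟨⟨i, b⟩, rfl⟩
    refine (hnext ⟨j, w⟩).trans ?_
    obtain ⟨p, b⟩ := w
    rw [honestPeers, Proc.out_parallel]

end Transcript

end Sessions
end Auction
lemma eval_le_eval_of_le (P : Polynomial ℕ) {m n : ℕ} (h : m ≤ n) : P.eval m ≤ P.eval n := by
  rw [Polynomial.eval_eq_sum_range, Polynomial.eval_eq_sum_range]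
  gcongr

namespace Auction

variable {k : ℕ} {a : Auction k} {sec : ℕ}

namespace Sessions

variable {H : Finset (a.Id sec)} (s : Sessions a sec H) (A : Finset (a.Id sec))

section Outcome

variable (v : a.Values sec) (κ : Bits (Fin (a.setupLen sec))) (ω : a.PeerCoins sec H s.announce)
  (τ : Bits (Fin (Fintype.card s.CoinIndex)))
  {T : Machine (s.In A) (a.Wires sec H s.announce) (a.Wires sec H s.announce)}

lemma received_strategy (hseller : a.NoPKI ∨ a.SellerSilent)
    (hT : ∀ x, (T.toProc x).out = (reactive (s.step A) x).out) (i : Option H) :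
    ((s.strategy A T).transcript v κ ω τ).received i =
      (s.sessionTranscript v κ ω τ (s.σ i)).received (s.place i) :=
  funext fun r => funext fun j => s.msgs_strategy A v κ ω τ hseller hT r ⟨i, j⟩

lemma sellerOut_strategy (hseller : a.NoPKI ∨ a.SellerSilent)
    (hT : ∀ x, (T.toProc x).out = (reactive (s.step A) x).out) :
    ((s.strategy A T).transcript v κ ω τ).sellerOut =
      (s.sessionTranscript v κ ω τ (s.σ none)).sellerOut := by
  unfold Transcript.sellerOut Transcript.lastMessage
  rw [received_strategy s A v κ ω τ hseller hT none]
  rfl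

lemma buyerOut_strategy (hseller : a.NoPKI ∨ a.SellerSilent)
    (hT : ∀ x, (T.toProc x).out = (reactive (s.step A) x).out) (i : H) :
    ((s.strategy A T).transcript v κ ω τ).buyerOut i =
      (s.sessionTranscript v κ ω τ (s.σ (some i))).buyerOut ⟨i.1, s.mem i⟩ := by
  unfold Transcript.buyerOut Transcript.lastMessage
  rw [received_strategy s A v κ ω τ hseller hT (some i)]
  rfl

lemma accepts_strategy (hseller : a.NoPKI ∨ a.SellerSilent)
    (hT : ∀ x, (T.toProc x).out = (reactive (s.step A) x).out) (i : Option H) :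
    ((s.strategy A T).transcript v κ ω τ).Accepts i ↔
      (s.sessionTranscript v κ ω τ (s.σ i)).Accepts (s.place i) := by
  have hr := received_strategy s A v κ ω τ hseller hT i
  have hi := s.peerInput_place ω τ (a.setup sec κ) i
  rcases i with _ | i
  · show a.sellerAccepts sec _ (peerInput (N := s.announce) (a.setup sec κ) ω none)
      (((s.strategy A T).transcript v κ ω τ).received none) = true ↔ _
    rw [hr, ← hi]
    rfl
  · have hb : s.sessionBids v (s.σ (some i)) i = v i := Finset.piecewise_eq_of_mem _ _ _ i.2
    show a.buyerAccepts sec _ i.1 (v i.1) (peerInput (N := s.announce) (a.setup sec κ) ω (some i))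
      (((s.strategy A T).transcript v κ ω τ).received (some i)) = true ↔ _
    rw [hr, ← hi, ← hb]
    rfl

end Outcome

/-! ### Resources -/

/-- A bound on the resources needed to run all sessions. -/
lemma card_mem_le {P m : ℕ}
    (hplat : ∀ j, (a.platform sec (s.Bs j)).mem ≤ P) (hpeer : ∀ j p, (s.peerMach j p).mem ≤ P)
    (hmsg : ∀ j, a.msgLen sec (s.Bs j).card ≤ P) (hm : ∀ j, (s.Bs j).card ≤ m) :
    Fintype.card s.Mem ≤ Fintype.card s.J * ((2 * m + 3) * P) := by
  have h1 : Fintype.card (Σ j, Fin (a.platform sec (s.Bs j)).mem) ≤ Fintype.card s.J * P := by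
    rw [Fintype.card_sigma, ← smul_eq_mul]
    exact Finset.sum_le_card_nsmul _ _ _ fun j _ => by simpa using hplat j
  have h2 : Fintype.card (Σ q : (Σ j, Option (s.Bs j)), Fin (s.peerMach q.1 q.2).mem) ≤
      Fintype.card s.J * ((m + 1) * P) := by
    rw [Fintype.card_sigma, Fintype.sum_sigma, ← smul_eq_mul]
    refine Finset.sum_le_card_nsmul _ _ _ fun j _ => ?_
    refine (Finset.sum_le_card_nsmul _ _ P fun p _ => by simpa using hpeer j p).trans ?_
    simpa using Nat.mul_le_mul_right P (Nat.succ_le_succ (hm j))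
  have h3 : Fintype.card (s.Total (a.msgLen sec)) ≤ Fintype.card s.J * ((m + 1) * P) := by
    rw [Fintype.card_sigma, ← smul_eq_mul]
    refine Finset.sum_le_card_nsmul _ _ _ fun j _ => ?_
    rw [Fintype.card_sigma, ← smul_eq_mul]
    refine (Finset.sum_le_card_nsmul _ _ P fun p _ => by simpa using hmsg j).trans ?_
    simpa using Nat.mul_le_mul_right P (Nat.succ_le_succ (hm j))
  rw [Fintype.card_sum, Fintype.card_sum]
  nlinarith

lemma sum_size_le {P m : ℕ} (r : ℕ)
    (hplat : ∀ j, ((a.platform sec (s.Bs j)).step r).size ≤ P)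
    (hpeer : ∀ j p, ((s.peerMach j p).step r).size ≤ P) (hm : ∀ j, (s.Bs j).card ≤ m) :
    ∑ j, ((a.platform sec (s.Bs j)).step r).size +
      ∑ q : (Σ j, Option (s.Bs j)), ((s.peerMach q.1 q.2).step r).size ≤
        Fintype.card s.J * ((m + 2) * P) := by
  have h1 : ∑ j, ((a.platform sec (s.Bs j)).step r).size ≤ Fintype.card s.J * P := by
    rw [← smul_eq_mul]
    exact Finset.sum_le_card_nsmul _ _ _ fun j _ => hplat j
  have h2 : ∑ q : (Σ j, Option (s.Bs j)), ((s.peerMach q.1 q.2).step r).size ≤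
      Fintype.card s.J * ((m + 1) * P) := by
    rw [Fintype.sum_sigma, ← smul_eq_mul]
    refine Finset.sum_le_card_nsmul _ _ _ fun j _ => ?_
    refine (Finset.sum_le_card_nsmul _ _ P fun p _ => hpeer j p).trans ?_
    simpa using Nat.mul_le_mul_right P (Nat.succ_le_succ (hm j))
  nlinarith

lemma card_coinIndex_le {P m : ℕ} (hcoin : ∀ j, a.coinLen sec (s.Bs j).card ≤ P)
    (hm : ∀ j, (s.Bs j).card ≤ m) :
    Fintype.card s.CoinIndex ≤ Fintype.card s.J * ((m + 2) * P) := by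
  rw [Fintype.card_sigma, ← smul_eq_mul]
  refine Finset.sum_le_card_nsmul _ _ _ fun j _ => ?_
  rw [Fintype.card_sum, Fintype.card_sigma]
  have : ∑ i : Option (s.Bs j), Fintype.card (Fin (a.coinLen sec (s.Bs j).card)) ≤ (m + 1) * P := by
    refine (Finset.sum_le_card_nsmul _ _ P fun p _ => by simpa using hcoin j).trans ?_
    simpa using Nat.mul_le_mul_right P (Nat.succ_le_succ (hm j))
  have h := hcoin j
  refine (Nat.add_le_add ((Fintype.card_fin _).le.trans h) this).trans ?_
  linarith

lemma card_fakes_le {m : ℕ} (hm : ∀ j, (s.Bs j).card ≤ m) :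
    s.fakes.card ≤ Fintype.card s.J * m := by
  refine (Finset.card_le_card Finset.sdiff_subset).trans ?_
  exact Finset.card_biUnion_le_card_mul _ _ _ fun j _ => hm j

/-- If honest players run in polynomial time, then all sessions can be run in time polynomial in
the number of sessions and the number of their participants. -/
lemma exists_bounded_strategy {P : Polynomial ℕ}
    (hlen : ∀ sec N, a.rounds sec N ≤ P.eval (sec + N) ∧ a.msgLen sec N ≤ P.eval (sec + N) ∧
      a.coinLen sec N ≤ P.eval (sec + N) ∧
      (∀ i v, (a.buyer sec N i v).Bounded (P.eval (sec + N))) ∧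
      (a.seller sec N).Bounded (P.eval (sec + N)))
    (hplat : ∀ sec (B : Finset (a.Id sec)), (a.platform sec B).Bounded (P.eval (sec + B.card)))
    {m : ℕ} (hm : ∀ j, (s.Bs j).card ≤ m) :
    ∃ T : Machine (s.In A) (a.Wires sec H s.announce) (a.Wires sec H s.announce),
      (s.strategy A T).Bounded (m + Fintype.card s.J * ((2 * m + 3) * (P.eval (sec + m) + 1))) ∧
      ∀ x, (T.toProc x).out = (reactive (s.step A) x).out := by
  have hmono : ∀ j, P.eval (sec + (s.Bs j).card) ≤ P.eval (sec + m) := fun j =>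
    eval_le_eval_of_le P (Nat.add_le_add_left (hm j) _)
  have hpeer : ∀ j p, (s.peerMach j p).Bounded (P.eval (sec + (s.Bs j).card)) := by
    rintro j (_ | i)
    · exact (hlen sec _).2.2.2.2
    · exact (hlen sec _).2.2.2.1 _ _
  obtain ⟨T, hb, hT⟩ := s.exists_machine A
    (m + Fintype.card s.J * ((2 * m + 3) * (P.eval (sec + m) + 1)))
    ((s.card_mem_le (P := P.eval (sec + m)) (fun j => (hplat sec _).1.trans (hmono j))
      (fun j p => (hpeer j p).1.trans (hmono j)) (fun j => (hlen sec _).2.1.trans (hmono j))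
      hm).trans (by nlinarith [Nat.zero_le (Fintype.card s.J * (2 * m + 3))]))
    (fun r => (s.sum_size_le (P := P.eval (sec + m)) r
      (fun j => ((hplat sec _).2 r).trans (hmono j))
      (fun j p => ((hpeer j p).2 r).trans (hmono j)) hm).trans
        (by nlinarith [Nat.zero_le (Fintype.card s.J * (m + 1) * P.eval (sec + m)),
          Nat.zero_le (Fintype.card s.J * (2 * m + 3))]))
  refine ⟨T, ⟨?_, ?_, ?_, hb⟩, hT⟩
  · refine (s.card_fakes_le hm).trans ?_
    nlinarith [Nat.zero_le (Fintype.card s.J * (2 * m + 3) * P.eval (sec + m)),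
      Nat.zero_le (Fintype.card s.J * m)]
  · intro i
    exact (hm _).trans (Nat.le_add_right _ _)
  · refine (s.card_coinIndex_le (P := P.eval (sec + m))
      (fun j => (hlen sec _).2.2.1.trans (hmono j)) hm).trans ?_
    nlinarith [Nat.zero_le (Fintype.card s.J * (m + 1) * P.eval (sec + m)),
      Nat.zero_le (Fintype.card s.J * (2 * m + 3))]

end Sessions
end Auction
/-! ### Expectations over coins -/

section Expect

variable {V W : Type} [Fintype V] [Fintype W]

lemma expect_prod_fst {α β : Type} [Fintype α] [Fintype β] [Nonempty β] (f : α → ℝ) :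
    (Finset.univ.expect fun p : α × β => f p.1) = Finset.univ.expect f := by
  rw [← Finset.univ_product_univ, Finset.expect_product]
  simp [Finset.expect_const]

lemma expect_prod {α β : Type} [Fintype α] [Fintype β] (f : α → β → ℝ) :
    (Finset.univ.expect fun x : α => Finset.univ.expect fun y : β => f x y) =
      Finset.univ.expect fun p : α × β => f p.1 p.2 := by
  rw [← Finset.univ_product_univ, Finset.expect_product]

/-- A selection of distinct fair coins is again a family of independent fair coins. -/
lemma expect_comp_injective [DecidableEq V] [DecidableEq W] {φ : V → W}
    (hφ : Function.Injective φ) (f : Bits V → ℝ) :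
    (Finset.univ.expect fun x : Bits W => f fun i => x (φ i)) = Finset.univ.expect f := by
  classical
  let e : V ⊕ ↥(Set.range φ)ᶜ ≃ W :=
    ((Equiv.ofInjective φ hφ).sumCongr (Equiv.refl _)).trans (Equiv.Set.sumCompl (Set.range φ))
  let E : Bits W ≃ Bits V × Bits ↥(Set.range φ)ᶜ :=
    (Equiv.arrowCongr e.symm (Equiv.refl Bool)).trans (Equiv.sumArrowEquivProdArrow _ _ _)
  rw [← expect_prod_fst (β := Bits ↥(Set.range φ)ᶜ) f]
  exact Fintype.expect_equiv E _ _ fun x => rfl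

/-- Coins that are split into families can be tossed all at once. -/
lemma expect_families {ι : Type} [Fintype ι] [DecidableEq ι] {l : ι → ℕ} {c : ℕ}
    (F : (∀ i, Bits (Fin (l i))) → Bits (Fin c) → ℝ) :
    (Finset.univ.expect fun ω => Finset.univ.expect fun τ => F ω τ) =
      Finset.univ.expect fun x : Bits ((Σ i, Fin (l i)) ⊕ Fin c) =>
        F (fun i j => x (Sum.inl ⟨i, j⟩)) fun j => x (Sum.inr j) := by
  rw [expect_prod]
  let E : Bits ((Σ i, Fin (l i)) ⊕ Fin c) ≃ (∀ i, Bits (Fin (l i))) × Bits (Fin c) :=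
    (Equiv.sumArrowEquivProdArrow _ _ _).trans
      ((Equiv.piCurry fun (i : ι) (_ : Fin (l i)) => Bool).prodCongr (Equiv.refl _))
  exact (Fintype.expect_equiv E _ _ fun x => rfl).symm

end Expect

namespace Auction

variable {k : ℕ} {a : Auction k} {sec : ℕ}

namespace Sessions

variable {H : Finset (a.Id sec)} (s : Sessions a sec H)

/-- Where the coins for session `j` come from: the honest players toss their own coins, and the
strategy tosses all others. -/
noncomputable def coinSource (j : s.J) :
    (Σ _ : Option (s.Bs j), Fin (a.coinLen sec (s.Bs j).card)) ⊕ Fin (a.coinLen sec (s.Bs j).card) →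
      (Σ i : Option H, Fin (a.coinLen sec (s.announce i))) ⊕ Fin (Fintype.card s.CoinIndex) :=
  Sum.elim
    (fun w => Function.extend (s.wire (a.coinLen sec)) Sum.inl
      (fun w => Sum.inr (Fintype.equivFin s.CoinIndex ⟨w.1, Sum.inr w.2⟩))
      (⟨j, w⟩ : s.Total (a.coinLen sec)))
    fun c => Sum.inr (Fintype.equivFin s.CoinIndex ⟨j, Sum.inl c⟩)

lemma coinSource_injective (j : s.J) : Function.Injective (s.coinSource j) := by
  have hval : ∀ w : s.Total (a.coinLen sec),
      (∃ w', s.wire (a.coinLen sec) w' = w ∧ Function.extend (s.wire (a.coinLen sec)) Sum.inl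
        (fun w => Sum.inr (Fintype.equivFin s.CoinIndex ⟨w.1, Sum.inr w.2⟩)) w = Sum.inl w') ∨
      Function.extend (s.wire (a.coinLen sec)) Sum.inl
        (fun w => Sum.inr (Fintype.equivFin s.CoinIndex ⟨w.1, Sum.inr w.2⟩)) w =
          Sum.inr (Fintype.equivFin s.CoinIndex ⟨w.1, Sum.inr w.2⟩) := by
    intro w
    by_cases h : ∃ w', s.wire (a.coinLen sec) w' = w
    · obtain ⟨w', rfl⟩ := h
      exact Or.inl ⟨w', rfl, (s.wire_injective _).extend_apply _ _ _⟩
    · exact Or.inr (Function.extend_apply' _ _ _ h)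
  have hsig : ∀ {w w' : Σ _ : Option (s.Bs j), Fin (a.coinLen sec (s.Bs j).card)},
      (⟨j, w⟩ : s.Total (a.coinLen sec)) = ⟨j, w'⟩ → w = w' := fun h =>
    eq_of_heq (Sigma.mk.inj h).2
  rintro (w | c) (w' | c') h
  · simp only [coinSource, Sum.elim_inl] at h
    congr 1
    rcases hval ⟨j, w⟩ with ⟨u, hu, hw⟩ | hw <;> rcases hval ⟨j, w'⟩ with ⟨u', hu', hw'⟩ | hw' <;>
      rw [hw, hw'] at h
    · rw [Sum.inl.inj h] at hu
      exact hsig (hu.symm.trans hu')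
    · cases h
    · cases h
    · have h' := (Fintype.equivFin s.CoinIndex).injective (Sum.inr.inj h)
      exact Sum.inr.inj (eq_of_heq (Sigma.mk.inj h').2)
  · simp only [coinSource, Sum.elim_inl, Sum.elim_inr] at h
    rcases hval ⟨j, w⟩ with ⟨u, hu, hw⟩ | hw <;> rw [hw] at h
    · cases h
    · have h' := (Fintype.equivFin s.CoinIndex).injective (Sum.inr.inj h)
      cases eq_of_heq (Sigma.mk.inj h').2
  · simp only [coinSource, Sum.elim_inl, Sum.elim_inr] at h
    rcases hval ⟨j, w'⟩ with ⟨u, hu, hw⟩ | hw <;> rw [hw] at h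
    · cases h
    · have h' := (Fintype.equivFin s.CoinIndex).injective (Sum.inr.inj h)
      cases eq_of_heq (Sigma.mk.inj h').2
  · have h' := (Fintype.equivFin s.CoinIndex).injective (Sum.inr.inj h)
    congr 1
    exact Sum.inl.inj (eq_of_heq (Sigma.mk.inj h').2)

/-- What happens in one session is distributed as in an honest execution with the participants of
this session. -/
lemma expect_sessionTranscript (v : a.Values sec) (j : s.J)
    (f : a.Transcript sec (s.Bs j) (fun _ => (s.Bs j).card) → ℝ) :
    (Finset.univ.expect fun κ : Bits (Fin (a.setupLen sec)) =>
      Finset.univ.expect fun ω : a.PeerCoins sec H s.announce =>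
      Finset.univ.expect fun τ : Bits (Fin (Fintype.card s.CoinIndex)) =>
        f (s.sessionTranscript v κ ω τ j)) = honestExp (s.Bs j) (s.sessionBids v j) f := by
  unfold honestExp
  refine Finset.expect_congr rfl fun κ _ => ?_
  refine (expect_families fun ω τ => f (s.sessionTranscript v κ ω τ j)).trans ?_
  refine Eq.trans ?_ (expect_families fun (ω : a.PeerCoins sec (s.Bs j) fun _ => (s.Bs j).card) ρ =>
    f (honestTranscript (s.Bs j) (s.sessionBids v j) κ ω ρ)).symm
  refine Eq.trans ?_ (expect_comp_injective (s.coinSource_injective j) _)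
  refine Finset.expect_congr rfl fun x _ => ?_
  unfold sessionTranscript
  congr 2
  funext p c
  exact (Function.apply_extend x (s.wire (a.coinLen sec)) (g := Sum.inl)
    (fun w : s.Total (a.coinLen sec) =>
      Sum.inr (Fintype.equivFin s.CoinIndex ⟨w.1, Sum.inr w.2⟩)) ⟨j, p, c⟩).symm

end Sessions
/-! ### Honest executions -/

section HonestExp

variable {B : Finset (a.Id sec)} {b : a.Values sec}
  {f g : a.Transcript sec B (fun _ => B.card) → ℝ}

lemma honestExp_mono
    (h : ∀ κ ω ρ, f (honestTranscript B b κ ω ρ) ≤ g (honestTranscript B b κ ω ρ)) :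
    honestExp B b f ≤ honestExp B b g :=
  Finset.expect_le_expect fun κ _ => Finset.expect_le_expect fun ω _ =>
    Finset.expect_le_expect fun ρ _ => h κ ω ρ

lemma honestExp_congr
    (h : ∀ κ ω ρ, f (honestTranscript B b κ ω ρ) = g (honestTranscript B b κ ω ρ)) :
    honestExp B b f = honestExp B b g :=
  le_antisymm (honestExp_mono fun κ ω ρ => (h κ ω ρ).le) (honestExp_mono fun κ ω ρ => (h κ ω ρ).ge)

lemma honestExp_add : honestExp B b (fun T => f T + g T) = honestExp B b f + honestExp B b g := by
  simp only [honestExp, Finset.expect_add_distrib]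

lemma honestExp_sub : honestExp B b (fun T => f T - g T) = honestExp B b f - honestExp B b g := by
  simp only [honestExp, Finset.expect_sub_distrib]

lemma honestExp_const_mul (c : ℝ) : honestExp B b (fun T => c * f T) = c * honestExp B b f := by
  simp only [honestExp, Finset.mul_expect]

lemma honestExp_sum {α : Type} (F : Finset α)
    (f : α → a.Transcript sec B (fun _ => B.card) → ℝ) :
    honestExp B b (fun T => ∑ i ∈ F, f i T) = ∑ i ∈ F, honestExp B b (f i) := by
  simp only [honestExp, Finset.expect_sum_comm]

lemma honestExp_const (c : ℝ) : honestExp B b (fun _ => c) = c := by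
  simp [honestExp, Finset.expect_const]

/-- Quantities that depend on the messages of the platform only are not affected by the bids of
identities that do not take part. -/
lemma honestExp_congr_bids {b' : a.Values sec} (hb : ∀ i ∈ B, b i = b' i)
    (hf : ∀ T T' : a.Transcript sec B (fun _ => B.card), T.msgs = T'.msgs → f T = f T') :
    honestExp B b f = honestExp B b' f := by
  have hpeer :
      peerMachine a sec B (fun _ => B.card) b = peerMachine a sec B (fun _ => B.card) b' := by
    funext i
    rcases i with _ | i
    · rfl
    · show a.buyer sec _ i.1 (b i) = a.buyer sec _ i.1 (b' i)
      rw [hb i i.2]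
  unfold honestExp
  refine Finset.expect_congr rfl fun κ _ => Finset.expect_congr rfl fun ω _ =>
    Finset.expect_congr rfl fun ρ _ => hf _ _ ?_
  unfold honestTranscript honestPeers
  rw [hpeer]
  rfl

end HonestExp

namespace Transcript

variable {B : Finset (a.Id sec)} {N : Option B → ℕ} (T : a.Transcript sec B N)

lemma itemsOf_singleton (i : B) : T.itemsOf {i.1} = T.items i := by
  simp [itemsOf]

lemma payOf_singleton (i : B) : T.payOf {i.1} = T.pay i := by
  simp [payOf]

lemma itemsOf_univ : T.itemsOf B = ∑ i, T.items i := by simp [itemsOf]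

lemma payOf_univ : T.payOf B = ∑ i, T.pay i := by simp [payOf]

lemma pay_nonneg (i : B) : 0 ≤ T.pay i := NNReal.coe_nonneg _

lemma payOf_nonneg (C : Finset (a.Id sec)) : 0 ≤ T.payOf C :=
  Finset.sum_nonneg fun i _ => by split_ifs <;> simp [T.pay_nonneg i]

lemma sellerRevenue_nonneg : 0 ≤ T.sellerRevenue := NNReal.coe_nonneg _

lemma itemsOf_eq_sum (C : Finset (a.Id sec)) : T.itemsOf C = ∑ i ∈ C, T.itemsOf {i} := by
  unfold itemsOf
  rw [Finset.sum_comm]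
  refine Finset.sum_congr rfl fun i _ => ?_
  simp [Finset.sum_ite_eq]

lemma payOf_eq_sum (C : Finset (a.Id sec)) : T.payOf C = ∑ i ∈ C, T.payOf {i} := by
  unfold payOf
  rw [Finset.sum_comm]
  refine Finset.sum_congr rfl fun i _ => ?_
  simp [Finset.sum_ite_eq]

lemma itemsOf_union {C C' : Finset (a.Id sec)} (h : Disjoint C C') :
    T.itemsOf (C ∪ C') = T.itemsOf C + T.itemsOf C' := by
  rw [itemsOf_eq_sum, Finset.sum_union h, ← itemsOf_eq_sum, ← itemsOf_eq_sum]

lemma payOf_union {C C' : Finset (a.Id sec)} (h : Disjoint C C') :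
    T.payOf (C ∪ C') = T.payOf C + T.payOf C' := by
  rw [payOf_eq_sum, Finset.sum_union h, ← payOf_eq_sum, ← payOf_eq_sum]

lemma itemsOf_le {C C' : Finset (a.Id sec)} (h : C ⊆ C') : T.itemsOf C ≤ T.itemsOf C' := by
  rw [itemsOf_eq_sum, itemsOf_eq_sum T C']
  exact Finset.sum_le_sum_of_subset h

end Transcript

section Honest

variable (B : Finset (a.Id sec)) (b : a.Values sec)
  (κ : Bits (Fin (a.setupLen sec))) (ω : a.PeerCoins sec B fun _ => B.card)
  (ρ : Bits (Fin (a.coinLen sec B.card)))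

lemma honest_rational (ha : a.IsAuction) (i : B) : (honestTranscript B b κ ω ρ).items i ≤ 1 ∧
    (honestTranscript B b κ ω ρ).pay i ≤ (honestTranscript B b κ ω ρ).items i * (b i : ℝ) := by
  obtain ⟨y, hy, h1, h2⟩ := ha.buyer_rational sec B.card i (b i) _ _
    ((ha.complete sec B b κ ω ρ).2 (some i))
  have hout : (honestTranscript B b κ ω ρ).buyerOut i = some y := hy
  simp only [Transcript.items, Transcript.pay, hout, Option.getD_some]
  exact ⟨h1, h2⟩

lemma honest_consistent (ha : a.IsAuction) :
    (honestTranscript B b κ ω ρ).sold = (honestTranscript B b κ ω ρ).itemsOf B ∧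
    (honestTranscript B b κ ω ρ).sellerRevenue ≤ (honestTranscript B b κ ω ρ).payOf B := by
  have h := ha.consistent sec B b κ ω ρ ∅ fun _ _ => false
  have hT : platformTranscript b (a.setup sec κ) ω ρ
      ((honestPeers _ b (a.setup sec κ) ω).takeOver (Proc.stream fun _ _ => false)
        (fun w => w.1 ∈ (∅ : Finset (Option B)))) = honestTranscript B b κ ω ρ := by
    unfold honestTranscript platformTranscript
    congr 1
    refine centerMessage_congr rfl ?_
    funext s r
    rw [Proc.out_takeOver]
    simp
  rw [hT] at h
  rw [Transcript.itemsOf_univ, Transcript.payOf_univ]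
  exact h (ha.complete sec B b κ ω ρ).1

lemma honest_itemsOf_le (ha : a.IsAuction) : (honestTranscript B b κ ω ρ).itemsOf B ≤ k := by
  rw [← (honest_consistent B b κ ω ρ ha).1]
  exact Nat.lt_succ_iff.1 (Fin.is_lt _)

variable {B}

lemma honest_buyerUtility (ha : a.IsAuction) {u : a.Id sec} (hu : u ∈ B) (w : ℝ) :
    (honestTranscript B b κ ω ρ).buyerUtility {u} w =
      w * (honestTranscript B b κ ω ρ).itemsOf {u} - (honestTranscript B b κ ω ρ).payOf {u} := by
  set T := honestTranscript B b κ ω ρ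
  obtain ⟨h1, h2⟩ := honest_rational B b κ ω ρ ha ⟨u, hu⟩
  have hi : T.itemsOf {u} = T.items ⟨u, hu⟩ := T.itemsOf_singleton ⟨u, hu⟩
  have hp : T.payOf {u} = T.pay ⟨u, hu⟩ := T.payOf_singleton ⟨u, hu⟩
  have hex : (∃ i : B, i.1 ∈ ({u} : Finset (a.Id sec)) ∧ 0 < T.items i) ↔ 0 < T.items ⟨u, hu⟩ := by
    constructor
    · rintro ⟨⟨i, hi⟩, hiu, h⟩
      obtain rfl := Finset.mem_singleton.1 hiu
      exact h
    · exact fun h => ⟨_, Finset.mem_singleton_self _, h⟩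
  have hsum : (∑ i : B, if i.1 ∈ ({u} : Finset (a.Id sec)) ∧ 0 < T.items i then T.pay i else 0) =
      if 0 < T.items ⟨u, hu⟩ then T.pay ⟨u, hu⟩ else 0 := by
    rw [Finset.sum_eq_single_of_mem (⟨u, hu⟩ : B) (Finset.mem_univ _)]
    · simp
    · intro i _ hne
      have : i.1 ≠ u := fun h => hne (Subtype.ext h)
      simp [this]
  unfold Transcript.buyerUtility
  rw [if_pos (ha.complete sec B b κ ω ρ).1, hsum, hi, hp, if_congr hex rfl rfl]
  rcases Nat.le_one_iff_eq_zero_or_eq_one.1 h1 with h | h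
  · change T.items ⟨u, hu⟩ = 0 at h
    have h0 : T.pay ⟨u, hu⟩ = 0 := by
      change T.pay ⟨u, hu⟩ ≤ _ at h2
      refine le_antisymm (h2.trans ?_) (T.pay_nonneg _)
      rw [show (honestTranscript B b κ ω ρ).items ⟨u, hu⟩ = 0 from h]
      simp
    simp [h, h0]
  · change T.items ⟨u, hu⟩ = 1 at h
    simp [h]

lemma honest_coalitionUtility (ha : a.IsAuction) {H : Finset (a.Id sec)} (hH : H ⊆ B)
    (vals : Multiset ℝ) :
    (honestTranscript B b κ ω ρ).coalitionUtility H vals =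
      (honestTranscript B b κ ω ρ).payOf H - (honestTranscript B b κ ω ρ).sellerRevenue +
        ((vals.sort (· ≥ ·)).take ((honestTranscript B b κ ω ρ).itemsOf B -
          (honestTranscript B b κ ω ρ).itemsOf H)).sum := by
  unfold Transcript.coalitionUtility
  rw [if_pos, (honest_consistent B b κ ω ρ ha).1]
  refine ⟨(ha.complete sec B b κ ω ρ).2 none, fun i _ => (ha.complete sec B b κ ω ρ).2 (some i), ?_⟩
  rw [(honest_consistent B b κ ω ρ ha).1]
  exact Transcript.itemsOf_le _ hH

end Honest

/-! ### Interim quantities -/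

/-- Expected number of items that identity `u` obtains if everybody in `B` is honest and bids
`b`. -/
noncomputable def alloc (B : Finset (a.Id sec)) (b : a.Values sec) (u : a.Id sec) : ℝ :=
  honestExp B b fun T => (T.itemsOf {u} : ℝ)

/-- Expected payment of identity `u` if everybody in `B` is honest and bids `b`. -/
noncomputable def price (B : Finset (a.Id sec)) (b : a.Values sec) (u : a.Id sec) : ℝ :=
  honestExp B b fun T => T.payOf {u}

/-- Expected revenue of the platform if everybody in `B` is honest and bids `b`. -/
noncomputable def surplus (B : Finset (a.Id sec)) (b : a.Values sec) : ℝ :=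
  honestExp B b fun T => T.payOf B - T.sellerRevenue

section Interim

variable {B : Finset (a.Id sec)} {b b' : a.Values sec} {u : a.Id sec}

lemma alloc_congr (hb : ∀ i ∈ B, b i = b' i) : alloc B b u = alloc B b' u :=
  honestExp_congr_bids hb fun ⟨_, _, _, _⟩ ⟨_, _, _, _⟩ h => by cases h; rfl

lemma price_congr (hb : ∀ i ∈ B, b i = b' i) : price B b u = price B b' u :=
  honestExp_congr_bids hb fun ⟨_, _, _, _⟩ ⟨_, _, _, _⟩ h => by cases h; rfl

lemma honestExp_nonneg {f : a.Transcript sec B (fun _ => B.card) → ℝ} (hf : ∀ T, 0 ≤ f T) :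
    0 ≤ honestExp B b f :=
  (honestExp_const (B := B) (b := b) 0).symm.le.trans (honestExp_mono fun _ _ _ => hf _)

lemma alloc_nonneg : 0 ≤ alloc B b u := honestExp_nonneg fun _ => Nat.cast_nonneg _

lemma price_nonneg : 0 ≤ price B b u := honestExp_nonneg fun T => T.payOf_nonneg _

lemma alloc_le_one (ha : a.IsAuction) (hu : u ∈ B) : alloc B b u ≤ 1 := by
  refine (honestExp_mono (g := fun _ => 1) fun κ ω ρ => ?_).trans (honestExp_const 1).le
  rw [Transcript.itemsOf_singleton _ ⟨u, hu⟩]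
  exact_mod_cast (honest_rational B b κ ω ρ ha ⟨u, hu⟩).1

lemma price_le (ha : a.IsAuction) (hu : u ∈ B) : price B b u ≤ b u * alloc B b u := by
  unfold alloc
  rw [← honestExp_const_mul]
  refine honestExp_mono fun κ ω ρ => ?_
  rw [Transcript.itemsOf_singleton _ ⟨u, hu⟩, Transcript.payOf_singleton _ ⟨u, hu⟩, mul_comm]
  exact (honest_rational B b κ ω ρ ha ⟨u, hu⟩).2

lemma sum_alloc_le (ha : a.IsAuction) {C : Finset (a.Id sec)} (hC : C ⊆ B) :
    ∑ i ∈ C, alloc B b i ≤ k := by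
  unfold alloc
  rw [← honestExp_sum]
  refine (honestExp_mono (g := fun _ => (k : ℝ)) fun κ ω ρ => ?_).trans (honestExp_const _).le
  rw [← Nat.cast_sum, ← Transcript.itemsOf_eq_sum]
  exact_mod_cast (Transcript.itemsOf_le _ hC).trans (honest_itemsOf_le B b κ ω ρ ha)

lemma surplus_nonneg (ha : a.IsAuction) : 0 ≤ surplus B b :=
  (honestExp_const (B := B) (b := b) 0).symm.le.trans
    (honestExp_mono fun κ ω ρ => sub_nonneg.2 (honest_consistent B b κ ω ρ ha).2)

lemma honestExp_buyerUtility (ha : a.IsAuction) (hu : u ∈ B) (w : ℝ) :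
    honestExp B b (fun T => T.buyerUtility {u} w) = w * alloc B b u - price B b u := by
  unfold alloc price
  rw [← honestExp_const_mul, ← honestExp_sub]
  exact honestExp_congr fun κ ω ρ => honest_buyerUtility b κ ω ρ ha hu w

lemma honestExp_coalitionUtility_singleton (ha : a.IsAuction) {H : Finset (a.Id sec)} (hu : u ∉ H)
    (w : ℝ) :
    honestExp (H ∪ {u}) b (fun T => T.coalitionUtility H {w}) =
      surplus (H ∪ {u}) b + (w * alloc (H ∪ {u}) b u - price (H ∪ {u}) b u) := by
  unfold alloc price surplus
  rw [← honestExp_const_mul, ← honestExp_sub, ← honestExp_add]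
  refine honestExp_congr fun κ ω ρ => ?_
  have hd : Disjoint H {u} := Finset.disjoint_singleton_right.2 hu
  have hmem : u ∈ H ∪ {u} := Finset.mem_union_right _ (Finset.mem_singleton_self _)
  rw [honest_coalitionUtility b κ ω ρ ha Finset.subset_union_left, Transcript.itemsOf_union _ hd,
    Transcript.payOf_union _ hd, Nat.add_sub_cancel_left, Multiset.sort_singleton]
  have h1 := (honest_rational (H ∪ {u}) b κ ω ρ ha ⟨u, hmem⟩).1
  rw [← Transcript.itemsOf_singleton] at h1
  rcases Nat.le_one_iff_eq_zero_or_eq_one.1 h1 with h | h <;> rw [h] <;> simp <;> ring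

lemma honestExp_coalitionUtility_empty (ha : a.IsAuction) {H C : Finset (a.Id sec)}
    (hC : Disjoint H C) :
    honestExp (H ∪ C) b (fun T => T.coalitionUtility H 0) =
      surplus (H ∪ C) b - ∑ i ∈ C, price (H ∪ C) b i := by
  unfold price surplus
  rw [← honestExp_sum, ← honestExp_sub]
  refine honestExp_congr fun κ ω ρ => ?_
  rw [honest_coalitionUtility b κ ω ρ ha Finset.subset_union_left, ← Transcript.payOf_eq_sum,
    Transcript.payOf_union _ hC]
  simp
  ring

lemma surplus_empty (ha : a.IsAuction) : surplus (∅ : Finset (a.Id sec)) b = 0 := by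
  refine le_antisymm ?_ (surplus_nonneg ha)
  refine (honestExp_mono (g := fun _ => 0) fun κ ω ρ => ?_).trans (honestExp_const _).le
  have := (honestTranscript (∅ : Finset (a.Id sec)) b κ ω ρ).sellerRevenue_nonneg
  rw [Transcript.payOf_eq_sum]
  simpa using this

end Interim

/-! ### Independent values -/

/-- The expectation of `f` if the value of every identity `i` is drawn independently from `D i`.
This covers both fixed values (point masses) and values with a common distribution. -/
noncomputable def priorExp (D : a.Id sec → PMF (a.domain sec)) (f : a.Values sec → ℝ) : ℝ :=
  ∑ v : a.Values sec, (∏ i, (D i (v i)).toReal) * f v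

section Prior

variable {D : a.Id sec → PMF (a.domain sec)} {f g : a.Values sec → ℝ}

lemma sum_pmf (p : PMF (a.domain sec)) : ∑ c, (p c).toReal = 1 := by
  rw [← ENNReal.toReal_sum fun c _ => p.apply_ne_top c, ← tsum_fintype (L := .unconditional _),
    p.tsum_coe, ENNReal.toReal_one]

lemma weight_nonneg (v : a.Values sec) : 0 ≤ ∏ i, (D i (v i)).toReal :=
  Finset.prod_nonneg fun _ _ => ENNReal.toReal_nonneg

/-- The expectation of a function of a single value. -/
lemma priorExp_apply (u : a.Id sec) (g : a.domain sec → ℝ) :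
    priorExp D (fun v => g (v u)) = ∑ c, (D u c).toReal * g c := by
  have h : ∀ v : a.Values sec, (∏ i, (D i (v i)).toReal) * g (v u) =
      ∏ i, ((D i (v i)).toReal * if i = u then g (v i) else 1) := by
    intro v
    rw [Finset.prod_mul_distrib, Finset.prod_ite_eq' Finset.univ u fun i => g (v i)]
    simp
  unfold priorExp
  simp only [h]
  rw [← Fintype.prod_sum (fun i c => (D i c).toReal * if i = u then g c else 1),
    Finset.prod_eq_single u]
  · simp
  · intro i _ hi
    simpa [hi] using sum_pmf (D i)
  · simp

lemma priorExp_const [Nonempty (a.Id sec)] (c : ℝ) : priorExp D (fun _ => c) = c := by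
  obtain ⟨u⟩ := ‹Nonempty (a.Id sec)›
  rw [priorExp_apply u fun _ => c, ← Finset.sum_mul, sum_pmf, one_mul]

lemma priorExp_mono (h : ∀ v, f v ≤ g v) : priorExp D f ≤ priorExp D g :=
  Finset.sum_le_sum fun v _ => mul_le_mul_of_nonneg_left (h v) (weight_nonneg v)

lemma priorExp_add : priorExp D (fun v => f v + g v) = priorExp D f + priorExp D g := by
  simp only [priorExp, mul_add, Finset.sum_add_distrib]

lemma priorExp_sub : priorExp D (fun v => f v - g v) = priorExp D f - priorExp D g := by
  simp only [priorExp, mul_sub, Finset.sum_sub_distrib]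

lemma priorExp_const_mul (c : ℝ) : priorExp D (fun v => c * f v) = c * priorExp D f := by
  simp only [priorExp, Finset.mul_sum]
  exact Finset.sum_congr rfl fun v _ => by ring

lemma priorExp_sum {α : Type} (F : Finset α) (f : α → a.Values sec → ℝ) :
    priorExp D (fun v => ∑ i ∈ F, f i v) = ∑ i ∈ F, priorExp D (f i) := by
  simp only [priorExp, Finset.mul_sum]
  exact Finset.sum_comm

lemma priorExp_pure (v : a.Values sec) (f : a.Values sec → ℝ) :
    priorExp (fun i => PMF.pure (v i)) f = f v := by
  unfold priorExp
  rw [Finset.sum_eq_single v]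
  · simp
  · intro w _ hw
    obtain ⟨i, hi⟩ := Function.ne_iff.1 hw
    rw [Finset.prod_eq_zero (Finset.mem_univ i), zero_mul]
    simp [PMF.pure_apply, hi]
  · simp

/-- Exchanging the values in `C` by an independent copy does not change the expectation. -/
lemma priorExp_resample (C : Finset (a.Id sec)) (f : a.Values sec → ℝ) :
    priorExp D (fun v' => priorExp D fun v => f (C.piecewise v' v)) = priorExp D f := by
  have hsum : priorExp D (fun v' => priorExp D fun v => f (C.piecewise v' v)) =
      ∑ p : a.Values sec × a.Values sec,
        (∏ i, (D i (p.1 i)).toReal) * (∏ i, (D i (p.2 i)).toReal) * f (C.piecewise p.1 p.2) := by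
    simp only [priorExp, Finset.mul_sum]
    rw [← Finset.univ_product_univ, Finset.sum_product]
    simp only [mul_assoc]
  have hsum' : priorExp D f = ∑ p : a.Values sec × a.Values sec,
      (∏ i, (D i (p.1 i)).toReal) * (∏ i, (D i (p.2 i)).toReal) * f p.1 := by
    rw [← Finset.univ_product_univ, Finset.sum_product]
    have h1 : ∑ v : a.Values sec, ∏ i, (D i (v i)).toReal = 1 := by
      rw [← Fintype.prod_sum fun i c => (D i c).toReal]
      exact Finset.prod_eq_one fun i _ => sum_pmf (D i)
    refine Finset.sum_congr rfl fun v _ => ?_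
    show _ = ∑ w : a.Values sec, (∏ i, (D i (v i)).toReal) * (∏ i, (D i (w i)).toReal) * f v
    rw [← Finset.sum_mul, ← Finset.mul_sum, h1, mul_one]
  rw [hsum, hsum']
  have hinv : Function.Involutive fun p : a.Values sec × a.Values sec =>
      (C.piecewise p.1 p.2, C.piecewise p.2 p.1) := by
    rintro ⟨v, w⟩
    ext i <;> by_cases hi : i ∈ C <;> simp [hi]
  refine Fintype.sum_equiv hinv.toPerm _ _ ?_
  rintro ⟨v, w⟩
  show _ = (∏ i, (D i (C.piecewise v w i)).toReal) * (∏ i, (D i (C.piecewise w v i)).toReal) * _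
  rw [← Finset.prod_mul_distrib, ← Finset.prod_mul_distrib]
  congr 1
  refine Finset.prod_congr rfl fun i _ => ?_
  by_cases hi : i ∈ C <;> simp [hi, mul_comm]

lemma priorExp_resample_singleton (u : a.Id sec) (f : a.Values sec → ℝ) :
    ∑ c, (D u c).toReal * priorExp D (fun v => f (Function.update v u c)) = priorExp D f := by
  rw [← priorExp_apply u fun c => priorExp D fun v => f (Function.update v u c),
    ← priorExp_resample {u} f]
  unfold priorExp
  refine Finset.sum_congr rfl fun v' _ => ?_
  congr 1
  refine Finset.sum_congr rfl fun v _ => ?_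
  show _ * f (Function.update v u (v' u)) = _ * f (({u} : Finset (a.Id sec)).piecewise v' v)
  rw [Finset.piecewise_singleton]

lemma exists_le_of_priorExp_le [Nonempty (a.Id sec)] {c : ℝ} (h : priorExp D f ≤ c) :
    ∃ v, f v ≤ c := by
  by_contra! hlt
  have hc : priorExp D f = c := by
    refine le_antisymm h ?_
    rw [← priorExp_const (D := D) c]
    exact priorExp_mono fun v => (hlt v).le
  have hz : ∀ v ∈ (Finset.univ : Finset (a.Values sec)),
      (∏ i, (D i (v i)).toReal) * (f v - c) = 0 := by
    refine (Finset.sum_eq_zero_iff_of_nonneg fun v _ =>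
      mul_nonneg (weight_nonneg v) (sub_nonneg.2 (hlt v).le)).1 ?_
    have : priorExp D (fun v => f v - c) = 0 := by
      rw [priorExp_sub, priorExp_const, hc, sub_self]
    exact this
  have hw : ∀ v : a.Values sec, ∏ i, (D i (v i)).toReal = 0 := fun v =>
    (mul_eq_zero.1 (hz v (Finset.mem_univ v))).resolve_right (sub_pos.2 (hlt v)).ne'
  have h1 := priorExp_const (D := D) 1
  simp [priorExp, hw] at h1

end Prior

end Auction
/-! ### The payoff of truthful bidders and the revenue of the platform -/

lemma abs_sub_le_tick {U : Finset ℝ} {x y : ℝ} (hx : x ∈ U) (hy : y ∈ U) (hxy : x ≤ y)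
    (hadj : ∀ c ∈ U, ¬ (x < c ∧ c < y)) : |x - y| ≤ tick U := by
  refine le_csSup ?_ ⟨x, hx, y, hy, hxy, hadj, rfl⟩
  refine (((U ×ˢ U).image fun p => |p.1 - p.2|).finite_toSet.subset ?_).bddAbove
  rintro d ⟨x, hx, y, hy, -, -, rfl⟩
  exact Finset.mem_coe.2 (Finset.mem_image.2 ⟨(x, y), Finset.mem_product.2 ⟨hx, hy⟩, rfl⟩)

lemma tick_nonneg (U : Finset ℝ) : 0 ≤ tick U := by
  refine Real.sSup_nonneg ?_
  rintro d ⟨x, -, y, -, -, -, rfl⟩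
  exact abs_nonneg _

/-- If the increments of `R` are bounded by products of increments of the argument and of `X`, then
`R` changes by at most the tick size times the increment of `X`: the products are summed over
adjacent points. -/
lemma sub_le_tick_mul {U : Finset ℝ} {z₀ : U} (hz₀ : ∀ w : U, z₀ ≤ w) {R X : U → ℝ}
    (h : ∀ z w : U, R w - R z ≤ ((z : ℝ) - w) * (X z - X w)) (w : U) :
    R w - R z₀ ≤ tick U * (X w - X z₀) := by
  induction w using WellFoundedLT.induction with
  | ind w ih =>
    rcases (hz₀ w).eq_or_lt with rfl | hlt
    · simp
    · obtain ⟨z, hz, hmax⟩ := (Finset.univ.filter (· < w)).exists_max_image id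
        ⟨z₀, by simpa using hlt⟩
      have hzw : z < w := by simpa using hz
      have hzw' : (z : ℝ) < w := hzw
      have htick : (w : ℝ) - z ≤ tick U := by
        have := abs_sub_le_tick z.2 w.2 hzw'.le fun c hc ⟨h1, h2⟩ =>
          absurd (hmax ⟨c, hc⟩ (by simpa using (show (⟨c, hc⟩ : U) < w from h2))) (not_le.2 h1)
        rwa [abs_sub_comm, abs_of_pos (sub_pos.2 hzw')] at this
      have hX : 0 ≤ X w - X z := by
        by_contra! hneg
        have h1 := h z w
        have h2 := h w z
        nlinarith [mul_pos (sub_pos.2 hzw') (neg_pos.2 hneg)]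
      have h1 := h z w
      have h2 := ih z hzw
      nlinarith [mul_le_mul_of_nonneg_right htick hX]

namespace Auction

variable {k : ℕ} {a : Auction k} {sec : ℕ}

/-- The part of buyer incentive compatibility that concerns extended input replacement, if the
values of the honest buyers are drawn from the product distribution `D`. -/
def ExactBIC (D : a.Id sec → PMF (a.domain sec)) : Prop :=
  ∀ (H : Finset (a.Id sec)) (u : a.Id sec) (C : Finset (a.Id sec)) (b : a.Values sec)
    (w : a.domain sec), u ∉ H → Disjoint H C →
    priorExp D (fun v => buyerReplacement H u C b (Function.update v u w)) ≤
      priorExp D (fun v => buyerHonest H u (Function.update v u w))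

/-- The part of incentive compatibility for the platform and one buyer that concerns extended input
replacement, if the values of the honest buyers are drawn from the product distribution `D`. -/
def ExactPBIC (D : a.Id sec → PMF (a.domain sec)) : Prop :=
  ∀ (H : Finset (a.Id sec)) (u : a.Id sec) (C : Finset (a.Id sec)) (b : a.Values sec)
    (w : a.domain sec), u ∉ H → Disjoint H C →
    priorExp D (fun v => coalitionReplacement H {u} C b (Function.update v u w)) ≤
      priorExp D (fun v => coalitionHonest H {u} (Function.update v u w))

section InterimAnalysis

variable (D : a.Id sec → PMF (a.domain sec)) (H : Finset (a.Id sec)) (u : a.Id sec)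
  (z : a.domain sec)

/-- Expected number of items of `u` against the honest buyers `H` if `u` bids `z`. -/
noncomputable def interimAlloc : ℝ :=
  priorExp D fun v => alloc (H ∪ {u}) (Function.update v u z) u

/-- Expected payment of `u` against the honest buyers `H` if `u` bids `z`. -/
noncomputable def interimPrice : ℝ :=
  priorExp D fun v => price (H ∪ {u}) (Function.update v u z) u

/-- Expected revenue of the platform from `H` and `u` if `u` bids `z`. -/
noncomputable def interimSurplus : ℝ :=
  priorExp D fun v => surplus (H ∪ {u}) (Function.update v u z)

/-- Expected utility of `u` against the honest buyers `H` if its value is `z` and it is honest. -/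
noncomputable def interimUtility : ℝ := z * interimAlloc D H u z - interimPrice D H u z

variable {D H u z}

lemma buyerReplacement_singleton (ha : a.IsAuction) (i : a.Id sec) (b v : a.Values sec) :
    buyerReplacement H u {i} b v =
      v u * alloc (H ∪ {i}) (Function.update v i (b i)) i -
        price (H ∪ {i}) (Function.update v i (b i)) i := by
  unfold buyerReplacement
  rw [Finset.piecewise_singleton]
  exact honestExp_buyerUtility ha (Finset.mem_union_right _ (Finset.mem_singleton_self _)) _

lemma buyerHonest_eq (ha : a.IsAuction) (v : a.Values sec) :
    buyerHonest H u v = v u * alloc (H ∪ {u}) v u - price (H ∪ {u}) v u := by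
  unfold buyerHonest
  rw [buyerReplacement_singleton ha, Function.update_eq_self]

lemma coalitionReplacement_singleton (ha : a.IsAuction) (hu : u ∉ H) (b v : a.Values sec) :
    coalitionReplacement H {u} {u} b v = surplus (H ∪ {u}) (Function.update v u (b u)) +
      (v u * alloc (H ∪ {u}) (Function.update v u (b u)) u -
        price (H ∪ {u}) (Function.update v u (b u)) u) := by
  unfold coalitionReplacement
  rw [Finset.piecewise_singleton]
  exact honestExp_coalitionUtility_singleton ha hu _

lemma coalitionHonest_singleton (ha : a.IsAuction) (hu : u ∉ H) (v : a.Values sec) :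
    coalitionHonest H {u} v = surplus (H ∪ {u}) v +
      (v u * alloc (H ∪ {u}) v u - price (H ∪ {u}) v u) := by
  unfold coalitionHonest
  rw [coalitionReplacement_singleton ha hu, Function.update_eq_self]

lemma priorExp_buyerHonest (ha : a.IsAuction) :
    priorExp D (fun v => buyerHonest H u (Function.update v u z)) = interimUtility D H u z := by
  simp only [buyerHonest_eq ha, Function.update_self]
  rw [priorExp_sub, priorExp_const_mul]
  rfl

lemma priorExp_coalitionHonest (ha : a.IsAuction) (hu : u ∉ H) :
    priorExp D (fun v => coalitionHonest H {u} (Function.update v u z)) =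
      interimSurplus D H u z + interimUtility D H u z := by
  simp only [coalitionHonest_singleton ha hu, Function.update_self]
  rw [priorExp_add, priorExp_sub, priorExp_const_mul]
  rfl

/-- Truthful bidding is optimal for a single buyer. -/
lemma ExactBIC.truthful (hD : ExactBIC D) (ha : a.IsAuction) (hu : u ∉ H) (z w : a.domain sec) :
    w * interimAlloc D H u z - interimPrice D H u z ≤ interimUtility D H u w := by
  have h := hD H u {u} (fun _ => z) w hu (Finset.disjoint_singleton_right.2 hu)
  rw [priorExp_buyerHonest ha] at h
  simp only [buyerReplacement_singleton ha, Function.update_self, Function.update_idem] at h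
  rwa [priorExp_sub, priorExp_const_mul] at h

/-- A buyer cannot gain by taking part under another identity. -/
lemma ExactBIC.interimUtility_le (hD : ExactBIC D) (ha : a.IsAuction) {i : a.Id sec} (hu : u ∉ H)
    (hi : i ∉ H) (w : a.domain sec) : interimUtility D H i w ≤ interimUtility D H u w := by
  rcases eq_or_ne i u with rfl | hne
  · exact le_rfl
  have h := hD H u {i} (fun _ => w) w hu (Finset.disjoint_singleton_right.2 hi)
  rw [priorExp_buyerHonest ha] at h
  refine le_trans (le_of_eq ?_) h
  simp only [buyerReplacement_singleton ha, Function.update_self]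
  rw [priorExp_sub, priorExp_const_mul]
  have hb : ∀ v : a.Values sec, ∀ l ∈ H ∪ {i},
      Function.update v i w l = Function.update (Function.update v u w) i w l := by
    intro v l hl
    rcases eq_or_ne l i with rfl | hli
    · simp
    · have hlu : l ≠ u := by
        rintro rfl
        rcases Finset.mem_union.1 hl with h | h
        · exact hu h
        · exact hli (Finset.mem_singleton.1 h)
      simp [hli, hlu]
  have hx : interimAlloc D H i w = priorExp D fun v =>
      alloc (H ∪ {i}) (Function.update (Function.update v u w) i w) i :=
    congrArg (priorExp D) (funext fun v => alloc_congr (hb v))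
  have hp : interimPrice D H i w = priorExp D fun v =>
      price (H ∪ {i}) (Function.update (Function.update v u w) i w) i :=
    congrArg (priorExp D) (funext fun v => price_congr (hb v))
  rw [interimUtility, hx, hp]

lemma interimAlloc_nonneg : 0 ≤ interimAlloc D H u z :=
  Finset.sum_nonneg fun v _ => mul_nonneg (weight_nonneg v) alloc_nonneg

lemma interimAlloc_le_one (ha : a.IsAuction) : interimAlloc D H u z ≤ 1 := by
  have : Nonempty (a.Id sec) := ⟨u⟩
  rw [← priorExp_const (D := D) 1]
  exact priorExp_mono fun v => alloc_le_one ha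
    (Finset.mem_union_right _ (Finset.mem_singleton_self _))

lemma interimUtility_nonneg (ha : a.IsAuction) : 0 ≤ interimUtility D H u z := by
  unfold interimUtility interimAlloc interimPrice
  rw [← priorExp_const_mul, ← priorExp_sub]
  refine Finset.sum_nonneg fun v _ => mul_nonneg (weight_nonneg v) (sub_nonneg.2 ?_)
  have := price_le (b := Function.update v u z) ha
    (Finset.mem_union_right H (Finset.mem_singleton_self u))
  simpa using this

lemma ExactBIC.interimUtility_mono (hD : ExactBIC D) (ha : a.IsAuction) (hu : u ∉ H)
    {z w : a.domain sec} (hzw : z ≤ w) : interimUtility D H u z ≤ interimUtility D H u w := by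
  refine le_trans ?_ (hD.truthful ha hu z w)
  unfold interimUtility
  have : (z : ℝ) ≤ w := hzw
  have := mul_le_mul_of_nonneg_right this (interimAlloc_nonneg (D := D) (H := H) (u := u) (z := z))
  linarith

/-- The value `0`. -/
def zeroValue (ha : a.IsAuction) (sec : ℕ) : a.domain sec := ⟨0, ha.zero_mem sec⟩

/-- The revenue of the platform hardly depends on the bid of a single buyer: the allocation alone
determines, up to the tick size, both the payment of the buyer and the joint payoff of the
platform and the buyer. -/
lemma interimSurplus_le (hD : ExactBIC D) (hD' : ExactPBIC D) (ha : a.IsAuction) (hu : u ∉ H)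
    (w : a.domain sec) :
    interimSurplus D H u w ≤ interimSurplus D H u (zeroValue ha sec) + tick (a.domain sec) := by
  have key : ∀ z w : a.domain sec, interimSurplus D H u w - interimSurplus D H u z ≤
      ((z : ℝ) - w) * (interimAlloc D H u z - interimAlloc D H u w) := by
    intro z w
    have h1 := hD' H u {u} (fun _ => w) z hu (Finset.disjoint_singleton_right.2 hu)
    rw [priorExp_coalitionHonest ha hu] at h1
    simp only [coalitionReplacement_singleton ha hu, Function.update_self,
      Function.update_idem] at h1
    rw [priorExp_add, priorExp_sub, priorExp_const_mul] at h1
    have h2 := hD.truthful ha hu z w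
    unfold interimUtility at h1 h2
    change interimSurplus D H u w + (z * interimAlloc D H u w - interimPrice D H u w) ≤ _ at h1
    linarith
  have h := sub_le_tick_mul (z₀ := zeroValue ha sec)
    (fun w => (ha.mem_unit sec w w.2).1) key w
  have h1 : interimAlloc D H u w - interimAlloc D H u (zeroValue ha sec) ≤ 1 := by
    linarith [interimAlloc_le_one (D := D) (H := H) (u := u) (z := w) ha,
      interimAlloc_nonneg (D := D) (H := H) (u := u) (z := zeroValue ha sec)]
  have h2 := mul_le_mul_of_nonneg_left h1 (tick_nonneg (a.domain sec))
  linarith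

/-- If all incentives hold for arbitrary fixed values, the revenue of the platform is negligible: it
vanishes if all bids are `0`. -/
lemma surplus_le_of_exPost (ha : a.IsAuction)
    (hD : ∀ v : a.Values sec, ExactBIC fun i => PMF.pure (v i))
    (hD' : ∀ v : a.Values sec, ExactPBIC fun i => PMF.pure (v i)) (B : Finset (a.Id sec))
    (v : a.Values sec) : surplus B v ≤ B.card * tick (a.domain sec) := by
  have hstep : ∀ (v : a.Values sec), ∀ u ∈ B, surplus B v ≤
      surplus B (Function.update v u (zeroValue ha sec)) + tick (a.domain sec) := by
    intro v u hu
    have h := interimSurplus_le (hD v) (hD' v) ha (Finset.notMem_erase u B) (v u)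
    unfold interimSurplus at h
    rwa [priorExp_pure, priorExp_pure, Function.update_eq_self,
      show B.erase u ∪ {u} = B by
        rw [Finset.union_comm, ← Finset.insert_eq, Finset.insert_erase hu]] at h
  have hind : ∀ C ⊆ B, surplus B v ≤
      surplus B (C.piecewise (fun _ => zeroValue ha sec) v) + C.card * tick (a.domain sec) := by
    intro C
    induction C using Finset.induction_on with
    | empty => intro _; simp
    | insert u C hu ih =>
      intro hC
      have h1 := ih ((Finset.subset_insert _ _).trans hC)
      have h2 := hstep (C.piecewise (fun _ => zeroValue ha sec) v) u
        (hC (Finset.mem_insert_self _ _))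
      rw [Finset.piecewise_insert, Finset.card_insert_of_notMem hu]
      push_cast
      linarith
  refine (hind B subset_rfl).trans ?_
  have h0 : surplus B (B.piecewise (fun _ => zeroValue ha sec) v) ≤ 0 := by
    have hz := honestExp_mono (B := B) (b := B.piecewise (fun _ => zeroValue ha sec) v)
      (f := fun T => T.payOf B - T.sellerRevenue) (g := fun _ => 0) (fun κ ω ρ => by
        have hr := (honestTranscript B (B.piecewise (fun _ => zeroValue ha sec) v)
          κ ω ρ).sellerRevenue_nonneg
        have hp : (honestTranscript B (B.piecewise (fun _ => zeroValue ha sec) v) κ ω ρ).payOf B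
            ≤ 0 := by
          rw [Transcript.payOf_univ]
          refine Finset.sum_nonpos fun i _ => ?_
          have := (honest_rational B (B.piecewise (fun _ => zeroValue ha sec) v) κ ω ρ ha i).2
          rw [Finset.piecewise_eq_of_mem _ _ _ i.2] at this
          simpa [zeroValue] using this
        linarith)
    rwa [honestExp_const] at hz
  linarith

/-- With a common distribution of values, the revenue of the platform is negligible: a platform
without colluding buyers cannot gain by adding bids of `0`, so that removing a buyer costs at most
the tick size. -/
lemma interimSurplus_le_of_bayes (ha : a.IsAuction) (hD : ExactBIC D) (hD' : ExactPBIC D)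
    (hP : ∀ (H C : Finset (a.Id sec)) (b : a.Values sec), Disjoint H C →
      priorExp D (fun v => coalitionReplacement H ∅ C b v) ≤
        priorExp D (fun v => coalitionHonest H ∅ v)) (hu : u ∉ H) (w : a.domain sec) :
    interimSurplus D H u w ≤ (H.card + 1) * tick (a.domain sec) := by
  have hstep : ∀ (H : Finset (a.Id sec)) (u : a.Id sec) (w : a.domain sec), u ∉ H →
      interimSurplus D H u w ≤ priorExp D (surplus H) + tick (a.domain sec) := by
    intro H u w hu
    refine (interimSurplus_le hD hD' ha hu w).trans (add_le_add_left ?_ _)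
    have h := hP H {u} (fun _ => zeroValue ha sec) (Finset.disjoint_singleton_right.2 hu)
    refine le_trans (priorExp_mono fun v => ?_) (h.trans (priorExp_mono fun v => ?_))
    · unfold coalitionReplacement
      rw [Finset.piecewise_singleton]
      refine le_of_eq (Eq.trans ?_ (honestExp_coalitionUtility_empty ha
        (Finset.disjoint_singleton_right.2 hu)).symm)
      have h1 := price_le (b := Function.update v u (zeroValue ha sec)) ha
        (Finset.mem_union_right H (Finset.mem_singleton_self u))
      have h2 := price_nonneg (B := H ∪ {u}) (b := Function.update v u (zeroValue ha sec)) (u := u)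
      have h3 : price (H ∪ {u}) (Function.update v u (zeroValue ha sec)) u = 0 := by
        refine le_antisymm ?_ h2
        simpa [zeroValue] using h1
      rw [Finset.sum_singleton, h3, sub_zero]
    · unfold coalitionHonest coalitionReplacement
      rw [Finset.piecewise_same]
      refine (honestExp_coalitionUtility_empty ha (Finset.disjoint_empty_right H)).le.trans ?_
      simp
  have hind : ∀ H : Finset (a.Id sec), priorExp D (surplus H) ≤ H.card * tick (a.domain sec) := by
    intro H
    induction H using Finset.induction_on with
    | empty =>
      refine le_of_eq ?_
      simp [priorExp, surplus_empty ha]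
    | insert i H hi ih =>
      rw [← priorExp_resample_singleton i]
      have : ∀ c, priorExp D (fun v => surplus (insert i H) (Function.update v i c)) ≤
          (H.card + 1) * tick (a.domain sec) := by
        intro c
        rw [Finset.insert_eq, Finset.union_comm]
        have := hstep H i c hi
        unfold interimSurplus at this
        linarith
      refine (Finset.sum_le_sum fun c _ =>
        mul_le_mul_of_nonneg_left (this c) ENNReal.toReal_nonneg).trans ?_
      rw [← Finset.sum_mul, sum_pmf, one_mul, Finset.card_insert_of_notMem hi]
      push_cast
      exact le_rfl
  have h1 := hstep H u w hu
  have h2 := hind H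
  linarith

end InterimAnalysis

/-! ### The attack -/

/-- The sessions of the attack. In the session `none`, the seller and the buyers in `B` other than
`u` take part in an honest auction in which `u` bids `z`. Every other session `some j` shows an
auction with the participants `X j` to the honest buyer `w j` (all `j` except `j₀`) while the other
participants are simulated and bid `bids j`. The function `block` tells the session of an
identity. -/
structure Attack (a : Auction k) (sec : ℕ) where
  B : Finset (a.Id sec)
  u : a.Id sec
  z : a.domain sec
  n : ℕ
  X : Fin (n + 1) → Finset (a.Id sec)
  w : Fin (n + 1) → a.Id sec
  bids : Fin (n + 1) → a.Values sec
  j₀ : Fin (n + 1)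
  block : a.Id sec → Option (Fin (n + 1))
  mem_B : u ∈ B
  mem_X : ∀ j, w j ∈ X j
  block_B : ∀ i ∈ B, block i = none
  block_X : ∀ j, ∀ i ∈ X j, block i = some j

namespace Attack

variable (t : Attack a sec)

/-- The honest buyers that are shown an auction of their own. -/
def crowd : Finset (a.Id sec) := (Finset.univ.erase t.j₀).image t.w

/-- The honest buyers. -/
def H : Finset (a.Id sec) := t.B.erase t.u ∪ t.crowd

lemma block_w (j : Fin (t.n + 1)) : t.block (t.w j) = some j := t.block_X j _ (t.mem_X j)

lemma w_injective : Function.Injective t.w := fun i j h => by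
  have := congrArg t.block h
  rwa [block_w, block_w, Option.some_inj] at this

lemma w_notMem (j : Fin (t.n + 1)) : t.w j ∉ t.B := fun h => by
  have := t.block_B _ h
  rw [block_w] at this
  cases this

lemma mem_crowd {i : a.Id sec} : i ∈ t.crowd ↔ ∃ j, j ≠ t.j₀ ∧ t.w j = i := by
  simp [crowd]

lemma disjoint_crowd : Disjoint (t.B.erase t.u) t.crowd := by
  refine Finset.disjoint_left.2 fun i hi hc => ?_
  obtain ⟨j, -, rfl⟩ := t.mem_crowd.1 hc
  exact t.w_notMem j (Finset.mem_of_mem_erase hi)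

lemma u_notMem : t.u ∉ t.H := by
  intro h
  rcases Finset.mem_union.1 h with h | h
  · exact Finset.notMem_erase _ _ h
  · obtain ⟨j, -, hj⟩ := t.mem_crowd.1 h
    exact t.w_notMem j (hj ▸ t.mem_B)

lemma card_H_le : t.H.card ≤ t.B.card + t.n := by
  refine (Finset.card_union_le _ _).trans (Nat.add_le_add (Finset.card_erase_le) ?_)
  refine Finset.card_image_le.trans ?_
  rw [Finset.card_erase_of_mem (Finset.mem_univ _)]
  simp

/-- The sessions of the attack. -/
def sessions : Sessions a sec t.H where
  J := Option (Fin (t.n + 1))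
  fintype := inferInstance
  Bs := fun j => j.elim t.B t.X
  bids := fun j => j.elim (fun _ => t.z) t.bids
  σ := fun i => i.elim none fun i => t.block i.1
  mem := by
    rintro ⟨i, hi⟩
    rcases Finset.mem_union.1 hi with h | h
    · have hB := Finset.mem_of_mem_erase h
      show i ∈ (t.block i).elim t.B t.X
      rw [t.block_B i hB]
      exact hB
    · obtain ⟨j, -, rfl⟩ := t.mem_crowd.1 h
      show t.w j ∈ (t.block (t.w j)).elim t.B t.X
      rw [block_w]
      exact t.mem_X j
  eq_of_mem := by
    rintro (_ | j) i hi
    · exact t.block_B _ hi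
    · exact t.block_X j _ hi

lemma card_sessions : Fintype.card t.sessions.J = t.n + 2 := by
  have : Fintype.card t.sessions.J = Fintype.card (Option (Fin (t.n + 1))) := rfl
  rw [this]
  simp

section Payoff

variable (v : a.Values sec) (κ : Bits (Fin (a.setupLen sec)))
  (ω : a.PeerCoins sec t.H t.sessions.announce)
  (τ : Bits (Fin (Fintype.card t.sessions.CoinIndex)))
  {M : Machine (t.sessions.In {t.u}) (a.Wires sec t.H t.sessions.announce)
    (a.Wires sec t.H t.sessions.announce)}

lemma items_pay_of_mem (hseller : a.NoPKI ∨ a.SellerSilent)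
    (hM : ∀ x, (M.toProc x).out = (reactive (t.sessions.step {t.u}) x).out) {i : a.Id sec}
    (hi : i ∈ t.H) {j : Option (Fin (t.n + 1))} (hj : t.block i = j) :
    ((t.sessions.strategy {t.u} M).transcript v κ ω τ).itemsOf {i} =
      (t.sessions.sessionTranscript v κ ω τ j).itemsOf {i} ∧
    ((t.sessions.strategy {t.u} M).transcript v κ ω τ).payOf {i} =
      (t.sessions.sessionTranscript v κ ω τ j).payOf {i} := by
  subst hj
  have h := t.sessions.buyerOut_strategy {t.u} v κ ω τ hseller hM ⟨i, hi⟩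
  have hmem := t.sessions.mem ⟨i, hi⟩
  have hx := Transcript.itemsOf_singleton
    (t.sessions.sessionTranscript v κ ω τ (t.sessions.σ (some ⟨i, hi⟩))) ⟨i, hmem⟩
  have hp := Transcript.payOf_singleton
    (t.sessions.sessionTranscript v κ ω τ (t.sessions.σ (some ⟨i, hi⟩))) ⟨i, hmem⟩
  constructor
  · refine (Transcript.itemsOf_singleton _ ⟨i, hi⟩).trans (Eq.trans ?_ hx.symm)
    unfold Transcript.items
    rw [h]
  · refine (Transcript.payOf_singleton _ ⟨i, hi⟩).trans (Eq.trans ?_ hp.symm)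
    unfold Transcript.pay
    rw [h]

/-- In every execution, the coalition of the platform and `u` gets at least what `u` gets in the
session with the seller, unless some member of the crowd obtains an item; in this case it loses at
most `k + 1`. -/
lemma le_coalitionUtility (ha : a.IsAuction) (hseller : a.NoPKI ∨ a.SellerSilent)
    (hM : ∀ x, (M.toProc x).out = (reactive (t.sessions.step {t.u}) x).out) :
    t.z * ((t.sessions.sessionTranscript v κ ω τ none).itemsOf {t.u} : ℝ) -
        (t.sessions.sessionTranscript v κ ω τ none).payOf {t.u} -
        (k + 1) * ∑ j ∈ Finset.univ.erase t.j₀,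
          ((t.sessions.sessionTranscript v κ ω τ (some j)).itemsOf {t.w j} : ℝ) ≤
      ((t.sessions.strategy {t.u} M).transcript v κ ω τ).coalitionUtility t.H {(t.z : ℝ)} := by
  set T := (t.sessions.strategy {t.u} M).transcript v κ ω τ with hT
  set T₀ := t.sessions.sessionTranscript v κ ω τ none with hT₀
  set c : ℕ := ∑ j ∈ Finset.univ.erase t.j₀,
    (t.sessions.sessionTranscript v κ ω τ (some j)).itemsOf {t.w j} with hc
  have hnone : ∀ i ∈ t.B.erase t.u, i ∈ t.H ∧ t.block i = none := fun i hi =>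
    ⟨Finset.mem_union_left _ hi, t.block_B i (Finset.mem_of_mem_erase hi)⟩
  have hsome : ∀ j ∈ Finset.univ.erase t.j₀, t.w j ∈ t.H ∧ t.block (t.w j) = some j :=
    fun j hj => ⟨Finset.mem_union_right _ (Finset.mem_image_of_mem _ hj), t.block_w j⟩
  have hitems : T.itemsOf t.H = T₀.itemsOf (t.B.erase t.u) + c := by
    show T.itemsOf (t.B.erase t.u ∪ t.crowd) = _
    rw [Transcript.itemsOf_union _ t.disjoint_crowd]
    congr 1
    · rw [Transcript.itemsOf_eq_sum, Transcript.itemsOf_eq_sum T₀]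
      exact Finset.sum_congr rfl fun i hi =>
        (t.items_pay_of_mem v κ ω τ hseller hM (hnone i hi).1 (hnone i hi).2).1
    · rw [Transcript.itemsOf_eq_sum, crowd, Finset.sum_image t.w_injective.injOn]
      exact Finset.sum_congr rfl fun j hj =>
        (t.items_pay_of_mem v κ ω τ hseller hM (hsome j hj).1 (hsome j hj).2).1
  have hpay : T₀.payOf (t.B.erase t.u) ≤ T.payOf t.H := by
    show _ ≤ T.payOf (t.B.erase t.u ∪ t.crowd)
    rw [Transcript.payOf_union _ t.disjoint_crowd, Transcript.payOf_eq_sum T,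
      Transcript.payOf_eq_sum T₀, Finset.sum_congr rfl fun i hi =>
        (t.items_pay_of_mem v κ ω τ hseller hM (hnone i hi).1 (hnone i hi).2).2]
    exact le_add_of_nonneg_right (T.payOf_nonneg _)
  have hsell := t.sessions.sellerOut_strategy {t.u} v κ ω τ hseller hM
  have hsold : T.sold = T₀.sold := by
    unfold Transcript.sold
    rw [hT, hsell]
    rfl
  have hrev : T.sellerRevenue = T₀.sellerRevenue := by
    unfold Transcript.sellerRevenue
    rw [hT, hsell]
    rfl
  have hcons := honest_consistent t.B (t.sessions.sessionBids v none) κ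
    (t.sessions.peerCoins ω τ none) (t.sessions.platCoins τ none) ha
  change T₀.sold = T₀.itemsOf t.B ∧ T₀.sellerRevenue ≤ T₀.payOf t.B at hcons
  have hdisj : Disjoint (t.B.erase t.u) {t.u} :=
    Finset.disjoint_singleton_right.2 (Finset.notMem_erase _ _)
  have hB : t.B.erase t.u ∪ {t.u} = t.B := by
    rw [Finset.union_comm, ← Finset.insert_eq, Finset.insert_erase t.mem_B]
  have hsplit : T₀.itemsOf t.B = T₀.itemsOf (t.B.erase t.u) + T₀.itemsOf {t.u} := by
    rw [← Transcript.itemsOf_union _ hdisj, hB]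
  have hpsplit : T₀.payOf t.B = T₀.payOf (t.B.erase t.u) + T₀.payOf {t.u} := by
    rw [← Transcript.payOf_union _ hdisj, hB]
  have hx1 : T₀.itemsOf {t.u} ≤ 1 := by
    rw [Transcript.itemsOf_singleton T₀ ⟨t.u, t.mem_B⟩]
    exact (honest_rational t.B (t.sessions.sessionBids v none) κ
      (t.sessions.peerCoins ω τ none) (t.sessions.platCoins τ none) ha ⟨t.u, t.mem_B⟩).1
  have hp0 := T₀.payOf_nonneg {t.u}
  have hz := ha.mem_unit sec t.z t.z.2
  have hacc : T.Accepts none ∧ ∀ i : t.H, i.1 ∈ t.H → T.Accepts (some i) :=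
    ⟨(t.sessions.accepts_strategy {t.u} v κ ω τ hseller hM none).2
      ((ha.complete sec _ _ _ _ _).2 _), fun i _ =>
      (t.sessions.accepts_strategy {t.u} v κ ω τ hseller hM (some i)).2
        ((ha.complete sec _ _ _ _ _).2 _)⟩
  rw [← Nat.cast_sum, ← hc]
  have hxR : (T₀.itemsOf {t.u} : ℝ) ≤ 1 := by exact_mod_cast hx1
  have hx0 : (0 : ℝ) ≤ T₀.itemsOf {t.u} := Nat.cast_nonneg _
  have hzx : (t.z : ℝ) * T₀.itemsOf {t.u} ≤ T₀.itemsOf {t.u} :=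
    mul_le_of_le_one_left hx0 hz.2
  have hk0 : (0 : ℝ) ≤ k := Nat.cast_nonneg _
  unfold Transcript.coalitionUtility
  by_cases hsafe : T.Safe t.H
  · rw [if_pos hsafe, hrev, hsold, hcons.1, hitems, hsplit, Nat.add_sub_add_left,
      Multiset.sort_singleton]
    rcases Nat.eq_zero_or_pos c with h0 | hpos
    · rw [h0, Nat.sub_zero]
      have : (([(t.z : ℝ)].take (T₀.itemsOf {t.u})).sum) = t.z * T₀.itemsOf {t.u} := by
        rcases Nat.le_one_iff_eq_zero_or_eq_one.1 hx1 with h | h <;> rw [h] <;> simp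
      rw [this]
      push_cast
      linarith [hcons.2]
    · have hcR : (1 : ℝ) ≤ c := by exact_mod_cast hpos
      have hnn : 0 ≤ ([(t.z : ℝ)].take (T₀.itemsOf {t.u} - c)).sum :=
        List.sum_nonneg fun y hy => by
          rw [List.mem_singleton.1 (List.mem_of_mem_take hy)]
          exact hz.1
      nlinarith [hcons.2]
  · rw [if_neg hsafe]
    have hlt : T₀.itemsOf {t.u} < c := by
      by_contra! hge
      refine hsafe ⟨hacc.1, hacc.2, ?_⟩
      rw [hsold, hcons.1, hitems, hsplit]
      omega
    have hcR : (1 : ℝ) ≤ c := by exact_mod_cast (by omega : 1 ≤ c)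
    nlinarith

/-- The expected payoff of the attack, given the values of the honest buyers. -/
lemma le_utility (ha : a.IsAuction) (hseller : a.NoPKI ∨ a.SellerSilent)
    (hM : ∀ x, (M.toProc x).out = (reactive (t.sessions.step {t.u}) x).out) (hv : v t.u = t.z) :
    t.z * alloc t.B v t.u - price t.B v t.u - (k + 1) * ∑ j ∈ Finset.univ.erase t.j₀,
      alloc (t.X j) (({t.w j} : Finset (a.Id sec)).piecewise v (t.bids j)) (t.w j) ≤
      (t.sessions.strategy {t.u} M).utility v := by
  have h0 : ∀ i ∈ t.B, v i = t.sessions.sessionBids v none i := by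
    intro i hi
    by_cases hH : i ∈ t.H
    · exact (Finset.piecewise_eq_of_mem _ _ _ hH).symm
    · have hu : i = t.u := by
        by_contra hne
        exact hH (Finset.mem_union_left _ (Finset.mem_erase.2 ⟨hne, hi⟩))
      have hs : t.sessions.sessionBids v none i = t.z := Finset.piecewise_eq_of_notMem _ _ _ hH
      rw [hs, hu, hv]
  have hj : ∀ j ∈ Finset.univ.erase t.j₀, ∀ i ∈ t.X j,
      ({t.w j} : Finset (a.Id sec)).piecewise v (t.bids j) i =
        t.sessions.sessionBids v (some j) i := by
    intro j hj i hi
    by_cases hw : i = t.w j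
    · rw [Finset.piecewise_eq_of_mem _ _ _ (Finset.mem_singleton.2 hw)]
      refine (Finset.piecewise_eq_of_mem _ _ _ ?_).symm
      rw [hw]
      exact Finset.mem_union_right _ (Finset.mem_image_of_mem _ hj)
    · rw [Finset.piecewise_eq_of_notMem _ _ _ (Finset.notMem_singleton.2 hw)]
      refine (Finset.piecewise_eq_of_notMem _ _ _ fun hH => ?_).symm
      have hb := t.block_X j i hi
      rcases Finset.mem_union.1 hH with h | h
      · rw [t.block_B i (Finset.mem_of_mem_erase h)] at hb
        cases hb
      · obtain ⟨j', -, rfl⟩ := t.mem_crowd.1 h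
        rw [block_w, Option.some_inj] at hb
        exact hw (hb ▸ rfl)
  have hvals : valuesOf {t.u} v = {(t.z : ℝ)} := by
    simp [valuesOf, hv]
  have e0 : alloc t.B v t.u = _ := (alloc_congr h0).trans
    (t.sessions.expect_sessionTranscript v none fun T => (T.itemsOf {t.u} : ℝ)).symm
  have e1 : price t.B v t.u = _ := (price_congr h0).trans
    (t.sessions.expect_sessionTranscript v none fun T => T.payOf {t.u}).symm
  have e2 : ∀ j ∈ Finset.univ.erase t.j₀,
      alloc (t.X j) (({t.w j} : Finset (a.Id sec)).piecewise v (t.bids j)) (t.w j) = _ :=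
    fun j h => (alloc_congr (hj j h)).trans
      (t.sessions.expect_sessionTranscript v (some j) fun T => (T.itemsOf {t.w j} : ℝ)).symm
  rw [e0, e1, Finset.sum_congr rfl e2]
  simp only [← Finset.expect_sum_comm, Finset.mul_expect, ← Finset.expect_sub_distrib]
  unfold PlatformStrategy.utility
  rw [hvals]
  exact Finset.expect_le_expect fun κ _ => Finset.expect_le_expect fun ω _ =>
    Finset.expect_le_expect fun τ _ => t.le_coalitionUtility v κ ω τ ha hseller hM

/-- The expected payoff of the attack. -/
lemma le_priorExp_utility (D : a.Id sec → PMF (a.domain sec)) (ha : a.IsAuction)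
    (hseller : a.NoPKI ∨ a.SellerSilent)
    (hM : ∀ x, (M.toProc x).out = (reactive (t.sessions.step {t.u}) x).out) :
    interimUtility D (t.B.erase t.u) t.u t.z -
      (k + 1) * ∑ j ∈ Finset.univ.erase t.j₀, priorExp D (fun v =>
        alloc (t.X j) (({t.w j} : Finset (a.Id sec)).piecewise v (t.bids j)) (t.w j)) ≤
      priorExp D fun v =>
        (t.sessions.strategy {t.u} M).utility (Function.update v t.u t.z) := by
  have hX : ∀ j v, alloc (t.X j) (({t.w j} : Finset (a.Id sec)).piecewise v (t.bids j)) (t.w j) =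
      alloc (t.X j) (({t.w j} : Finset (a.Id sec)).piecewise (Function.update v t.u t.z) (t.bids j))
        (t.w j) := by
    intro j v
    refine alloc_congr fun i _ => ?_
    by_cases hi : i = t.w j
    · have hu : i ≠ t.u := fun h => t.w_notMem j (by rw [← hi, h]; exact t.mem_B)
      rw [Finset.piecewise_eq_of_mem _ _ _ (Finset.mem_singleton.2 hi),
        Finset.piecewise_eq_of_mem _ _ _ (Finset.mem_singleton.2 hi), Function.update_of_ne hu]
    · rw [Finset.piecewise_eq_of_notMem _ _ _ (Finset.notMem_singleton.2 hi),
        Finset.piecewise_eq_of_notMem _ _ _ (Finset.notMem_singleton.2 hi)]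
  have hB : t.B.erase t.u ∪ {t.u} = t.B := by
    rw [Finset.union_comm, ← Finset.insert_eq, Finset.insert_erase t.mem_B]
  have h := priorExp_mono (D := D) fun v =>
    t.le_utility (Function.update v t.u t.z) ha hseller hM (Function.update_self _ _ _)
  refine le_trans (le_of_eq ?_) h
  rw [priorExp_sub, priorExp_sub, priorExp_const_mul, priorExp_const_mul, priorExp_sum]
  simp only [← hX]
  unfold interimUtility interimAlloc interimPrice
  rw [hB]

end Payoff

end Attack
/-! ### Choosing the parameters of the attack -/

lemma priorExp_le {D : a.Id sec → PMF (a.domain sec)} (u : a.Id sec) {f : a.Values sec → ℝ} {c : ℝ}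
    (h : ∀ v, f v ≤ c) : priorExp D f ≤ c := by
  have : Nonempty (a.Id sec) := ⟨u⟩
  exact (priorExp_mono h).trans (priorExp_const c).le

/-- If a random variable with values at most `1` has mean at least `δ`, then with probability at
least `δ / 2` the value is no smaller than one at which the variable is at least `δ / 2`. -/
lemma exists_quantile (p : PMF (a.domain sec)) {U : a.domain sec → ℝ} {δ : ℝ} (hδ : 0 < δ)
    (hU : ∀ c, U c ≤ 1) (h : δ ≤ ∑ c, (p c).toReal * U c) :
    ∃ z, δ / 2 ≤ U z ∧ δ / 2 ≤ ∑ c, (p c).toReal * if z ≤ c then 1 else 0 := by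
  have hne : (Finset.univ.filter fun c => δ / 2 ≤ U c).Nonempty := by
    by_contra hempty
    rw [Finset.not_nonempty_iff_eq_empty, Finset.filter_eq_empty_iff] at hempty
    have : ∑ c, (p c).toReal * U c ≤ ∑ c, (p c).toReal * (δ / 2) :=
      Finset.sum_le_sum fun c hc =>
        mul_le_mul_of_nonneg_left (not_le.1 (hempty hc)).le ENNReal.toReal_nonneg
    rw [← Finset.sum_mul, sum_pmf, one_mul] at this
    linarith
  obtain ⟨z, hz, hmin⟩ := Finset.exists_min_image _ id hne
  refine ⟨z, (Finset.mem_filter.1 hz).2, ?_⟩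
  have hle : ∀ c, (p c).toReal * U c ≤
      (p c).toReal * (if z ≤ c then 1 else 0) + (p c).toReal * (δ / 2) := by
    intro c
    rw [← mul_add]
    refine mul_le_mul_of_nonneg_left ?_ ENNReal.toReal_nonneg
    split_ifs with hc
    · linarith [hU c]
    · have : ¬ δ / 2 ≤ U c := fun h' =>
        hc (hmin c (Finset.mem_filter.2 ⟨Finset.mem_univ _, h'⟩))
      linarith
  have hsum := Finset.sum_le_sum fun c (_ : c ∈ Finset.univ) => hle c
  rw [Finset.sum_add_distrib, ← Finset.sum_mul, sum_pmf, one_mul] at hsum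
  linarith

variable {D : a.Id sec → PMF (a.domain sec)}

lemma sum_priorExp_alloc_le (ha : a.IsAuction) (u : a.Id sec) (B : Finset (a.Id sec)) :
    ∑ i ∈ B, priorExp D (fun v => alloc B v i) ≤ k := by
  rw [← priorExp_sum]
  exact priorExp_le u fun v => sum_alloc_le ha subset_rfl

/-- In a set of `m` bidders there is one that obtains an item with probability at most `k / m`, and
the bids of the others can be fixed so that this remains true. -/
lemma exists_small_alloc (ha : a.IsAuction) {X : Finset (a.Id sec)} (hX : X.Nonempty) :
    ∃ w ∈ X, ∃ b : a.Values sec, priorExp D (fun v =>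
      alloc X (({w} : Finset (a.Id sec)).piecewise v b) w) ≤ k / X.card := by
  have hcard : (0 : ℝ) < X.card := by exact_mod_cast hX.card_pos
  obtain ⟨w, hw, hle⟩ : ∃ w ∈ X, priorExp D (fun v => alloc X v w) ≤ k / X.card := by
    obtain ⟨u, hu⟩ := id hX
    refine Finset.exists_le_of_sum_le hX ?_
    refine (sum_priorExp_alloc_le ha u X).trans (le_of_eq ?_)
    rw [Finset.sum_const, nsmul_eq_mul]
    field_simp
  have : Nonempty (a.Id sec) := ⟨w⟩
  rw [← priorExp_resample ({w}ᶜ)] at hle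
  obtain ⟨b, hb⟩ := exists_le_of_priorExp_le hle
  refine ⟨w, hw, b, ?_⟩
  simpa only [Finset.piecewise_compl] using hb

/-- The attack exists if one buyer `u` has a substantial expected utility among the buyers `B`, the
values of all other identities are distributed like the one of `u`, and there are enough
identities: in a crowd with values distributed like the one of `u`, most buyers have hardly any
utility, and `u` is in no better position than they are. -/
lemma exists_attack (ha : a.IsAuction) (hD : ExactBIC D) {B : Finset (a.Id sec)} {u : a.Id sec}
    (hu : u ∈ B) (hDu : ∀ i ∉ B, D i = D u) {δ : ℝ} (hδ : 0 < δ)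
    (hutil : δ ≤ priorExp D fun v => v u * alloc B v u - price B v u) (n m : ℕ)
    (hcard : B.card + (n + 1) * (m + 1) ≤ a.numIds sec) :
    ∃ t : Attack a sec, t.B = B ∧ t.n = n ∧ (∀ j, (t.X j).card = m + 1) ∧
      δ / 2 ≤ interimUtility D (t.B.erase t.u) t.u t.z ∧
      δ / 2 * interimUtility D t.H t.u t.z ≤ k / (n + 1) ∧
      ∑ j ∈ Finset.univ.erase t.j₀, priorExp D (fun v =>
        alloc (t.X j) (({t.w j} : Finset (a.Id sec)).piecewise v (t.bids j)) (t.w j)) ≤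
          n * (k / (m + 1)) := by
  have hBu : B.erase u ∪ {u} = B := by
    rw [Finset.union_comm, ← Finset.insert_eq, Finset.insert_erase hu]
  have hUle : ∀ (H : Finset (a.Id sec)) (i : a.Id sec) (c : a.domain sec),
      interimUtility D H i c ≤ 1 := by
    intro H i c
    have h1 : 0 ≤ interimPrice D H i c :=
      Finset.sum_nonneg fun v _ => mul_nonneg (weight_nonneg v) price_nonneg
    have h2 := mul_le_one₀ (ha.mem_unit sec c c.2).2 interimAlloc_nonneg
      (interimAlloc_le_one (D := D) (H := H) (u := i) (z := c) ha)
    unfold interimUtility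
    linarith
  -- the mean utility of a buyer is the average of its interim utilities
  have hmean : ∀ (H : Finset (a.Id sec)) (i : a.Id sec),
      priorExp D (fun v => v i * alloc (H ∪ {i}) v i - price (H ∪ {i}) v i) =
        ∑ c, (D i c).toReal * interimUtility D H i c := by
    intro H i
    rw [← priorExp_resample_singleton i]
    refine Finset.sum_congr rfl fun c _ => ?_
    simp only [Function.update_self]
    rw [priorExp_sub, priorExp_const_mul]
    rfl
  obtain ⟨z, hz, hprob⟩ := exists_quantile (D u) hδ (hUle (B.erase u) u) (by
    rw [← hmean, hBu]; exact hutil)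
  -- disjoint blocks of identities outside `B`
  obtain ⟨e⟩ : Nonempty (Fin (n + 1) × Fin (m + 1) ↪ {i : a.Id sec // i ∉ B}) := by
    refine Function.Embedding.nonempty_of_card_le ?_
    rw [Fintype.card_prod, Fintype.card_fin, Fintype.card_fin, Fintype.card_subtype_compl,
      Fintype.card_fin, Fintype.card_coe]
    omega
  let X : Fin (n + 1) → Finset (a.Id sec) := fun j => Finset.univ.image fun l => (e (j, l)).1
  have hXinj : ∀ j, Function.Injective fun l => (e (j, l)).1 := fun j l l' h => by
    have := e.injective (Subtype.ext h)
    exact (Prod.mk.inj this).2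
  have hXcard : ∀ j, (X j).card = m + 1 := fun j => by
    rw [Finset.card_image_of_injective _ (hXinj j), Finset.card_univ, Fintype.card_fin]
  have hXne : ∀ j, (X j).Nonempty := fun j => Finset.card_pos.1 (by rw [hXcard]; omega)
  choose w hwX bids hw using fun j => exists_small_alloc (D := D) ha (hXne j)
  classical
  let block : a.Id sec → Option (Fin (n + 1)) := fun i =>
    if h : ∃ p, (e p).1 = i then some h.choose.1 else none
  have hblockB : ∀ i ∈ B, block i = none := fun i hi => dif_neg fun ⟨p, hp⟩ =>
    (e p).2 (hp ▸ hi)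
  have hblockX : ∀ j, ∀ i ∈ X j, block i = some j := by
    intro j i hi
    obtain ⟨l, -, rfl⟩ := Finset.mem_image.1 hi
    have hex : ∃ p, (e p).1 = (e (j, l)).1 := ⟨_, rfl⟩
    have hp : hex.choose = (j, l) := e.injective (Subtype.ext hex.choose_spec)
    show dite _ _ _ = _
    rw [dif_pos hex, hp]
  -- the buyer whose place `u` takes
  let T : Fin (n + 1) → Attack a sec := fun j₀ =>
    ⟨B, u, z, n, X, w, bids, j₀, block, hu, hwX, hblockB, hblockX⟩
  have hHw : ∀ j, (T j).H ∪ {w j} = B.erase u ∪ Finset.univ.image w := by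
    intro j
    show (B.erase u ∪ (Finset.univ.erase j).image w) ∪ {w j} = _
    rw [Finset.union_assoc, Finset.union_comm _ {w j}, ← Finset.insert_eq, ← Finset.image_insert,
      Finset.insert_erase (Finset.mem_univ _)]
  have hwH : ∀ j, w j ∉ (T j).H := by
    intro j h
    rcases Finset.mem_union.1 h with h | h
    · exact (T j).w_notMem j (Finset.mem_of_mem_erase h)
    · obtain ⟨j', hne, heq⟩ := (T j).mem_crowd.1 h
      exact hne ((T j).w_injective heq)
  set C := B.erase u ∪ Finset.univ.image w with hC
  obtain ⟨j₀, -, hj₀⟩ : ∃ j ∈ (Finset.univ : Finset (Fin (n + 1))),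
      priorExp D (fun v => v (w j) * alloc C v (w j) - price C v (w j)) ≤ k / (n + 1) := by
    refine Finset.exists_le_of_sum_le Finset.univ_nonempty ?_
    have h1 : ∀ j, priorExp D (fun v => v (w j) * alloc C v (w j) - price C v (w j)) ≤
        priorExp D (fun v => alloc C v (w j)) := fun j => priorExp_mono fun v => by
      have h1 := mul_le_of_le_one_left (alloc_nonneg (B := C) (b := v) (u := w j))
        (ha.mem_unit sec _ (v (w j)).2).2
      have h2 := price_nonneg (B := C) (b := v) (u := w j)
      linarith
    refine (Finset.sum_le_sum fun j _ => h1 j).trans ?_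
    have h2 : ∑ j, priorExp D (fun v => alloc C v (w j)) ≤
        ∑ i ∈ C, priorExp D (fun v => alloc C v i) := by
      rw [← Finset.sum_image (f := fun i => priorExp D fun v => alloc C v i)
        (T 0).w_injective.injOn]
      exact Finset.sum_le_sum_of_subset_of_nonneg Finset.subset_union_right fun i _ _ =>
        Finset.sum_nonneg fun v _ => mul_nonneg (weight_nonneg v) alloc_nonneg
    refine h2.trans ((sum_priorExp_alloc_le ha u C).trans (le_of_eq ?_))
    rw [Finset.sum_const, Finset.card_univ, Fintype.card_fin, nsmul_eq_mul]
    push_cast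
    field_simp
  refine ⟨T j₀, rfl, rfl, hXcard, hz, ?_, ?_⟩
  · have h1 : interimUtility D (T j₀).H u z ≤ interimUtility D (T j₀).H (w j₀) z :=
      hD.interimUtility_le ha (hwH j₀) (T j₀).u_notMem z
    rw [← hHw j₀, hmean, hDu _ ((T j₀).w_notMem j₀)] at hj₀
    have h0 : 0 ≤ interimUtility D (T j₀).H (w j₀) z := interimUtility_nonneg ha
    have h2 : δ / 2 * interimUtility D (T j₀).H (w j₀) z ≤
        (∑ c, (D u c).toReal * if z ≤ c then 1 else 0) * interimUtility D (T j₀).H (w j₀) z :=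
      mul_le_mul_of_nonneg_right hprob h0
    have h3 : (∑ c, (D u c).toReal * if z ≤ c then 1 else 0) *
        interimUtility D (T j₀).H (w j₀) z ≤
          ∑ c, (D u c).toReal * interimUtility D (T j₀).H (w j₀) c := by
      rw [Finset.sum_mul]
      refine Finset.sum_le_sum fun c _ => ?_
      rw [mul_assoc]
      refine mul_le_mul_of_nonneg_left ?_ ENNReal.toReal_nonneg
      split_ifs with hc
      · rw [one_mul]
        exact hD.interimUtility_mono ha (hwH j₀) hc
      · rw [zero_mul]
        exact interimUtility_nonneg ha
    exact (mul_le_mul_of_nonneg_left h1 (half_pos hδ).le).trans (h2.trans (h3.trans hj₀))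
  · have hle : ∀ j, priorExp D (fun v =>
        alloc (X j) (({w j} : Finset (a.Id sec)).piecewise v (bids j)) (w j)) ≤
          (k : ℝ) / (m + 1) := by
      intro j
      have := hw j
      rw [hXcard j] at this
      exact_mod_cast this
    have hsum := Finset.sum_le_card_nsmul (Finset.univ.erase j₀) _ _ fun j _ => hle j
    rwa [Finset.card_erase_of_mem (Finset.mem_univ _), Finset.card_univ, Fintype.card_fin,
      nsmul_eq_mul, Nat.add_sub_cancel] at hsum

end Auction
/-! ### Asymptotics -/

lemma Negligible.eventually_lt {ε : ℕ → ℝ} (hε : Negligible ε) {Q : Polynomial ℕ}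
    (hQ : ∀ m, 0 < Q.eval m) : ∀ᶠ sec in Filter.atTop, ε sec < 1 / ((Q.eval sec : ℕ) : ℝ) := by
  have h := hε.2 (Q.map (Nat.castRingHom ℝ)) fun m => by
    rw [Polynomial.eval_natCast_map]
    simpa using hQ m
  filter_upwards [h] with sec hsec
  rw [Polynomial.eval_natCast_map] at hsec
  simpa using hsec

/-- Every real polynomial is bounded on the natural numbers by one with natural coefficients. -/
lemma exists_natPoly_ge (q : Polynomial ℝ) :
    ∃ Q : Polynomial ℕ, ∀ m : ℕ, q.eval (m : ℝ) ≤ ((Q.eval m : ℕ) : ℝ) := by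
  induction q using Polynomial.induction_on' with
  | add p q hp hq =>
    obtain ⟨P, hP⟩ := hp
    obtain ⟨Q, hQ⟩ := hq
    refine ⟨P + Q, fun m => ?_⟩
    rw [Polynomial.eval_add, Polynomial.eval_add]
    push_cast
    exact add_le_add (hP m) (hQ m)
  | monomial n c =>
    refine ⟨Polynomial.monomial n ⌈c⌉₊, fun m => ?_⟩
    rw [Polynomial.eval_monomial, Polynomial.eval_monomial]
    push_cast
    exact mul_le_mul_of_nonneg_right (Nat.le_ceil c) (by positivity)

namespace Auction

variable {k : ℕ} {a : Auction k} {sec : ℕ}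

/-- A buyer with at least the average utility. -/
lemma exists_buyer_of_le_sum {B : Finset (a.Id sec)} {g : a.Id sec → ℝ} {c : ℝ} (hc : 0 < c)
    (h : c ≤ ∑ i ∈ B, g i) {N : ℕ} (hN : B.card ≤ N) : ∃ u ∈ B, c / (N + 1) ≤ g u := by
  have hne : B.Nonempty := by
    by_contra h0
    rw [Finset.not_nonempty_iff_eq_empty.1 h0, Finset.sum_empty] at h
    linarith
  refine Finset.exists_le_of_sum_le hne (le_trans ?_ h)
  rw [Finset.sum_const, nsmul_eq_mul]
  have hB : (B.card : ℝ) ≤ N + 1 := by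
    have : (B.card : ℝ) ≤ N := by exact_mod_cast hN
    linarith
  have : (0 : ℝ) < N + 1 := by positivity
  calc (B.card : ℝ) * (c / (N + 1)) ≤ (N + 1) * (c / (N + 1)) :=
        mul_le_mul_of_nonneg_right hB (by positivity)
    _ = c := by field_simp

/-- The strategy of a platform that never sends anything. -/
def idleStrategy (H A : Finset (a.Id sec)) : a.PlatformStrategy sec H A where
  fakes := ∅
  disjoint := Finset.disjoint_empty_right H
  announce := fun _ => 0
  coins := 0
  machine := ⟨0, fun _ => ⟨[], fun _ => Sum.inr 0⟩⟩

lemma idleStrategy_bounded (H A : Finset (a.Id sec)) (b : ℕ) :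
    (idleStrategy H A).Bounded b :=
  ⟨Nat.zero_le _, fun _ => Nat.zero_le _, Nat.zero_le _, Nat.zero_le _, fun _ => Nat.zero_le _⟩

/-- The attack is run by a strategy of polynomial size. -/
lemma Attack.exists_strategy (t : Attack a sec) (ha : a.IsAuction)
    (hseller : a.NoPKI ∨ a.SellerSilent) {P : Polynomial ℕ}
    (hlen : ∀ sec N, a.rounds sec N ≤ P.eval (sec + N) ∧ a.msgLen sec N ≤ P.eval (sec + N) ∧
      a.coinLen sec N ≤ P.eval (sec + N) ∧
      (∀ i v, (a.buyer sec N i v).Bounded (P.eval (sec + N))) ∧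
      (a.seller sec N).Bounded (P.eval (sec + N)))
    (hplat : ∀ sec (B : Finset (a.Id sec)), (a.platform sec B).Bounded (P.eval (sec + B.card)))
    {m : ℕ} (hB : t.B.card ≤ m) (hX : ∀ j, (t.X j).card ≤ m)
    (D : a.Id sec → PMF (a.domain sec)) :
    ∃ S : a.PlatformStrategy sec t.H {t.u},
      S.Bounded (m + (t.n + 2) * ((2 * m + 3) * (P.eval (sec + m) + 1))) ∧
      interimUtility D (t.B.erase t.u) t.u t.z -
        (k + 1) * ∑ j ∈ Finset.univ.erase t.j₀, priorExp D (fun v =>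
          alloc (t.X j) (({t.w j} : Finset (a.Id sec)).piecewise v (t.bids j)) (t.w j)) ≤
        priorExp D fun v => S.utility (Function.update v t.u t.z) := by
  obtain ⟨T, hb, hT⟩ := t.sessions.exists_bounded_strategy {t.u} hlen hplat (m := m) (by
    rintro (_ | j)
    · exact hB
    · exact hX j)
  rw [t.card_sessions] at hb
  exact ⟨_, hb, t.le_priorExp_utility D ha hseller hT⟩

/-- An auction in which truthful bidding is optimal, the platform earns a negligible amount, and
some buyer has a substantial utility, is not computationally incentive compatible for the platform
together with one buyer. -/
lemma not_computationalPBIC (ha : a.IsAuction) (hppt : a.IsPPT)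
    (hseller : a.NoPKI ∨ a.SellerSilent)
    (htick : ∃ ε, Negligible ε ∧ ∀ sec, tick (a.domain sec) ≤ ε sec)
    (D : ∀ sec, a.Id sec → PMF (a.domain sec)) (hD : ∀ sec, ExactBIC (D sec))
    (hsurplus : ∀ sec (H : Finset (a.Id sec)) (u : a.Id sec) (w : a.domain sec), u ∉ H →
      interimSurplus (D sec) H u w ≤ (H.card + 1) * tick (a.domain sec))
    (L P₀ : Polynomial ℕ) (hL : ∀ m, 0 < L.eval m)
    (hutil : ∃ᶠ sec in Filter.atTop, ∃ (B : Finset (a.Id sec)) (u : a.Id sec), u ∈ B ∧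
      B.card ≤ P₀.eval sec ∧ (∀ i ∉ B, D sec i = D sec u) ∧
      1 / ((L.eval sec : ℕ) : ℝ) ≤ priorExp (D sec) fun v => v u * alloc B v u - price B v u)
    (hIC : ∀ n : ℕ → ℕ, PolyBounded n →
      ∀ S : ∀ sec (H A : Finset (a.Id sec)), a.PlatformStrategy sec H A,
      (∃ P : Polynomial ℕ, ∀ sec H A, (S sec H A).Bounded (P.eval sec)) →
      ∃ ε, Negligible ε ∧ ∀ sec (H : Finset (a.Id sec)) (u : a.Id sec) (w : a.domain sec),
        H.card ≤ n sec → u ∉ H →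
        priorExp (D sec) (fun v => (S sec H {u}).utility (Function.update v u w)) ≤
          priorExp (D sec) (fun v => coalitionHonest H {u} (Function.update v u w)) + ε sec) :
    False := by
  obtain ⟨P, -, hlen, hplat⟩ := hppt
  obtain ⟨εt, hεt, htick⟩ := htick
  -- the number of honest buyers in the crowd, and of participants in each of their sessions
  let n : Polynomial ℕ := 16 * (Polynomial.C k + 1) * L ^ 2
  let m : Polynomial ℕ := 8 * L * (Polynomial.C k + 1) ^ 2 * n
  let M : Polynomial ℕ := P₀ + m + 1
  let bound : Polynomial ℕ := M + (n + 2) * ((2 * M + 3) * (P.comp (Polynomial.X + M) + 1))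
  have hn : ∀ sec, n.eval sec = 16 * (k + 1) * L.eval sec ^ 2 := fun sec => by simp [n]
  have hm : ∀ sec, m.eval sec = 8 * L.eval sec * (k + 1) ^ 2 * n.eval sec := fun sec => by
    simp [m]
  have hM : ∀ sec, M.eval sec = P₀.eval sec + m.eval sec + 1 := fun sec => by simp [M]
  have hbound : ∀ sec, bound.eval sec = M.eval sec + (n.eval sec + 2) *
      ((2 * M.eval sec + 3) * (P.eval (sec + M.eval sec) + 1)) := fun sec => by
    simp [bound, Polynomial.eval_comp]
  let good : ∀ sec, Attack a sec → Prop := fun sec t =>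
    t.B.card ≤ P₀.eval sec ∧ t.n = n.eval sec ∧ (∀ j, (t.X j).card = m.eval sec + 1) ∧
    1 / ((L.eval sec : ℕ) : ℝ) / 2 ≤ interimUtility (D sec) (t.B.erase t.u) t.u t.z ∧
    1 / ((L.eval sec : ℕ) : ℝ) / 2 * interimUtility (D sec) t.H t.u t.z ≤ k / (n.eval sec + 1) ∧
    ∑ j ∈ Finset.univ.erase t.j₀, priorExp (D sec) (fun v =>
      alloc (t.X j) (({t.w j} : Finset (a.Id sec)).piecewise v (t.bids j)) (t.w j)) ≤
        n.eval sec * (k / (m.eval sec + 1))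
  have hS : ∀ sec (H A : Finset (a.Id sec)), ∃ S : a.PlatformStrategy sec H A,
      S.Bounded (bound.eval sec) ∧ ((∃ t, good sec t ∧ t.H = H ∧ {t.u} = A) →
        ∃ t, good sec t ∧ t.H = H ∧ {t.u} = A ∧
          interimUtility (D sec) (t.B.erase t.u) t.u t.z -
            (k + 1) * ∑ j ∈ Finset.univ.erase t.j₀, priorExp (D sec) (fun v =>
              alloc (t.X j) (({t.w j} : Finset (a.Id sec)).piecewise v (t.bids j)) (t.w j)) ≤
            priorExp (D sec) fun v => S.utility (Function.update v t.u t.z)) := by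
    intro sec H A
    by_cases h : ∃ t, good sec t ∧ t.H = H ∧ {t.u} = A
    · obtain ⟨t, ht, rfl, rfl⟩ := id h
      obtain ⟨S, hb, hle⟩ := t.exists_strategy ha hseller hlen hplat (m := M.eval sec)
        (by have := ht.1; rw [hM]; omega) (fun j => (ht.2.2.1 j).le.trans (by rw [hM]; omega))
        (D sec)
      rw [ht.2.1, ← hbound] at hb
      exact ⟨S, hb, fun _ => ⟨t, ht, rfl, rfl, hle⟩⟩
    · exact ⟨idleStrategy H A, idleStrategy_bounded H A _, fun h' => absurd h' h⟩
  choose S hSb hSt using hS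
  obtain ⟨ε, hε, hle⟩ := hIC (fun sec => P₀.eval sec + n.eval sec)
    ⟨P₀ + n, fun sec => by simp⟩ S ⟨bound, hSb⟩
  have hids := ha.many_ids (P₀ + (n + 1) * (m + 1))
  have hε' := hε.eventually_lt (Q := 16 * L) fun m => by
    have := hL m
    simp only [Polynomial.eval_mul, Polynomial.eval_ofNat]
    omega
  have hεt' := hεt.eventually_lt (Q := 16 * L * (P₀ + n + 1)) fun m => by
    have := hL m
    simp only [Polynomial.eval_mul, Polynomial.eval_ofNat, Polynomial.eval_add,
      Polynomial.eval_one]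
    positivity
  obtain ⟨sec, ⟨B, u, hu, hB, hDu, hδ⟩, hids, hε', hεt'⟩ :=
    (hutil.and_eventually (hids.and (hε'.and hεt'))).exists
  have hl : (0 : ℝ) < ((L.eval sec : ℕ) : ℝ) := by exact_mod_cast hL sec
  obtain ⟨t₀, ht₀B, ht₀⟩ := exists_attack ha (hD sec) hu hDu (one_div_pos.2 hl) hδ
    (n.eval sec) (m.eval sec) (by
      simp only [Polynomial.eval_add, Polynomial.eval_mul, Polynomial.eval_one] at hids
      omega)
  obtain ⟨t, ⟨h1, h2, -, h4, h5, h6⟩, htH, htu, h8⟩ := hSt sec t₀.H {t₀.u}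
    ⟨t₀, ⟨ht₀B ▸ hB, ht₀⟩, rfl, rfl⟩
  rw [← htH, ← htu] at h8
  have hcard : t.H.card ≤ P₀.eval sec + n.eval sec := by
    have := t.card_H_le
    omega
  have h9 := hle sec t.H t.u t.z hcard t.u_notMem
  rw [priorExp_coalitionHonest ha t.u_notMem] at h9
  have h10 := hsurplus sec t.H t.u t.z t.u_notMem
  -- the four error terms
  have hk : (0 : ℝ) ≤ k := Nat.cast_nonneg k
  have hnR : ((n.eval sec : ℕ) : ℝ) = 16 * (k + 1) * ((L.eval sec : ℕ) : ℝ) ^ 2 := by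
    rw [hn]; push_cast; ring
  have hmR : ((m.eval sec : ℕ) : ℝ) =
      8 * ((L.eval sec : ℕ) : ℝ) * (k + 1) ^ 2 * ((n.eval sec : ℕ) : ℝ) := by
    rw [hm]; push_cast; ring
  have hQ : (((16 * L * (P₀ + n + 1)).eval sec : ℕ) : ℝ) = 16 * ((L.eval sec : ℕ) : ℝ) *
      (((P₀.eval sec : ℕ) : ℝ) + ((n.eval sec : ℕ) : ℝ) + 1) := by
    simp only [Polynomial.eval_mul, Polynomial.eval_ofNat, Polynomial.eval_add,
      Polynomial.eval_one]
    push_cast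
    ring
  have hQ' : (((16 * L).eval sec : ℕ) : ℝ) = 16 * ((L.eval sec : ℕ) : ℝ) := by
    simp only [Polynomial.eval_mul, Polynomial.eval_ofNat]
    push_cast
    ring
  rw [hQ] at hεt'
  rw [hQ'] at hε'
  have hcardR : (t.H.card : ℝ) ≤ ((P₀.eval sec : ℕ) : ℝ) + ((n.eval sec : ℕ) : ℝ) := by
    exact_mod_cast hcard
  have hP0 : (0 : ℝ) ≤ ((P₀.eval sec : ℕ) : ℝ) := Nat.cast_nonneg _
  have hn0 : (0 : ℝ) ≤ ((n.eval sec : ℕ) : ℝ) := Nat.cast_nonneg _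
  generalize ((L.eval sec : ℕ) : ℝ) = l at *
  generalize ((n.eval sec : ℕ) : ℝ) = x at *
  generalize ((m.eval sec : ℕ) : ℝ) = y at *
  generalize ((P₀.eval sec : ℕ) : ℝ) = p at *
  have e1 : interimUtility (D sec) t.H t.u t.z ≤ 1 / (8 * l) := by
    have hq : (k : ℝ) / (x + 1) ≤ 1 / (16 * l ^ 2) := by
      rw [div_le_div_iff₀ (by linarith) (by positivity), hnR]
      nlinarith [sq_nonneg l]
    have h := mul_le_mul_of_nonneg_left (h5.trans hq) (by positivity : (0 : ℝ) ≤ 2 * l)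
    calc interimUtility (D sec) t.H t.u t.z
        = 2 * l * (1 / l / 2 * interimUtility (D sec) t.H t.u t.z) := by field_simp
      _ ≤ 2 * l * (1 / (16 * l ^ 2)) := h
      _ = 1 / (8 * l) := by field_simp; norm_num
  have e2 : ((k : ℝ) + 1) * (x * (k / (y + 1))) ≤ 1 / (8 * l) := by
    have hy : 0 ≤ y := by rw [hmR]; positivity
    rw [← mul_div_assoc, ← mul_div_assoc, div_le_div_iff₀ (by linarith) (by positivity), hmR]
    have : 0 ≤ l * x * (k + 1) := by positivity
    nlinarith
  have e3 : ((t.H.card : ℝ) + 1) * tick (a.domain sec) ≤ 1 / (16 * l) := by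
    have ht : tick (a.domain sec) ≤ 1 / (16 * l * (p + x + 1)) := (htick sec).trans hεt'.le
    calc ((t.H.card : ℝ) + 1) * tick (a.domain sec)
        ≤ (p + x + 1) * (1 / (16 * l * (p + x + 1))) :=
          mul_le_mul (by linarith) ht (tick_nonneg _) (by linarith)
      _ = 1 / (16 * l) := by
          have : p + x + 1 ≠ 0 := by linarith
          field_simp
  have e4 := mul_le_mul_of_nonneg_left h6 (by linarith : (0 : ℝ) ≤ k + 1)
  have r1 : 1 / (8 * l) = 2 * (1 / (16 * l)) := by field_simp; norm_num
  have r2 : 1 / l / 2 = 8 * (1 / (16 * l)) := by field_simp; norm_num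
  have r3 : 0 < 1 / (16 * l) := by positivity
  linarith

/-! ### The ex post and the Bayesian setting -/

lemma StrongBIC.exactBIC (h : a.StrongBIC) (D : a.Id sec → PMF (a.domain sec)) : ExactBIC D :=
  fun H u C b w hu hC => priorExp_mono fun v => h.2 sec H u C b (Function.update v u w) hu hC

lemma StrongPBIC.exactPBIC (h : a.StrongPBIC 1) (D : a.Id sec → PMF (a.domain sec)) :
    ExactPBIC D := fun H u C b w hu hC => priorExp_mono fun v =>
  h.2 sec H {u} C b (Function.update v u w) (by simp) (Finset.disjoint_singleton_right.2 hu) hC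

lemma StrongBayesPBIC.exactPBIC {D : ∀ sec, PMF (a.domain sec)} (h : a.StrongBayesPBIC D 1) :
    ExactPBIC fun _ : a.Id sec => D sec := by
  intro H u C b w hu hC
  have := h.2 sec H {u} C b (fun _ => w) (by simp) (Finset.disjoint_singleton_right.2 hu) hC
  simp only [Finset.piecewise_singleton] at this
  exact this

lemma honestExp_sum_buyerUtility (ha : a.IsAuction) (B : Finset (a.Id sec)) (v : a.Values sec) :
    honestExp B v (fun T => ∑ i ∈ B, T.buyerUtility {i} (v i)) =
      ∑ i ∈ B, (v i * alloc B v i - price B v i) := by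
  rw [honestExp_sum]
  exact Finset.sum_congr rfl fun i hi => honestExp_buyerUtility ha hi _

/-- The polynomials that bound the number of buyers and the inverse of the utility of one of
them. -/
lemma exists_polynomials {q : Polynomial ℝ} (hq : ∀ m : ℕ, 0 < q.eval (m : ℝ)) {n : ℕ → ℕ}
    (hn : PolyBounded n) : ∃ L P : Polynomial ℕ, (∀ m, 0 < L.eval m) ∧ (∀ sec, n sec ≤ P.eval sec) ∧
      ∀ sec, 1 / ((L.eval sec : ℕ) : ℝ) ≤ 1 / q.eval (sec : ℝ) / (((P.eval sec : ℕ) : ℝ) + 1) := by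
  obtain ⟨P, hP⟩ := hn
  obtain ⟨Q, hQ⟩ := exists_natPoly_ge q
  have hQpos : ∀ m, 0 < Q.eval m := fun m => by exact_mod_cast (hq m).trans_le (hQ m)
  have hL : ∀ m, (Q * (P + 1)).eval m = Q.eval m * (P.eval m + 1) := fun m => by simp
  refine ⟨Q * (P + 1), P, fun m => ?_, hP, fun sec => ?_⟩
  · rw [hL]
    exact Nat.mul_pos (hQpos m) (Nat.succ_pos _)
  · rw [hL, div_div]
    push_cast
    exact one_div_le_one_div_of_le (mul_pos (hq sec) (by positivity))
      (mul_le_mul_of_nonneg_right (hQ sec) (by positivity))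

/-- The ex post case: the buyers in `B` have the values for which the auction is non-trivial, and
all other identities the same value as the buyer `u` with a substantial utility. -/
lemma not_strongBIC_and_strongPBIC (ha : a.IsAuction) (hppt : a.IsPPT)
    (hseller : a.NoPKI ∨ a.SellerSilent)
    (htick : ∃ ε, Negligible ε ∧ ∀ sec, tick (a.domain sec) ≤ ε sec) (h : a.NonTrivial) :
    ¬ (a.StrongBIC ∧ a.StrongPBIC 1) := by
  rintro ⟨hB, hPB⟩
  obtain ⟨q, hq, n, hn, hfreq⟩ := h
  obtain ⟨L, P, hL, hP, hLP⟩ := exists_polynomials hq hn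
  let good : ∀ sec, Finset (a.Id sec) × a.Id sec → a.Values sec → Prop := fun sec p v =>
    p.2 ∈ p.1 ∧ p.1.card ≤ P.eval sec ∧ (∀ i ∉ p.1, v i = v p.2) ∧
      1 / ((L.eval sec : ℕ) : ℝ) ≤ v p.2 * alloc p.1 v p.2 - price p.1 v p.2
  have hgood : ∃ᶠ sec in Filter.atTop, ∃ v p, good sec p v := by
    refine hfreq.mono ?_
    rintro sec ⟨B, v, hcard, hle⟩
    rw [honestExp_sum_buyerUtility ha] at hle
    obtain ⟨u, hu, hutil⟩ := exists_buyer_of_le_sum (one_div_pos.2 (hq sec)) hle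
      (hcard.trans (hP sec))
    have hagree : ∀ i ∈ B, v i = B.piecewise v (fun _ => v u) i := fun i hi =>
      (Finset.piecewise_eq_of_mem _ _ _ hi).symm
    refine ⟨B.piecewise v fun _ => v u, (B, u), hu, hcard.trans (hP sec), fun i hi => ?_, ?_⟩
    · show B.piecewise v (fun _ => v u) i = B.piecewise v (fun _ => v u) u
      rw [Finset.piecewise_eq_of_notMem _ _ _ hi, Finset.piecewise_eq_of_mem _ _ _ hu]
    · refine (hLP sec).trans (hutil.trans (le_of_eq ?_))
      show _ = (B.piecewise v (fun _ => v u) u : ℝ) * alloc B _ u - price B _ u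
      rw [← alloc_congr hagree, ← price_congr hagree, ← hagree u hu]
  classical
  have hval : ∀ sec, ∃ v : a.Values sec, (∃ v p, good sec p v) → ∃ p, good sec p v := by
    intro sec
    by_cases h : ∃ v p, good sec p v
    · obtain ⟨v, hv⟩ := h
      exact ⟨v, fun _ => hv⟩
    · exact ⟨fun _ => zeroValue ha sec, fun h' => absurd h' h⟩
  choose v hv using hval
  refine not_computationalPBIC ha hppt hseller htick (fun sec i => PMF.pure (v sec i))
    (fun sec => hB.exactBIC _) (fun sec H u w hu => ?_) L P hL (hgood.mono fun sec h => ?_) ?_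
  · unfold interimSurplus
    rw [priorExp_pure]
    refine (surplus_le_of_exPost ha (fun _ => hB.exactBIC _) (fun _ => hPB.exactPBIC _) _ _).trans
      (le_of_eq ?_)
    rw [Finset.card_union_of_disjoint (Finset.disjoint_singleton_right.2 hu),
      Finset.card_singleton]
    push_cast
    rfl
  · obtain ⟨⟨B, u⟩, h1, h2, h3, h4⟩ := hv sec h
    refine ⟨B, u, h1, h2, fun i hi => by rw [h3 i hi], ?_⟩
    rw [priorExp_pure]
    exact h4
  · intro n hn S ⟨Q, hS⟩
    obtain ⟨ε, hε, hle⟩ := hPB.1 n hn S ⟨Q, fun sec H A _ _ => hS sec H A⟩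
    refine ⟨ε, hε, fun sec H u w hH hu => ?_⟩
    rw [priorExp_pure, priorExp_pure]
    exact hle sec H {u} _ hH (by simp) (Finset.disjoint_singleton_right.2 hu)

/-- The Bayesian case: all identities have the same distribution of values, and the bound on the
revenue of the platform rests on the incentives of the platform alone as well. -/
lemma not_strongBayes (ha : a.IsAuction) (hppt : a.IsPPT) (hseller : a.NoPKI ∨ a.SellerSilent)
    (htick : ∃ ε, Negligible ε ∧ ∀ sec, tick (a.domain sec) ≤ ε sec)
    (D : ∀ sec, PMF (a.domain sec)) (h : a.BayesNonTrivial D) :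
    ¬ (a.StrongBayesBIC D ∧ a.StrongBayesPIC D ∧ a.StrongBayesPBIC D 1) := by
  rintro ⟨hB, hPI, hPB⟩
  obtain ⟨q, hq, n, hn, hfreq⟩ := h
  obtain ⟨L, P, hL, hP, hLP⟩ := exists_polynomials hq hn
  have hBE : ∀ sec, ExactBIC fun _ : a.Id sec => D sec := fun sec => hB.2 sec
  refine not_computationalPBIC ha hppt hseller htick (fun sec _ => D sec) hBE
    (fun sec H u w hu => ?_) L P hL (hfreq.mono ?_) ?_
  · refine interimSurplus_le_of_bayes ha (hBE sec) hPB.exactPBIC (fun H C b hC => ?_) hu w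
    have := hPI.2 sec H ∅ C b (fun _ => w) rfl (Finset.disjoint_empty_right H) hC
    simp only [Finset.piecewise_empty] at this
    exact this
  · rintro sec ⟨B, hcard, hle⟩
    simp only [honestExp_sum_buyerUtility ha] at hle
    rw [show valueExp (D sec) (fun v => ∑ i ∈ B, (v i * alloc B v i - price B v i)) =
      ∑ i ∈ B, priorExp (fun _ => D sec) (fun v => v i * alloc B v i - price B v i) from
        priorExp_sum B _] at hle
    obtain ⟨u, hu, hutil⟩ := exists_buyer_of_le_sum (one_div_pos.2 (hq sec)) hle
      (hcard.trans (hP sec))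
    exact ⟨B, u, hu, hcard.trans (hP sec), fun _ _ => rfl, (hLP sec).trans hutil⟩
  · intro n hn S ⟨Q, hS⟩
    obtain ⟨ε, hε, hle⟩ := hPB.1 n hn S ⟨Q, fun sec H A _ _ => hS sec H A⟩
    refine ⟨ε, hε, fun sec H u w hH hu => ?_⟩
    have := hle sec H {u} (fun _ => w) hH (by simp) (Finset.disjoint_singleton_right.2 hu)
    simp only [Finset.piecewise_singleton] at this
    exact this

end Auction
end PlatformAuction

theorem mainTheorem4 {k : ℕ} (a : PlatformAuction.Auction k) (hauction : a.IsAuction)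
    (hppt : a.IsPPT) (hseller : a.NoPKI ∨ a.SellerSilent)
    (htick : ∃ ε, PlatformAuction.Negligible ε ∧
      ∀ sec, PlatformAuction.tick (a.domain sec) ≤ ε sec) :
    (a.NonTrivial → ¬ (a.StrongBIC ∧ a.StrongPBIC 1)) ∧
    (∀ D : ∀ sec, PMF (a.domain sec), a.BayesNonTrivial D →
      ¬ (a.StrongBayesBIC D ∧ a.StrongBayesPIC D ∧ a.StrongBayesPBIC D 1)) :=
  ⟨PlatformAuction.Auction.not_strongBIC_and_strongPBIC hauction hppt hseller htick,
    PlatformAuction.Auction.not_strongBayes hauction hppt hseller htick⟩
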